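/- **Setting.** Let $n\ge 1$, $\omega=e^{2\pi i/n}$, and let $\Gamma=\langle\gamma\rangle$ be cyclic of order $n$. Let $\mathcal D=\mathbb C[\partial,y^{\pm1}]*\Gamma$ be the crossed product of the localized first Weyl algebra ($\partial y-y\partial=1$) with $\Gamma$, where $y\gamma=\omega\gamma y$ and $\gamma\partial=\omega\partial\gamma$. Put $e_i=\frac1n\sum_{j=0}^{n-1}(\omega^i\gamma)^j$ and $e=e_0$. For $\mathbf k=(k_1,\dots,k_{n-1})\in\mathbb C^{n-1}$ put $d_{\mathbf k}=\partial-y^{-1}\sum_{i=1}^{n-1}k_ie_i$, let $H_{\mathbf k}\subseteq\mathcal D$ be the subalgebra generated by $d_{\mathbf k},y,\Gamma$, and $U_{\mathbf k}=eH_{\mathbf k}e$. Let $\mathbf v_1,\dots,\mathbf v_{n-1}$ be the standard basis, $\mathbf w_p=n(\mathbf v_1+\dots+\mathbf v_p)$, and $F(\mathbf b)=\sum_p b_p\mathbf w_p$ for $\mathbf b\in\mathbb N^{n-1}$; write $\mathbf r'\ge\mathbf r$ if $\mathbf r'-\mathbf r\in F(\mathbb N^{n-1})$. Put $B(\mathbf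 k+\mathbf w_p,\mathbf k)=eH_{\mathbf k+\mathbf w_p}e_py^p$ and $B(\mathbf r,\mathbf r)=U_{\mathbf r}$. For $\mathbf r'\ge\mathbf r$ choose a chain $\mathbf r=\mathbf r_0,\dots,\mathbf r_s=\mathbf r'$ whose successive differences are vectors $\mathbf w_p$, and put $B(\mathbf r',\mathbf r)=B(\mathbf r_s,\mathbf r_{s-1})\cdots B(\mathbf r_1,\mathbf r_0)\subseteq e\mathcal De$. Put $a_i=(n-i+k_i)/n$ for $1\le i\le n-1$ and $a_n=0$. The vector $\mathbf k$ is *dominant* if $a_i-a_j>0$ whenever $1\le i<j\le n$ and $a_i-a_j\in\mathbb Z$. Let $\mathcal D_N=\bigoplus_{i\le N}(\mathbb C[y^{\pm1}]*\Gamma)\,\partial^i$ ($\mathcal D_{-1}=0$), and for $B\subseteq\mathcal D$ let $\operatorname{gr}B=\bigoplus_{N\ge0}(B\cap\mathcal D_N)/(B\cap\mathcal D_{N-1})$. If $\beta\in B\cap\mathcal D_N$ and $\beta\equiv e f(y)\partial^N \pmod{\mathcal D_{N-1}}$ with $f\in\mathbb C[y^{\pm1}]$, we say that the class of $\beta$ in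 $\operatorname{gr}B$ has symbol $f(u)v^N\in\mathbb C[u^{\pm1},v^{\pm1}]$. Let $X$ be the toric surface of the fan in $\mathbb Z^2$ with rays through $v_j=(1,j)$, $0\le j\le n$, and two-dimensional cones $\mathbb R^+v_{i-1}+\mathbb R^+v_i$, $1\le i\le n$; it is the minimal resolution of $\mathbb C^2/\Gamma$. Let $x,z$ be the coordinates of its torus (the characters $(1,0),(0,1)$), embedded in $\mathbb C(u,v)$ by $x=uv$, $z=v^n$. Let $D_j$ be the torus invariant prime divisor of $v_j$, and put $D(i)=\sum_{j=0}^{i-1}(i-j)D_{n-j}$ and $D(\mathbf b)=\sum_{i=1}^{n-1}b_iD(i)$. **Theorem.** Assume that $\mathbf k\in\mathbb C^{n-1}$ is dominant, and that $\mathbf r'\ge\mathbf r\ge\mathbf k$ with $\mathbf r'=\mathbf r+F(\mathbf b)$, $\mathbf b\in\mathbb N^{n-1}$. Then, whichever chain is used to form $B(\mathbf r',\mathbf r)$, every class in every graded piece of $\operatorname{gr}B(\mathbf r',\mathbf r)$ has a symbol, this symbol lies in $\mathbb C[x^{\pm1},z^{\pm1}]$, and $\operatorname{gr}B(\mathbf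 r',\mathbf r)=H^0(X,\mathcal O(D(\mathbf b)))$ up to multiplication by $x^{\sum_i ib_i}$: there is a $\mathbb C$-linear bijection $$\Psi:\operatorname{gr}B(\mathbf r',\mathbf r)\longrightarrow H^0(X,\mathcal O(D(\mathbf b)))\subset\mathbb C(X)$$ such that for every element of a graded piece of $\operatorname{gr}B(\mathbf r',\mathbf r)$ its symbol equals $x^{\sum_{i=1}^{n-1} i b_i}$ times its image under $\Psi$. -/

import Mathlib

namespace Kleinian

section Geometry

open CategoryTheory CategoryTheory.Limits AlgebraicGeometry

/-! ### The toric surface and the sheaves `O(D(b))` -/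

/-- The pairing `⟨m, v_j⟩` of `m ∈ M = ℤ²` with the lattice vector `v_j = (1, j)`. -/
def pair (m : ℤ × ℤ) (j : ℕ) : ℤ := m.1 + j * m.2

lemma pair_add (m m' : ℤ × ℤ) (j : ℕ) : pair (m + m') j = pair m j + pair m' j := by
  simp only [pair, Prod.fst_add, Prod.snd_add]; ring

/-- The cones of the fan `Δ` spanned by `v_0, …, v_n`: the zero cone, the rays `ℝ⁺ v_j` and the
two-dimensional cones `ℝ⁺ v_{i} + ℝ⁺ v_{i+1}`, each given by the set of (the indices of) its
ray generators and ordered by the face relation. -/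
abbrev FanCone (n : ℕ) : Type :=
  {S : Finset (Fin (n + 1)) // ∃ i : Fin n, S ⊆ {i.castSucc, i.succ}}

/-- The semigroup `σ^∨ ∩ M` of the cone `σ` spanned by the `v_j`, `j ∈ S`. -/
def dualMonoid {n : ℕ} (S : Finset (Fin (n + 1))) : AddSubmonoid (ℤ × ℤ) where
  carrier := {m | ∀ j ∈ S, 0 ≤ pair m j}
  zero_mem' := fun j _ => by simp [pair]
  add_mem' := fun {a b} ha hb j hj => by
    rw [pair_add]; exact add_nonneg (ha j hj) (hb j hj)

lemma dualMonoid_anti {n : ℕ} {S T : Finset (Fin (n + 1))} (h : S ⊆ T) :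
    dualMonoid T ≤ dualMonoid S := fun _ hm j hj => hm j (h hj)

/-- The coordinate ring `ℂ[σ^∨ ∩ M]` of the affine toric chart of the cone spanned by `S`. -/
abbrev ChartRing {n : ℕ} (S : Finset (Fin (n + 1))) : Type :=
  AddMonoidAlgebra ℂ (dualMonoid S)

/-- The inclusion `ℂ[τ^∨ ∩ M] → ℂ[σ^∨ ∩ M]` for a face `σ` of `τ`. -/
noncomputable def chartMap {n : ℕ} {S T : Finset (Fin (n + 1))} (h : S ⊆ T) :
    ChartRing T →+* ChartRing S :=
  AddMonoidAlgebra.mapDomainRingHom ℂ (AddSubmonoid.inclusion (dualMonoid_anti h))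

lemma chartMap_single {n : ℕ} {S T : Finset (Fin (n + 1))} (h : S ⊆ T)
    (m : dualMonoid T) (c : ℂ) : chartMap h (AddMonoidAlgebra.single m c) =
      AddMonoidAlgebra.single (AddSubmonoid.inclusion (dualMonoid_anti h) m) c := by
  simp [chartMap]

lemma chartMap_injective {n : ℕ} {S T : Finset (Fin (n + 1))} (h : S ⊆ T) :
    Function.Injective (chartMap h) :=
  AddMonoidAlgebra.mapDomain_injective (AddSubmonoid.inclusion_injective _)

lemma chartMap_refl {n : ℕ} (S : Finset (Fin (n + 1))) (h : S ⊆ S) :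
    chartMap h = RingHom.id (ChartRing S) := by
  have : AddSubmonoid.inclusion (dualMonoid_anti h) = AddMonoidHom.id (dualMonoid S) := by
    ext <;> rfl
  rw [chartMap, this, AddMonoidAlgebra.mapDomainRingHom_id]

lemma chartMap_comp {n : ℕ} {S T R : Finset (Fin (n + 1))} (h : S ⊆ T) (h' : T ⊆ R) :
    (chartMap h).comp (chartMap h') = chartMap (h.trans h') := by
  rw [chartMap, chartMap, chartMap, ← AddMonoidAlgebra.mapDomainRingHom_comp]
  rfl

/-- A lattice point of `τ^∨` which vanishes on the face `σ` of `τ` and is positive on the other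
generators of `τ`. -/
lemma exists_facePoint {n : ℕ} {S T : Finset (Fin (n + 1))}
    (hT : ∃ i : Fin n, T ⊆ {i.castSucc, i.succ}) (h : S ⊆ T) :
    ∃ m : ℤ × ℤ, (∀ j ∈ S, pair m j = 0) ∧ ∀ j ∈ T, j ∉ S → pair m j = 1 := by
  obtain ⟨i, hi⟩ := hT
  refine ⟨(if i.castSucc ∈ S then 0 else ((i : ℤ) + 1, -1)) +
    (if i.succ ∈ S then 0 else (-(i : ℤ), 1)), ?_, ?_⟩
  · intro j hj
    have := hi (h hj)
    simp only [Finset.mem_insert, Finset.mem_singleton] at this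
    rcases this with rfl | rfl <;> split_ifs <;> simp [pair]
  · intro j hj hjS
    have := hi hj
    simp only [Finset.mem_insert, Finset.mem_singleton] at this
    rcases this with rfl | rfl <;> split_ifs <;> simp [pair]

lemma chart_isLocalization {n : ℕ} {S T : Finset (Fin (n + 1))} (h : S ⊆ T)
    (m : dualMonoid T) (hmS : ∀ j ∈ S, pair m j = 0)
    (hmT : ∀ j ∈ T, j ∉ S → 1 ≤ pair m j) :
    letI := (chartMap h).toAlgebra
    IsLocalization.Away (AddMonoidAlgebra.single m (1 : ℂ)) (ChartRing S) := by
  let := (chartMap h).toAlgebra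
  have key : ∀ z : ChartRing S, ∃ (N : ℕ) (a : ChartRing T),
      z * chartMap h (AddMonoidAlgebra.single m (1 : ℂ)) ^ N = chartMap h a := by
    intro z
    induction z using AddMonoidAlgebra.induction_linear with
    | zero => exact ⟨0, 0, by simp⟩
    | add f g hf hg =>
      obtain ⟨N, a, ha⟩ := hf
      obtain ⟨N', b, hb⟩ := hg
      refine ⟨N + N', a * AddMonoidAlgebra.single m (1 : ℂ) ^ N' +
        b * AddMonoidAlgebra.single m (1 : ℂ) ^ N, ?_⟩
      rw [map_add, map_mul, map_mul, ← ha, ← hb, map_pow, map_pow]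
      ring
    | single w c =>
      obtain ⟨w, hw⟩ := w
      obtain ⟨N, hN⟩ : ∃ N : ℕ, ∀ j ∈ T, -pair w j ≤ N := by
        refine ⟨∑ j ∈ T, (-pair w j).toNat, fun j hj => ?_⟩
        have h1 : (-pair w j).toNat ≤ ∑ j ∈ T, (-pair w j).toNat :=
          Finset.single_le_sum (f := fun j : Fin (n + 1) => (-pair w j).toNat)
            (fun _ _ => Nat.zero_le _) hj
        have h2 := Int.self_le_toNat (-pair w j)
        omega
      have hpairN : ∀ (N : ℕ) (j : ℕ), pair (w + N • (m : ℤ × ℤ)) j = pair w j + N * pair m j := by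
        intro N j
        simp only [pair, Prod.fst_add, Prod.snd_add, Prod.smul_fst, Prod.smul_snd,
          Int.nsmul_eq_mul]
        ring
      have hmem : w + N • (m : ℤ × ℤ) ∈ dualMonoid T := by
        intro j hj
        rw [hpairN]
        by_cases hjS : j ∈ S
        · rw [hmS j hjS]; simpa using hw j hjS
        · have h2 := hN j hj
          have h3 := hmT j hj hjS
          have h4 : (N : ℤ) * 1 ≤ N * pair m j := by gcongr
          omega
      refine ⟨N, AddMonoidAlgebra.single ⟨_, hmem⟩ c, ?_⟩
      rw [chartMap_single, chartMap_single, AddMonoidAlgebra.single_pow,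
        AddMonoidAlgebra.single_mul_single]
      congr 1
      simp
  rw [IsLocalization.Away, isLocalization_iff]
  refine ⟨?_, ?_, ?_⟩
  · rintro ⟨_, N, rfl⟩
    change IsUnit (chartMap h (_ ^ N))
    rw [map_pow]
    refine IsUnit.pow _ ?_
    rw [chartMap_single]
    have hneg : -(m : ℤ × ℤ) ∈ dualMonoid S := by
      intro j hj
      have := hmS j hj
      simp only [pair, Prod.fst_neg, Prod.snd_neg] at this ⊢
      linarith
    refine IsUnit.of_mul_eq_one (AddMonoidAlgebra.single ⟨_, hneg⟩ (1 : ℂ)) ?_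
    rw [AddMonoidAlgebra.single_mul_single, AddMonoidAlgebra.one_def]
    congr 1
    · ext <;> simp
    · simp
  · intro z
    obtain ⟨N, a, ha⟩ := key z
    refine ⟨(a, ⟨_, N, rfl⟩), ?_⟩
    change z * chartMap h (_ ^ N) = chartMap h a
    rw [map_pow]
    exact ha
  · intro x y hxy
    exact ⟨1, by rw [chartMap_injective h hxy]⟩

/-- The diagram of affine toric charts `σ ↦ Spec ℂ[σ^∨ ∩ M]` of the fan `Δ`. -/
noncomputable def fanDiagram (n : ℕ) : FanCone n ⥤ Scheme.{0} where
  obj σ := Spec (CommRingCat.of (ChartRing σ.1))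
  map f := Spec.map (CommRingCat.ofHom (chartMap (leOfHom f)))
  map_id σ := by
    rw [chartMap_refl]; exact Spec.map_id _
  map_comp f g := by
    rw [← Spec.map_comp, ← CommRingCat.ofHom_comp, chartMap_comp]

lemma facePoint_mem {n : ℕ} {S T : Finset (Fin (n + 1))} {m : ℤ × ℤ}
    (h0 : ∀ j ∈ S, pair m j = 0) (h1 : ∀ j ∈ T, j ∉ S → 1 ≤ pair m j) : m ∈ dualMonoid T := by
  intro j hj
  by_cases hjS : j ∈ S
  · rw [h0 j hjS]
  · have := h1 j hj hjS; omega

instance fanDiagram_isOpenImmersion (n : ℕ) {σ τ : FanCone n} (f : σ ⟶ τ) :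
    IsOpenImmersion ((fanDiagram n).map f) := by
  obtain ⟨m, h0, h1⟩ := exists_facePoint τ.2 (leOfHom f)
  let := (chartMap (leOfHom f)).toAlgebra
  have := chart_isLocalization (leOfHom f) ⟨m, facePoint_mem h0 (fun j hj hj' => (h1 j hj hj').ge)⟩
    h0 (fun j hj hj' => (h1 j hj hj').ge)
  exact IsOpenImmersion.of_isLocalization (S := ChartRing σ.1)
    (AddMonoidAlgebra.single (⟨m, _⟩ : dualMonoid τ.1) (1 : ℂ))

lemma fanDiagram_mem_range {n : ℕ} {σ τ : FanCone n} (f : σ ⟶ τ) (m : dualMonoid τ.1)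
    (h0 : ∀ j ∈ σ.1, pair m j = 0) (h1 : ∀ j ∈ τ.1, j ∉ σ.1 → 1 ≤ pair m j)
    (p : PrimeSpectrum (ChartRing τ.1)) :
    (p ∈ Set.range ((fanDiagram n).map f : _ → _)) ↔
      AddMonoidAlgebra.single m (1 : ℂ) ∉ p.asIdeal := by
  let := (chartMap (leOfHom f)).toAlgebra
  have := chart_isLocalization (leOfHom f) m h0 h1
  have h := PrimeSpectrum.localization_away_comap_range (ChartRing σ.1)
    (AddMonoidAlgebra.single m (1 : ℂ))
  exact Set.ext_iff.mp h p

instance fanDiagram_isLocallyDirected (n : ℕ) :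
    (fanDiagram n ⋙ Scheme.forget).IsLocallyDirected := by
  refine ⟨fun {σ σ' τ} f f' x x' hx => ?_⟩
  change (fanDiagram n).map f x = (fanDiagram n).map f' x' at hx
  let ρ : FanCone n := ⟨σ.1 ∩ σ'.1, by
    obtain ⟨i, hi⟩ := σ.2
    exact ⟨i, Finset.inter_subset_left.trans hi⟩⟩
  let g : ρ ⟶ σ := homOfLE (Finset.inter_subset_left : σ.1 ∩ σ'.1 ⊆ σ.1)
  let g' : ρ ⟶ σ' := homOfLE (Finset.inter_subset_right : σ.1 ∩ σ'.1 ⊆ σ'.1)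
  obtain ⟨m, h0, h1⟩ := exists_facePoint τ.2 (leOfHom f)
  obtain ⟨m', h0', h1'⟩ := exists_facePoint τ.2 (leOfHom f')
  have hm := facePoint_mem h0 (fun j hj hj' => (h1 j hj hj').ge)
  have hm' := facePoint_mem h0' (fun j hj hj' => (h1' j hj hj').ge)
  have hp := (fanDiagram_mem_range f ⟨m, hm⟩ h0 (fun j hj hj' => (h1 j hj hj').ge) _).mp ⟨x, rfl⟩
  have hp' := (fanDiagram_mem_range f' ⟨m', hm'⟩ h0'
    (fun j hj hj' => (h1' j hj hj').ge) _).mp ⟨x', rfl⟩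
  rw [← hx] at hp'
  have hpp : ((fanDiagram n).map f x) ∈ Set.range ((fanDiagram n).map (g ≫ f) : _ → _) := by
    refine (fanDiagram_mem_range (g ≫ f) ⟨m + m', add_mem hm hm'⟩ ?_ ?_ _).mpr ?_
    · intro j hj
      rw [Finset.mem_inter] at hj
      change pair (m + m') j = 0
      rw [pair_add, h0 j hj.1, h0' j hj.2, add_zero]
    · intro j hj hj'
      rw [Finset.mem_inter, not_and_or] at hj'
      change 1 ≤ pair (m + m') j
      rw [pair_add]
      have a1 := hm j hj
      have a2 := hm' j hj
      rcases hj' with hj' | hj'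
      · have := h1 j hj hj'; omega
      · have := h1' j hj hj'; omega
    · have : AddMonoidAlgebra.single (⟨m + m', add_mem hm hm'⟩ : dualMonoid τ.1) (1 : ℂ) =
          AddMonoidAlgebra.single ⟨m, hm⟩ 1 * AddMonoidAlgebra.single ⟨m', hm'⟩ 1 := by
        rw [AddMonoidAlgebra.single_mul_single]
        simp
      rw [this]
      intro hmem
      rcases (PrimeSpectrum.isPrime _).mem_or_mem hmem with h | h
      · exact hp h
      · exact hp' h
  obtain ⟨z, hz⟩ := hpp
  refine ⟨ρ, g, g', z, ?_, ?_⟩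
  · apply ((fanDiagram n).map f).isOpenEmbedding.injective
    change ((fanDiagram n).map f) ((fanDiagram n).map g z) = _
    rw [← hz, Functor.map_comp]
    rfl
  · apply ((fanDiagram n).map f').isOpenEmbedding.injective
    change ((fanDiagram n).map f') ((fanDiagram n).map g' z) = ((fanDiagram n).map f') x'
    rw [← hx, ← hz, ← Scheme.Hom.comp_apply, ← Functor.map_comp,
      Subsingleton.elim (g' ≫ f') (g ≫ f)]

/-- The toric surface `X = X(Δ)`, glued from the charts `Spec ℂ[σ^∨ ∩ M]` along the inclusions
of faces; it is the minimal resolution of `ℂ²/Γ`. -/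
noncomputable def ToricSurface (n : ℕ) : Scheme.{0} := colimit (fanDiagram n)

/-- The open immersion of the affine chart of the cone `σ` into `X`. -/
noncomputable def chart {n : ℕ} (σ : FanCone n) :
    Spec (CommRingCat.of (ChartRing σ.1)) ⟶ ToricSurface n :=
  colimit.ι (fanDiagram n) σ

instance chart_isOpenImmersion {n : ℕ} (σ : FanCone n) : IsOpenImmersion (chart σ) :=
  inferInstanceAs (IsOpenImmersion (colimit.ι (fanDiagram n) σ))

/-- The zero cone. -/
def zeroCone (n : ℕ) [NeZero n] : FanCone n := ⟨∅, 0, Finset.empty_subset _⟩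

instance chartRing_isDomain {n : ℕ} (S : Finset (Fin (n + 1))) : IsDomain (ChartRing S) :=
  Function.Injective.isDomain
    (AddMonoidAlgebra.mapDomainRingHom ℂ (dualMonoid S).subtype)
    (AddMonoidAlgebra.mapDomain_injective Subtype.val_injective)

lemma dualMonoid_fg {n : ℕ} (σ : FanCone n) : (dualMonoid σ.1).FG := by
  obtain ⟨S, i, hi⟩ := σ
  let u : ℤ × ℤ := ((i : ℤ) + 1, -1)
  let v : ℤ × ℤ := (-(i : ℤ), 1)
  let G : Set (ℤ × ℤ) := {u, v} ∪ ({w | w = -u ∧ i.castSucc ∉ S} ∪ {w | w = -v ∧ i.succ ∉ S})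
  have hG : G.Finite := by
    refine ((Set.finite_singleton v).insert u).union (Set.Finite.union ?_ ?_)
    · exact (Set.finite_singleton (-u)).subset fun w hw => hw.1
    · exact (Set.finite_singleton (-v)).subset fun w hw => hw.1
  refine (AddSubmonoid.fg_iff _).mpr ⟨G, le_antisymm ?_ ?_, hG⟩
  · rw [AddSubmonoid.closure_le]
    intro w hw j hj
    have hj' := hi hj
    simp only [Finset.mem_insert, Finset.mem_singleton] at hj'
    rcases hw with (rfl | rfl) | ⟨rfl, hS⟩ | ⟨rfl, hS⟩ <;> rcases hj' with rfl | rfl <;>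
      simp_all [pair, u, v]
  · intro m hm
    have hdec : m = pair m i • u + pair m (i + 1) • v := by
      ext <;> simp [pair, u, v] <;> ring
    have hzu : ∀ (t : ℤ) (w : ℤ × ℤ), (w ∈ G) → (0 ≤ t ∨ -w ∈ G) →
        t • w ∈ AddSubmonoid.closure G := by
      intro t w hw ht
      rcases le_total 0 t with h | h
      · obtain ⟨N, rfl⟩ := Int.eq_ofNat_of_zero_le h
        rw [natCast_zsmul]
        exact nsmul_mem (AddSubmonoid.subset_closure hw) N
      · obtain ⟨N, hN⟩ := Int.eq_ofNat_of_zero_le (neg_nonneg.mpr h)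
        rcases ht with ht | ht
        · have : t = 0 := le_antisymm h ht
          rw [this, zero_zsmul]; exact zero_mem _
        · have : t • w = N • (-w) := by
            rw [← natCast_zsmul, ← hN]; simp
          rw [this]
          exact nsmul_mem (AddSubmonoid.subset_closure ht) N
    rw [hdec]
    refine add_mem (hzu _ _ (Or.inl (Or.inl rfl)) ?_) (hzu _ _ (Or.inl (Or.inr rfl)) ?_)
    · by_cases h : i.castSucc ∈ S
      · left; simpa using hm _ h
      · right; exact Or.inr (Or.inl ⟨rfl, h⟩)
    · by_cases h : i.succ ∈ S
      · left; simpa using hm _ h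
      · right; exact Or.inr (Or.inr ⟨rfl, h⟩)

instance chartRing_isNoetherian {n : ℕ} (σ : FanCone n) : IsNoetherianRing (ChartRing σ.1) := by
  have : AddMonoid.FG (dualMonoid σ.1) :=
    (AddMonoid.fg_iff_addSubmonoid_fg _).mpr (dualMonoid_fg σ)
  exact Algebra.FiniteType.isNoetherianRing ℂ (ChartRing σ.1)

instance fanDiagram_obj_isIntegral {n : ℕ} (σ : FanCone n) : IsIntegral ((fanDiagram n).obj σ) :=
  inferInstanceAs (IsIntegral (Spec (CommRingCat.of (ChartRing σ.1))))

instance fanDiagram_obj_isNoetherian {n : ℕ} (σ : FanCone n) :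
    IsLocallyNoetherian ((fanDiagram n).obj σ) :=
  inferInstanceAs (IsLocallyNoetherian (Spec (CommRingCat.of (ChartRing σ.1))))

instance toricSurface_isLocallyNoetherian (n : ℕ) : IsLocallyNoetherian (ToricSurface n) :=
  (isLocallyNoetherian_iff_openCover
    (Scheme.IsLocallyDirected.openCover (fanDiagram n))).mpr fun σ => fanDiagram_obj_isNoetherian σ

instance toricSurface_isReduced (n : ℕ) : IsReduced (ToricSurface n) :=
  (IsReduced.iff_of_openCover _ (Scheme.IsLocallyDirected.openCover (fanDiagram n))).mpr fun σ =>
    @isReduced_of_isIntegral _ (fanDiagram_obj_isIntegral σ)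

instance toricSurface_irreducible (n : ℕ) [NeZero n] : IrreducibleSpace (ToricSurface n) := by
  have key : ∀ U : Set (ToricSurface n), IsOpen U → U.Nonempty →
      (chart (zeroCone n) ⁻¹' U).Nonempty := by
    rintro U hU ⟨x, hx⟩
    obtain ⟨σ, y, rfl⟩ := Scheme.IsLocallyDirected.ι_jointly_surjective (fanDiagram n) x
    let f : zeroCone n ⟶ σ := homOfLE (Finset.empty_subset σ.1 : (∅ : Finset (Fin (n + 1))) ⊆ σ.1)
    have hopen : IsOpen (colimit.ι (fanDiagram n) σ ⁻¹' U) :=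
      hU.preimage (colimit.ι (fanDiagram n) σ).continuous
    obtain ⟨z, hz, w, rfl⟩ := nonempty_preirreducible_inter hopen
      ((fanDiagram n).map f).isOpenEmbedding.isOpen_range ⟨y, hx⟩
      ⟨_, Set.mem_range_self (genericPoint ((fanDiagram n).obj (zeroCone n)))⟩
    refine ⟨w, ?_⟩
    have : colimit.ι (fanDiagram n) (zeroCone n) w =
        colimit.ι (fanDiagram n) σ ((fanDiagram n).map f w) := by
      rw [← Scheme.Hom.comp_apply, colimit.w]
    change colimit.ι (fanDiagram n) (zeroCone n) w ∈ U
    rw [this]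
    exact hz
  have hne : Nonempty (ToricSurface n) :=
    ⟨chart (zeroCone n) (genericPoint ((fanDiagram n).obj (zeroCone n)))⟩
  have : PreirreducibleSpace (ToricSurface n) := by
    refine ⟨fun U V hU hV hU' hV' => ?_⟩
    rw [Set.univ_inter] at hU' hV'
    obtain ⟨w, hw, hw'⟩ := nonempty_preirreducible_inter
      (hU.preimage (chart (zeroCone n)).continuous) (hV.preimage (chart (zeroCone n)).continuous)
      (key U hU hU') (key V hV hV')
    exact ⟨chart (zeroCone n) w, trivial, hw, hw'⟩
  exact { toNonempty := hne }

instance toricSurface_isIntegral (n : ℕ) [NeZero n] : IsIntegral (ToricSurface n) :=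
  isIntegral_of_irreducibleSpace_of_isReduced _

/-- The Laurent polynomial ring `ℂ[M] = ℂ[x^{±1}, z^{±1}]` of the torus; the exponent
`m = (m₁, m₂)` stands for the monomial `x^{m₁} z^{m₂}`. -/
abbrev TorusRing : Type := AddMonoidAlgebra ℂ (ℤ × ℤ)

/-- `ℂ[M]` is the coordinate ring of the chart of the zero cone. -/
noncomputable def toZeroChart (n : ℕ) [NeZero n] : TorusRing →+* ChartRing (zeroCone n).1 :=
  AddMonoidAlgebra.mapDomainRingHom ℂ
    ((AddMonoidHom.id (ℤ × ℤ)).codRestrict (dualMonoid (zeroCone n).1)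
      (fun _ _ hj => absurd hj (Finset.notMem_empty _)))

instance zeroChart_nonempty (n : ℕ) [NeZero n] :
    Nonempty ((chart (zeroCone n)) ''ᵁ ⊤ : (ToricSurface n).Opens) :=
  ⟨⟨chart (zeroCone n) (genericPoint ((fanDiagram n).obj (zeroCone n))), _, trivial, rfl⟩⟩

/-- A Laurent polynomial in `x, z`, i.e. a regular function on the open torus of `X`, viewed as a
rational function on `X`. -/
noncomputable def toRational (n : ℕ) [NeZero n] :
    TorusRing →+* (ToricSurface n).functionField :=
  ((Scheme.ΓSpecIso (CommRingCat.of (ChartRing (zeroCone n).1))).inv ≫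
    ((chart (zeroCone n)).appIso ⊤).inv ≫
    (ToricSurface n).germToFunctionField ((chart (zeroCone n)) ''ᵁ ⊤)).hom.comp (toZeroChart n)

/-- The function field of `X` as an extension of the field of constants `ℂ`. -/
noncomputable instance functionFieldAlgebra (n : ℕ) [NeZero n] :
    Algebra ℂ (ToricSurface n).functionField :=
  ((toRational n).comp (algebraMap ℂ TorusRing)).toAlgebra

/-- The ray `ℝ⁺ v_j`. -/
def ray {n : ℕ} [NeZero n] (j : Fin (n + 1)) : FanCone n :=
  ⟨{j}, by
    induction j using Fin.cases with
    | zero => exact ⟨0, by simp⟩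
    | succ i => exact ⟨i, by simp⟩⟩

/-- Restriction of functions from the chart of the ray `ρ = ℝ⁺ v_j` to the closed torus orbit in
it: `χ^m ↦ χ^m` if `⟨m, v_j⟩ = 0` and `χ^m ↦ 0` if `⟨m, v_j⟩ > 0`. -/
noncomputable def orbitMap {n : ℕ} [NeZero n] (j : Fin (n + 1)) :
    ChartRing (ray j).1 →ₐ[ℂ] TorusRing :=
  AddMonoidAlgebra.lift ℂ TorusRing (dualMonoid (ray j).1)
    { toFun := fun m => if pair (m.toAdd : ℤ × ℤ) j = 0
        then AddMonoidAlgebra.single (m.toAdd : ℤ × ℤ) 1 else 0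
      map_one' := by simp [pair, AddMonoidAlgebra.one_def]
      map_mul' := fun a b => by
        have ha : 0 ≤ pair (a.toAdd : ℤ × ℤ) j := a.toAdd.2 j (Finset.mem_singleton_self j)
        have hb : 0 ≤ pair (b.toAdd : ℤ × ℤ) j := b.toAdd.2 j (Finset.mem_singleton_self j)
        rw [toAdd_mul, AddSubmonoid.coe_add, pair_add]
        by_cases h1 : pair (a.toAdd : ℤ × ℤ) j = 0
        · by_cases h2 : pair (b.toAdd : ℤ × ℤ) j = 0
          · simp [h1, h2, AddMonoidAlgebra.single_mul_single]
          · simp [h1, h2]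
        · have h3 : pair (a.toAdd : ℤ × ℤ) j + pair (b.toAdd : ℤ × ℤ) j ≠ 0 := by omega
          simp [h1, h3] }

/-- The generic point of the torus invariant prime divisor `D_j` of `X` which belongs to the ray
`ℝ⁺ v_j`, i.e. of the closure of the corresponding torus orbit. -/
noncomputable def divisorPoint {n : ℕ} [NeZero n] (j : Fin (n + 1)) : ToricSurface n :=
  chart (ray j) (⟨RingHom.ker (orbitMap j), RingHom.ker_isPrime _⟩ :
    PrimeSpectrum (ChartRing (ray j).1))

/-- The prime divisor `D_j`. Divisors are finite integral combinations of points; a point stands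
for its closure. -/
noncomputable def primeDivisor {n : ℕ} [NeZero n] (j : Fin (n + 1)) : ToricSurface n →₀ ℤ :=
  Finsupp.single (divisorPoint j) 1

/-- The divisor `D(i) = ∑_{j=0}^{i-1} (i - j) D_{n-j}`, for `i = p + 1 ∈ {1, …, n - 1}`. -/
noncomputable def basicDivisor {n : ℕ} [NeZero n] (p : Fin (n - 1)) : ToricSurface n →₀ ℤ :=
  ∑ j ∈ Finset.range (p + 1),
    ((p : ℤ) + 1 - j) • primeDivisor (⟨n - j, by omega⟩ : Fin (n + 1))

/-- The divisor `D(b) = ∑_{i=1}^{n-1} b_i D(i)`; the entry of `b` at `p` is `b_{p+1}`. -/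
noncomputable def divisor {n : ℕ} [NeZero n] (b : Fin (n - 1) → ℕ) : ToricSurface n →₀ ℤ :=
  ∑ p, (b p : ℤ) • basicDivisor p

/-- The sections of `O(D)` over an open set `V`: the rational functions `f` such that `f = 0` or
`div f + D ≥ 0` on `V`. -/
def sections {n : ℕ} [NeZero n] (D : ToricSurface n →₀ ℤ) (V : (ToricSurface n).Opens) :
    Set (ToricSurface n).functionField :=
  {f | f = 0 ∨ ∀ x ∈ V, Order.coheight x = 1 → 0 ≤ Scheme.ord f x + D x}

/-- `H⁰(X, O(D))`. -/
def globalSections {n : ℕ} [NeZero n] (D : ToricSurface n →₀ ℤ) :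
    Set (ToricSurface n).functionField :=
  sections D ⊤

end Geometry

/-! ### The noncommutative side -/

/-- Generators of the crossed product `ℂ[∂, y^{±1}] * Γ`: `y`, `y⁻¹`, `∂` and a generator `γ` of
the cyclic group `Γ`. -/
inductive Gen : Type
  | y : Gen
  | yinv : Gen
  | del : Gen
  | gam : Gen

/-- The root of unity `e^{2πi/n}`. -/
noncomputable def rootOfUnity (n : ℕ) : ℂ := Complex.exp (2 * Real.pi * Complex.I / n)

open FreeAlgebra in
/-- The defining relations of `ℂ[∂, y^{±1}] * Γ`: those of the Weyl algebra localized at `y`, of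
the cyclic group of order `n`, and the action of the group,
`y γ = ω γ y` and `γ ∂ = ω ∂ γ` with `ω = e^{2πi/n}`. -/
inductive Rel (n : ℕ) : FreeAlgebra ℂ Gen → FreeAlgebra ℂ Gen → Prop
  | y_yinv : Rel n (ι ℂ Gen.y * ι ℂ Gen.yinv) 1
  | yinv_y : Rel n (ι ℂ Gen.yinv * ι ℂ Gen.y) 1
  | weyl : Rel n (ι ℂ Gen.del * ι ℂ Gen.y) (ι ℂ Gen.y * ι ℂ Gen.del + 1)
  | gam_pow : Rel n (ι ℂ Gen.gam ^ n) 1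
  | y_gam : Rel n (ι ℂ Gen.y * ι ℂ Gen.gam) (rootOfUnity n • (ι ℂ Gen.gam * ι ℂ Gen.y))
  | gam_del : Rel n (ι ℂ Gen.gam * ι ℂ Gen.del) (rootOfUnity n • (ι ℂ Gen.del * ι ℂ Gen.gam))

/-- The crossed product `ℂ[∂, y^{±1}] * Γ`, for `Γ` cyclic of order `n`. -/
def CrossedProduct (n : ℕ) : Type := RingQuot (Rel n)

noncomputable instance crossedProductRing (n : ℕ) : Ring (CrossedProduct n) :=
  inferInstanceAs (Ring (RingQuot (Rel n)))

noncomputable instance crossedProductAlgebra (n : ℕ) : Algebra ℂ (CrossedProduct n) :=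
  inferInstanceAs (Algebra ℂ (RingQuot (Rel n)))

/-- The projection of the free algebra onto the crossed product. -/
noncomputable def toCrossedProduct (n : ℕ) : FreeAlgebra ℂ Gen →ₐ[ℂ] CrossedProduct n :=
  RingQuot.mkAlgHom ℂ (Rel n)

lemma toCrossedProduct_rel {n : ℕ} {s t : FreeAlgebra ℂ Gen} (h : Rel n s t) :
    toCrossedProduct n s = toCrossedProduct n t :=
  RingQuot.mkAlgHom_rel ℂ h

/-- The generators as elements of the crossed product. -/
noncomputable def gen (n : ℕ) (g : Gen) : CrossedProduct n :=
  toCrossedProduct n (FreeAlgebra.ι ℂ g)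

/-- `y` as a unit of the crossed product. -/
noncomputable def yUnit (n : ℕ) : (CrossedProduct n)ˣ where
  val := gen n Gen.y
  inv := gen n Gen.yinv
  val_inv := by
    rw [gen, gen, ← map_mul, toCrossedProduct_rel Rel.y_yinv, map_one]
  inv_val := by
    rw [gen, gen, ← map_mul, toCrossedProduct_rel Rel.yinv_y, map_one]

/-- `y^a` for an integer `a`. -/
noncomputable def yPow (n : ℕ) (a : ℤ) : CrossedProduct n := ((yUnit n ^ a : (CrossedProduct n)ˣ))

/-- `∂`. -/
noncomputable def del (n : ℕ) : CrossedProduct n := gen n Gen.del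

/-- `γ`. -/
noncomputable def gam (n : ℕ) : CrossedProduct n := gen n Gen.gam

/-- The idempotent `e_i = (1/n) ∑_{j=0}^{n-1} (ω^i γ)^j`. -/
noncomputable def idem (n i : ℕ) : CrossedProduct n :=
  (n : ℂ)⁻¹ • ∑ j ∈ Finset.range n, (rootOfUnity n ^ i • gam n) ^ j

/-- `d_k = ∂ - y⁻¹ ∑_{i=1}^{n-1} k_i e_i`; the entry of the vector `k` at `p : Fin (n - 1)` is
`k_{p+1}`. -/
noncomputable def dunkl {n : ℕ} (k : Fin (n - 1) → ℂ) : CrossedProduct n :=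
  del n - yPow n (-1) * ∑ p : Fin (n - 1), k p • idem n (p + 1)

/-- `H_k`, the subalgebra generated by `d_k`, `y` and `Γ`. -/
noncomputable def algH {n : ℕ} (k : Fin (n - 1) → ℂ) : Subalgebra ℂ (CrossedProduct n) :=
  Algebra.adjoin ℂ {dunkl k, yPow n 1, gam n}

/-- The subspace `a M b`. -/
noncomputable def sandwich {n : ℕ} (a : CrossedProduct n) (M : Submodule ℂ (CrossedProduct n))
    (b : CrossedProduct n) : Submodule ℂ (CrossedProduct n) :=
  M.map (LinearMap.mulRight ℂ b ∘ₗ LinearMap.mulLeft ℂ a)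

/-- The spherical subalgebra `U_k = e H_k e`, `e = e_0`. -/
noncomputable def spherical {n : ℕ} (k : Fin (n - 1) → ℂ) : Submodule ℂ (CrossedProduct n) :=
  sandwich (idem n 0) (Subalgebra.toSubmodule (algH k)) (idem n 0)

/-- The vector `w_i = n (v_1 + ⋯ + v_i)`, for `i = p + 1`. -/
def wVec {n : ℕ} (p : Fin (n - 1)) : Fin (n - 1) → ℂ := fun q => if q ≤ p then (n : ℂ) else 0

/-- `F(b) = ∑_i b_i w_i`. -/
def latticeF {n : ℕ} (b : Fin (n - 1) → ℕ) : Fin (n - 1) → ℂ := ∑ p, b p • wVec p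

/-- The basic bimodule `B(k + w_i, k) = e H_{k + w_i} e_i y^i`, for `i = p + 1`. -/
noncomputable def basicBimodule {n : ℕ} (k : Fin (n - 1) → ℂ) (p : Fin (n - 1)) :
    Submodule ℂ (CrossedProduct n) :=
  sandwich (idem n 0) (Subalgebra.toSubmodule (algH (k + wVec p)))
    (idem n (p + 1) * yPow n ((p : ℤ) + 1))

/-- The bimodule `B(r', r) = B(r_s, r_{s-1}) ⋯ B(r_2, r_1) B(r_1, r_0)` for the chain
`r = r_0, r_1, …, r_s = r'` in which the successive differences `r_t - r_{t-1}` are the vectors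
`w_i` listed in the second argument; `B(r, r) = U_r`. -/
noncomputable def bimodule {n : ℕ} :
    (Fin (n - 1) → ℂ) → List (Fin (n - 1)) → Submodule ℂ (CrossedProduct n)
  | r, [] => spherical r
  | r, p :: l => bimodule (r + wVec p) l * basicBimodule r p

/-- The numbers `a_i = (n - i + k_i) / n` for `1 ≤ i ≤ n - 1`, and `a_n = 0`. -/
noncomputable def aVec {n : ℕ} (k : Fin (n - 1) → ℂ) (i : ℕ) : ℂ :=
  if h : 1 ≤ i ∧ i ≤ n - 1 then ((n : ℂ) - i + k ⟨i - 1, by omega⟩) / n else 0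

/-- `k` is dominant: `(k + ρ, α) > 0` for all positive roots `α = v_i - v_j`, `i < j`, such that
`(a, α)` is an integer. Here `k + ρ = n a`, so that `(k + ρ, α) = n (a_i - a_j)`. -/
def IsDominant {n : ℕ} (k : Fin (n - 1) → ℂ) : Prop :=
  ∀ i j : ℕ, 1 ≤ i → i < j → j ≤ n → ∀ z : ℤ, aVec k i - aVec k j = z → 0 < z

/-- `D_{<N}`, spanned by the `y^a γ^j ∂^i` with `i < N`. -/
noncomputable def orderLT (n N : ℕ) : Submodule ℂ (CrossedProduct n) :=
  Submodule.span ℂ {t | ∃ (a : ℤ) (j i : ℕ), i < N ∧ t = yPow n a * gam n ^ j * del n ^ i}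

/-- The filtration by the order of differential operators:
`D_N = ⨁_{i ≤ N} (ℂ[y^{±1}] * Γ) ∂^i`. -/
noncomputable def orderLE (n N : ℕ) : Submodule ℂ (CrossedProduct n) := orderLT n (N + 1)

/-- The graded piece `(B ∩ D_N) / (B ∩ D_{N-1})` (with `D_{-1} = 0`). -/
abbrev GrPiece {n : ℕ} (B : Submodule ℂ (CrossedProduct n)) (N : ℕ) : Type :=
  ↥(B ⊓ orderLE n N) ⧸ (orderLT n N).submoduleOf (B ⊓ orderLE n N)

/-- The associated graded space of `B` for the order filtration. -/
abbrev Gr {n : ℕ} (B : Submodule ℂ (CrossedProduct n)) : Type := DirectSum ℕ (GrPiece B)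

/-- The class in `gr B` of an element of `B` of order at most `N`. -/
noncomputable def grClass {n : ℕ} (B : Submodule ℂ (CrossedProduct n)) (N : ℕ)
    (β : ↥(B ⊓ orderLE n N)) : Gr B :=
  DirectSum.lof ℂ ℕ (GrPiece B) N (Submodule.Quotient.mk β)

/-- The operator `f(y)` for a Laurent polynomial `f`, given by its coefficients. -/
noncomputable def evalY (n : ℕ) (f : ℤ →₀ ℂ) : CrossedProduct n := f.sum fun a c => c • yPow n a

/-- The Laurent polynomial ring `ℂ[u^{±1}, v^{±1}]`; the exponent `(a, c)` stands for
`u^a v^c`. -/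
abbrev SymbolRing : Type := AddMonoidAlgebra ℂ (ℤ × ℤ)

/-- The symbol `f(u) v^N`. -/
noncomputable def symbol (f : ℤ →₀ ℂ) (N : ℕ) : SymbolRing :=
  f.sum fun a c => AddMonoidAlgebra.single (a, (N : ℤ)) c

/-- The embedding `ℂ[x^{±1}, z^{±1}] → ℂ[u^{±1}, v^{±1}]`, `x ↦ u v`, `z ↦ v^n`. -/
noncomputable def toSymbol (n : ℕ) : TorusRing →+* SymbolRing :=
  AddMonoidAlgebra.mapDomainRingHom ℂ
    { toFun := fun m : ℤ × ℤ => (m.1, m.1 + n * m.2)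
      map_zero' := by simp
      map_add' := fun a b => by ext <;> simp; ring }

/-- The number `∑_{i=1}^{n-1} i b_i`. -/
def weight {n : ℕ} (b : Fin (n - 1) → ℕ) : ℕ := ∑ p : Fin (n - 1), ((p : ℕ) + 1) * b p

end Kleinian

open Kleinian

/-! Put T = y∂/n. Each bimodule is graded by the degree in y, and its component of degree -na has
the form y^(-na) G_a(T) ℂ[T] e for one nonzero polynomial G_a. For the spaces built from a single
H_k this holds because d_k lowers the degree by one and multiplies by a linear polynomial in T
(`sandwich_algH`). The scalar by which ∑ k_i e_i acts is n-periodic in the degree, so the roots of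
these polynomials run through n arithmetic progressions with step one (`associated_lowering`). For
B(r', r) the result is, up to a scalar, G_a = ∏_i ∏_{0 ≤ q < a + m_i} (T - a_i - q), where the a_i
are the parameters of r and m_i = b_i + ⋯ + b_{n-1} (`bimodule_eq_gradedSpan`).

This formula is carried along the chain. A component of a product of two bimodules is the sum, over
all ways b of splitting its degree, of spaces generated by G_a Q_b for certain excess factors Q_b.
Dominance provides for every c ∈ ℂ a splitting with Q_b(c) ≠ 0 (`exists_shift`). So the Q_b have no
common root, they generate the unit ideal of ℂ[T], and the sum is everything (`gradedSpan_mul`).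

For the associated graded space, T^N agrees with n^(-N) y^N ∂^N up to lower order, and a
representation on formal series shows that y^(-na) f(T) e has order exactly deg f. Its symbol in
order N = deg f is a multiple of u^(N - na) v^N = x^(N - na) z^a. So the symbols are spanned by the
x^(m₁) z^(m₂) with m₁ + n m₂ ≥ deg G_{m₂} = ∑_i max(0, m₂ + m_i) (`range_grSymb`). As the m_i
decrease, this sum of positive parts is the largest partial sum, so the condition splits into n + 1
linear inequalities. After division by x^(∑ i b_i) these read ⟨m, v_j⟩ ≥ -d_j, with d_j the
multiplicity of D_j in D(b) (`forall_divisorCoeff_le_iff`).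

The same inequalities describe H⁰(X, O(D(b))) (`globalSections_divisor`): a codimension one point of
X lies in the torus or is the generic point of some D_j; a rational function without poles on the
torus is a Laurent polynomial, because the torus ring is factorial; and its order along D_j is the
least ⟨m, v_j⟩ among its exponents, because x is a uniformizer along every D_j. -/

namespace Kleinian

/-! ### Orders of vanishing read in an affine chart of an integral scheme -/

section OpenImmersion

open CategoryTheory AlgebraicGeometry

variable {R S : Type} [CommRing R] [CommRing S] {X : Scheme.{0}}

lemma appIso_inv_germ_stalkMap {Y : Scheme.{0}} (j : Y ⟶ X) [IsOpenImmersion j] (U : Y.Opens)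
    (p : Y) (hp : p ∈ U) (hjp : j p ∈ j ''ᵁ U) :
    (j.appIso U).inv ≫ X.presheaf.germ (j ''ᵁ U) (j p) hjp ≫ j.stalkMap p =
      Y.presheaf.germ U p hp := by
  rw [Scheme.Hom.germ_stalkMap, Scheme.Hom.appIso_inv_app_assoc]
  exact TopCat.Presheaf.germ_res _ _ _ _

/-- The ring of an affine chart, mapped to the stalk at a point of the chart. -/
noncomputable def toStalkOf (j : Spec (.of R) ⟶ X) [IsOpenImmersion j] (p : PrimeSpectrum R) :
    R →+* X.presheaf.stalk (j p) :=
  ((Scheme.ΓSpecIso (.of R)).inv ≫ (j.appIso ⊤).inv ≫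
    X.presheaf.germ (j ''ᵁ ⊤) (j p) (Set.mem_image_of_mem _ trivial)).hom

lemma stalkMap_comp_toStalkOf (j : Spec (.of R) ⟶ X) [IsOpenImmersion j] (p : PrimeSpectrum R) :
    (j.stalkMap p).hom.comp (toStalkOf j p) = (StructureSheaf.toStalk R p).hom := by
  exact congrArg (fun g => CommRingCat.Hom.hom ((Scheme.ΓSpecIso (.of R)).inv ≫ g))
    (appIso_inv_germ_stalkMap j ⊤ p trivial _)

/-- An open immersion induces isomorphisms on stalks, and this one carries `toStalkOf` to the
canonical map of R to the stalk of its structure sheaf, where the localization property is known. -/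
lemma isLocalization_toStalkOf (j : Spec (.of R) ⟶ X) [IsOpenImmersion j] (p : PrimeSpectrum R) :
    letI := (toStalkOf j p).toAlgebra
    IsLocalization.AtPrime (X.presheaf.stalk (j p)) p.asIdeal := by
  let := (toStalkOf j p).toAlgebra
  apply (IsLocalization.isLocalization_iff_of_ringEquiv (R := R)
    (S := X.presheaf.stalk (j p)) p.asIdeal.primeCompl
    (asIso <| j.stalkMap (show Spec (.of R) from p)).commRingCatIsoToRingEquiv).mpr
  convert StructureSheaf.IsLocalization.to_stalk R p
  delta IsLocalization.AtPrime StructureSheaf.stalkAlgebra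
  congr!
  rw [← stalkMap_comp_toStalkOf j p]
  rfl

instance nonempty_image_top (j : Spec (.of R) ⟶ X) [IsOpenImmersion j] [Nonempty (Spec (.of R))] :
    Nonempty (j ''ᵁ ⊤ : X.Opens) :=
  ⟨⟨j (Classical.arbitrary (Spec (.of R))), _, trivial, rfl⟩⟩

/-- Turns codimension one points of X into height one primes of a chart ring. -/
lemma coheight_eq_height (j : Spec (.of R) ⟶ X) [IsOpenImmersion j] (p : PrimeSpectrum R) :
    Order.coheight (j p) = p.asIdeal.height :=
  (coheight_eq_of_isOpenImmersion j).trans (idealHeight_eq_coheight (.of R) p).symm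

lemma isUnit_toStalkOf (j : Spec (.of R) ⟶ X) [IsOpenImmersion j] {p : PrimeSpectrum R} {r : R}
    (hr : r ∉ p.asIdeal) :
    IsUnit (toStalkOf j p r) := by
  let := (toStalkOf j p).toAlgebra
  have := isLocalization_toStalkOf j p
  exact (IsLocalization.AtPrime.isUnit_to_map_iff (X.presheaf.stalk (j p)) p.asIdeal r).mpr hr

/-- The order is the length of the quotient by a, here a field and hence a simple module. -/
lemma ringOrd_of_isMaximal {A : Type*} [CommRing A] {a : A} (h : (Ideal.span {a}).IsMaximal) :
    Ring.ord A a = 1 := by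
  rw [Ring.ord, Module.length_eq_one_iff]
  rw [isSimpleModule_iff_isSimpleModule_of_algebraMap_surjective (S := A ⧸ Ideal.span {a})
    Ideal.Quotient.mk_surjective]
  let := Ideal.Quotient.field (Ideal.span {a})
  infer_instance

variable [IsIntegral X]

/-- The ring of an affine chart, mapped to the function field. -/
noncomputable def toFunctionFieldOf (j : Spec (.of R) ⟶ X) [IsOpenImmersion j]
    [Nonempty (Spec (.of R))] : R →+* X.functionField :=
  ((Scheme.ΓSpecIso (.of R)).inv ≫ (j.appIso ⊤).inv ≫ X.germToFunctionField (j ''ᵁ ⊤)).hom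

lemma algebraMap_toStalkOf (j : Spec (.of R) ⟶ X) [IsOpenImmersion j] [Nonempty (Spec (.of R))]
    (p : PrimeSpectrum R) (r : R) :
    algebraMap (X.presheaf.stalk (j p)) X.functionField (toStalkOf j p r) =
      toFunctionFieldOf j r :=
  Scheme.algebraMap_germ_eq_germToFunctionField _ (U := j ''ᵁ ⊤) (x := j p)
    (show j p ∈ j ''ᵁ ⊤ from Set.mem_image_of_mem _ trivial) _

lemma toFunctionFieldOf_injective (j : Spec (.of R) ⟶ X) [IsOpenImmersion j]
    [Nonempty (Spec (.of R))] :
    Function.Injective (toFunctionFieldOf j) := by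
  have h3 := X.germToFunctionField_injective (j ''ᵁ ⊤)
  have h1 : Function.Injective (Scheme.ΓSpecIso (.of R)).inv :=
    (ConcreteCategory.bijective_of_isIso (Scheme.ΓSpecIso (.of R)).inv).1
  have h2 : Function.Injective (j.appIso ⊤).inv :=
    (ConcreteCategory.bijective_of_isIso (j.appIso ⊤).inv).1
  exact h3.comp (h2.comp h1)

lemma appLE_appIso_inv_germToFunctionField {Y Z : Scheme.{0}} (g : Z ⟶ Y) (j : Y ⟶ X)
    [IsOpenImmersion j] [IsOpenImmersion (g ≫ j)] (U : Y.Opens) (V : Z.Opens) (e : V ≤ g ⁻¹ᵁ U)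
    [Nonempty (j ''ᵁ U : X.Opens)] [Nonempty ((g ≫ j) ''ᵁ V : X.Opens)] :
    g.appLE U V e ≫ ((g ≫ j).appIso V).inv ≫ X.germToFunctionField ((g ≫ j) ''ᵁ V) =
      (j.appIso U).inv ≫ X.germToFunctionField (j ''ᵁ U) := by
  rw [← Iso.cancel_iso_hom_left (j.appIso U), Iso.hom_inv_id_assoc, Scheme.Hom.appIso_hom',
    Scheme.Hom.appLE_comp_appLE_assoc, Scheme.Hom.appLE_appIso_inv_assoc]
  exact TopCat.Presheaf.germ_res _ _ _ _

/-- Compatibility of charts: it lets a regular function on any toric chart be compared with its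
restriction to the torus. -/
lemma toFunctionFieldOf_comp (f : R →+* S) (j : Spec (.of R) ⟶ X) [IsOpenImmersion j]
    [Nonempty (Spec (.of R))] [Nonempty (Spec (.of S))]
    (j' : Spec (.of S) ⟶ X) [IsOpenImmersion j']
    (h : Spec.map (CommRingCat.ofHom f) ≫ j = j') :
    (toFunctionFieldOf j').comp f = toFunctionFieldOf j := by
  subst h
  have key := appLE_appIso_inv_germToFunctionField (Spec.map (CommRingCat.ofHom f)) j ⊤ ⊤ le_top
  have h : (Spec.map (CommRingCat.ofHom f)).appLE ⊤ ⊤ le_top =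
      (Spec.map (CommRingCat.ofHom f)).appTop := Scheme.Hom.appLE_eq_app _
  rw [h] at key
  have := congrArg (fun g => (Scheme.ΓSpecIso (.of R)).inv ≫ g) key
  simp only [← Scheme.ΓSpecIso_inv_naturality_assoc] at this
  exact congrArg CommRingCat.Hom.hom this

section Order

variable [IsLocallyNoetherian X] (j : Spec (.of R) ⟶ X) [IsOpenImmersion j]
  [Nonempty (Spec (.of R))]

/-- Together with multiplicativity, this lemma and the next two are all that is needed about orders:
regular functions have none that are negative, a function not in p has order zero, a generator of p
has order one. -/
lemma ord_toFunctionFieldOf_nonneg (p : PrimeSpectrum R) (r : R) :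
    0 ≤ Scheme.ord (toFunctionFieldOf j r) (j p) := by
  by_cases hx : Order.coheight (j p) = 1
  · by_cases hr : r = 0
    · simp [hr]
    have h0 : toFunctionFieldOf j r ≠ 0 :=
      (map_ne_zero_iff _ (toFunctionFieldOf_injective j)).mpr hr
    have : Ring.KrullDimLE 1 (X.presheaf.stalk (j p)) := krullDimLE_of_coheight_le hx.le
    rw [Scheme.le_ord_iff hx h0, ← algebraMap_toStalkOf j p]
    refine Ring.ordFrac_ge_one_of_ne_zero ?_
    rintro h
    rw [← algebraMap_toStalkOf j p, h, map_zero] at h0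
    exact h0 rfl
  · rw [Scheme.ord_eq_zero_of_coheight_neq_one hx]

lemma ord_toFunctionFieldOf_of_notMem {p : PrimeSpectrum R} {r : R} (hr : r ∉ p.asIdeal) :
    Scheme.ord (toFunctionFieldOf j r) (j p) = 0 := by
  by_cases hx : Order.coheight (j p) = 1
  · have h0 : toFunctionFieldOf j r ≠ 0 :=
      (map_ne_zero_iff _ (toFunctionFieldOf_injective j)).mpr fun h => hr (h ▸ zero_mem _)
    have : Ring.KrullDimLE 1 (X.presheaf.stalk (j p)) := krullDimLE_of_coheight_le hx.le
    rw [Scheme.ord_eq_iff hx h0, ← algebraMap_toStalkOf j p]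
    exact Ring.ordFrac_of_isUnit (isUnit_toStalkOf j hr)
  · exact Scheme.ord_eq_zero_of_coheight_neq_one hx _

lemma ord_toFunctionFieldOf_of_span {p : PrimeSpectrum R} (hx : Order.coheight (j p) = 1) {r : R}
    (hr : r ≠ 0) (hp : p.asIdeal = Ideal.span {r}) :
    Scheme.ord (toFunctionFieldOf j r) (j p) = 1 := by
  have h0 : toFunctionFieldOf j r ≠ 0 :=
    (map_ne_zero_iff _ (toFunctionFieldOf_injective j)).mpr hr
  have hk : Ring.KrullDimLE 1 (X.presheaf.stalk (j p)) := krullDimLE_of_coheight_le hx.le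
  have hs : toStalkOf j p r ≠ 0 := by
    intro h
    rw [← algebraMap_toStalkOf j p, h, map_zero] at h0
    exact h0 rfl
  rw [Scheme.ord_eq_iff hx h0, ← algebraMap_toStalkOf j p]
  refine (Ring.ordFrac_eq_ord _ hs).trans ?_
  refine Ring.ordMonoidWithZeroHom_eq_coe _ (mem_nonZeroDivisors_of_ne_zero hs) (n := 1) ?_
  refine ringOrd_of_isMaximal ?_
  -- The maximal ideal of the local ring is the extension of p, so it is generated by the image of
  -- r.
  let := (toStalkOf j p).toAlgebra
  have := isLocalization_toStalkOf j p
  have := IsLocalization.AtPrime.map_eq_maximalIdeal p.asIdeal (X.presheaf.stalk (j p))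
  rw [hp, Ideal.map_span, Set.image_singleton] at this
  change Ideal.span {toStalkOf j p r} = _ at this
  rw [this]
  infer_instance

end Order

end OpenImmersion

/-! ### Order of a Laurent polynomial along the divisors D_j -/

section ToricOrder

open CategoryTheory CategoryTheory.Limits AlgebraicGeometry

variable {n : ℕ}

lemma coeff_single_one_mul (a m : ℤ × ℤ) (q : TorusRing) :
    (AddMonoidAlgebra.single a (1 : ℂ) * q).coeff m = q.coeff (m - a) := by
  rw [AddMonoidAlgebra.coeff_single_mul_eq_mul_coeff (m - a), one_mul]
  intro m' _
  constructor
  · rintro rfl; abel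
  · rintro rfl; abel

/-- The inclusion `ℂ[σ^∨ ∩ M] → ℂ[M]`. -/
noncomputable def inclTorus (S : Finset (Fin (n + 1))) : ChartRing S →+* TorusRing :=
  AddMonoidAlgebra.mapDomainRingHom ℂ (dualMonoid S).subtype

lemma inclTorus_single (S : Finset (Fin (n + 1))) (m : dualMonoid S) (c : ℂ) :
    inclTorus S (AddMonoidAlgebra.single m c) = AddMonoidAlgebra.single (m : ℤ × ℤ) c := by
  simp [inclTorus]

lemma inclTorus_injective (S : Finset (Fin (n + 1))) : Function.Injective (inclTorus S) :=
  AddMonoidAlgebra.mapDomain_injective Subtype.val_injective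

lemma inclTorus_chartMap {S T : Finset (Fin (n + 1))} (h : S ⊆ T) (r : ChartRing T) :
    inclTorus S (chartMap h r) = inclTorus T r := by
  induction r using AddMonoidAlgebra.induction_linear with
  | zero => simp
  | add f g hf hg => simp only [map_add, hf, hg]
  | single m c => rw [chartMap_single, inclTorus_single, inclTorus_single]; rfl

lemma mem_dualMonoid_of_coeff_inclTorus {S : Finset (Fin (n + 1))} (r : ChartRing S) {m : ℤ × ℤ}
    (hm : (inclTorus S r).coeff m ≠ 0) : m ∈ dualMonoid S := by
  induction r using AddMonoidAlgebra.induction_linear with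
  | zero => simp at hm
  | add f g hf hg =>
    by_contra hc
    rw [map_add, AddMonoidAlgebra.coeff_add, Finsupp.add_apply,
      not_not.mp (mt hf hc), not_not.mp (mt hg hc)] at hm
    simp at hm
  | single w c =>
    rw [inclTorus_single, AddMonoidAlgebra.coeff_single] at hm
    have : m = w := by
      by_contra hc
      exact hm (Finsupp.single_eq_of_ne hc)
    rw [this]
    exact w.2

lemma exists_inclTorus_eq {S : Finset (Fin (n + 1))} (q : TorusRing)
    (h : ∀ m, q.coeff m ≠ 0 → m ∈ dualMonoid S) : ∃ r, inclTorus S r = q := by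
  refine ⟨∑ m ∈ q.coeff.support.attach, AddMonoidAlgebra.single
    (⟨m, h m (Finsupp.mem_support_iff.mp m.2)⟩ : dualMonoid S) (q.coeff m), ?_⟩
  rw [map_sum]
  simp only [inclTorus_single]
  rw [Finset.sum_attach q.coeff.support fun m => AddMonoidAlgebra.single m (q.coeff m)]
  apply AddMonoidAlgebra.coeff_injective
  rw [AddMonoidAlgebra.coeff_sum]
  simp only [AddMonoidAlgebra.coeff_single]
  exact q.coeff.sum_single

lemma single_zero_one : (AddMonoidAlgebra.single (0, 0) 1 : TorusRing) = 1 := rfl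

/-- The element `x` of the chart ring of a cone. -/
noncomputable def chartX (S : Finset (Fin (n + 1))) : ChartRing S :=
  AddMonoidAlgebra.single (⟨(1, 0), fun j _ => by simp [pair]⟩ : dualMonoid S) 1

lemma chartX_ne_zero (S : Finset (Fin (n + 1))) : chartX S ≠ 0 := by
  intro h
  have := congrArg (fun r => (AddMonoidAlgebra.coeff r) ⟨(1, 0), fun j _ => by simp [pair]⟩) h
  simp [chartX] at this

variable [NeZero n]

lemma coeff_orbitMap (j : Fin (n + 1)) (r : ChartRing (ray j).1) (m : ℤ × ℤ) :
    (orbitMap j r).coeff m = if pair m j = 0 then (inclTorus _ r).coeff m else 0 := by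
  induction r using AddMonoidAlgebra.induction_linear with
  | zero => simp
  | add f g hf hg =>
    simp only [map_add, AddMonoidAlgebra.coeff_add, Finsupp.add_apply, hf, hg]
    split_ifs <;> simp
  | single w c =>
    rw [inclTorus_single, orbitMap, AddMonoidAlgebra.lift_single]
    by_cases hw : m = w
    · subst hw
      by_cases h : pair (w : ℤ × ℤ) j = 0 <;> simp [h]
    · by_cases h : pair (w : ℤ × ℤ) j = 0 <;> simp [h, Finsupp.single_eq_of_ne hw]

lemma mem_ker_orbitMap {j : Fin (n + 1)} {r : ChartRing (ray j).1} :
    r ∈ RingHom.ker (orbitMap j) ↔ ∀ m, pair m j = 0 → (inclTorus _ r).coeff m = 0 := by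
  rw [RingHom.mem_ker]
  constructor
  · intro h m hm
    have := coeff_orbitMap j r m
    rw [if_pos hm] at this
    rw [← this, h]; rfl
  · intro h
    apply AddMonoidAlgebra.coeff_injective
    ext m
    rw [coeff_orbitMap]
    split_ifs with hm
    · rw [h m hm]; rfl
    · rfl

/-- All v_j have first coordinate one, so x = χ^(1,0) pairs to one with each of them. A function
vanishing on the orbit has only exponents with positive pairing, and these remain in the dual monoid
after subtracting (1, 0). Thus x is a uniformizer along every D_j. -/
lemma ker_orbitMap (j : Fin (n + 1)) :
    RingHom.ker (orbitMap j) = Ideal.span {chartX (ray j).1} := by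
  ext r
  rw [mem_ker_orbitMap, Ideal.mem_span_singleton]
  constructor
  · intro h
    obtain ⟨r', hr'⟩ := exists_inclTorus_eq (S := (ray j).1)
      (AddMonoidAlgebra.single (-(1, 0)) 1 * inclTorus _ r) (by
        intro m hm i hi
        obtain rfl : i = j := Finset.mem_singleton.mp hi
        rw [coeff_single_one_mul] at hm
        have h1 := mem_dualMonoid_of_coeff_inclTorus r hm i hi
        have h2 : pair (m - -(1, 0)) i ≠ 0 := fun h0 => hm (h _ h0)
        simp [pair] at h1 h2 ⊢
        omega)
    refine ⟨r', inclTorus_injective _ ?_⟩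
    rw [map_mul, hr', chartX, inclTorus_single, ← mul_assoc, AddMonoidAlgebra.single_mul_single]
    simp [single_zero_one]
  · rintro ⟨r', rfl⟩ m hm
    rw [map_mul, chartX, inclTorus_single, coeff_single_one_mul]
    by_contra hc
    have := mem_dualMonoid_of_coeff_inclTorus r' hc j (Finset.mem_singleton_self j)
    simp [pair] at this hm
    omega

lemma toRational_eq (q : TorusRing) :
    toRational n q = toFunctionFieldOf (chart (zeroCone n)) (toZeroChart n q) := rfl

lemma inclTorus_toZeroChart (q : TorusRing) : inclTorus _ (toZeroChart n q) = q := by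
  induction q using AddMonoidAlgebra.induction_linear with
  | zero => simp
  | add f g hf hg => simp only [map_add, hf, hg]
  | single m c => simp only [toZeroChart, inclTorus, AddMonoidAlgebra.mapDomainRingHom_apply,
      AddMonoidAlgebra.mapDomain_single]; rfl

lemma toZeroChart_inclTorus (r : ChartRing (zeroCone n).1) :
    toZeroChart n (inclTorus _ r) = r :=
  inclTorus_injective _ (inclTorus_toZeroChart _)

lemma toRational_injective : Function.Injective (toRational n) := by
  intro a b h
  rw [toRational_eq, toRational_eq] at h
  have := toFunctionFieldOf_injective _ h
  rw [← inclTorus_toZeroChart (n := n) a, this, inclTorus_toZeroChart]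

/-- Every chart contains the torus, so its regular functions are Laurent polynomials and orders can
be computed on exponents. -/
lemma toFunctionFieldOf_chart (σ : FanCone n) (r : ChartRing σ.1) :
    toFunctionFieldOf (chart σ) r = toRational n (inclTorus _ r) := by
  rw [toRational_eq]
  let f : zeroCone n ⟶ σ := homOfLE (Finset.empty_subset σ.1 : (∅ : Finset (Fin (n + 1))) ⊆ σ.1)
  have h := toFunctionFieldOf_comp (chartMap (leOfHom f)) (chart σ) (chart (zeroCone n))
    (colimit.w (fanDiagram n) f)
  rw [← h, RingHom.comp_apply, ← inclTorus_chartMap (leOfHom f), toZeroChart_inclTorus]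

/-- The prime is generated by the single nonzero element x, so its height is one by Krull's
principal ideal theorem. -/
lemma coheight_divisorPoint (j : Fin (n + 1)) : Order.coheight (divisorPoint j) = 1 := by
  rw [divisorPoint, coheight_eq_height]
  change (RingHom.ker (orbitMap j)).height = 1
  rw [ker_orbitMap]
  refine Ideal.height_span_singleton_eq_one_of_mem_nonZeroDivisors
    (mem_nonZeroDivisors_of_ne_zero (chartX_ne_zero _)) ?_
  rw [← Ideal.span_singleton_eq_top, ← ker_orbitMap]
  exact (RingHom.ker_isPrime _).ne_top

lemma ord_single_fst (j : Fin (n + 1)) (a : ℤ) :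
    Scheme.ord (toRational n (AddMonoidAlgebra.single (a, 0) 1)) (divisorPoint j) = a := by
  have hne : ∀ a : ℤ, toRational n (AddMonoidAlgebra.single (a, 0) 1) ≠ 0 := by
    intro a
    rw [map_ne_zero_iff _ toRational_injective]
    intro h
    have := congrArg (fun q => AddMonoidAlgebra.coeff q (a, 0)) h
    simp at this
  have h1 : Scheme.ord (toRational n (AddMonoidAlgebra.single (1, 0) 1)) (divisorPoint j) = 1 := by
    have := ord_toFunctionFieldOf_of_span (chart (ray j))
      (p := ⟨RingHom.ker (orbitMap j), RingHom.ker_isPrime _⟩) (coheight_divisorPoint j)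
      (chartX_ne_zero _) (ker_orbitMap j)
    rw [toFunctionFieldOf_chart, chartX, inclTorus_single] at this
    exact this
  -- Multiplying by x raises the order by one; this recursion determines the order for exponents of
  -- both signs.
  have hadd : ∀ a : ℤ,
      Scheme.ord (toRational n (AddMonoidAlgebra.single (a + 1, 0) 1)) (divisorPoint j) =
      Scheme.ord (toRational n (AddMonoidAlgebra.single (a, 0) 1)) (divisorPoint j) + 1 := by
    intro a
    have := Scheme.ord_mul (x := divisorPoint j) (hne a) (hne 1)
    rw [← map_mul, AddMonoidAlgebra.single_mul_single, h1] at this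
    simpa using this
  have h0 : Scheme.ord (toRational n (AddMonoidAlgebra.single (0, 0) 1)) (divisorPoint j) = 0 := by
    have := hadd 0
    rw [zero_add, h1] at this
    omega
  induction a using Int.induction_on with
  | zero => exact h0
  | succ i hi => rw [hadd, hi]
  | pred i hi =>
    have := hadd (-(i : ℤ) - 1)
    rw [sub_add_cancel, hi] at this
    omega

/-- A Laurent polynomial all of whose exponents pair with `v_j` to at least `a` is `x ^ a` times a
regular function on the chart of the ray. -/
lemma exists_eq_single_mul_inclTorus (j : Fin (n + 1)) (a : ℤ) (q : TorusRing)
    (h : ∀ m, q.coeff m ≠ 0 → a ≤ pair m j) :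
    ∃ r : ChartRing (ray j).1, q = AddMonoidAlgebra.single (a, 0) 1 * inclTorus _ r := by
  obtain ⟨r, hr⟩ := exists_inclTorus_eq (S := (ray j).1)
    (AddMonoidAlgebra.single (-(a, 0)) 1 * q) (by
      intro m hm i hi
      obtain rfl : i = j := Finset.mem_singleton.mp hi
      rw [coeff_single_one_mul] at hm
      have h1 := h _ hm
      simp [pair] at h1 ⊢
      omega)
  refine ⟨r, ?_⟩
  rw [hr, ← mul_assoc, AddMonoidAlgebra.single_mul_single]
  simp [single_zero_one]

lemma le_ord_toRational {j : Fin (n + 1)} {a : ℤ} {q : TorusRing} (hq : q ≠ 0)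
    (h : ∀ m, q.coeff m ≠ 0 → a ≤ pair m j) :
    a ≤ Scheme.ord (toRational n q) (divisorPoint j) := by
  obtain ⟨r, rfl⟩ := exists_eq_single_mul_inclTorus j a q h
  have h0 := (map_ne_zero_iff _ (toRational_injective (n := n))).mpr hq
  rw [map_mul] at h0 ⊢
  rw [Scheme.ord_mul (left_ne_zero_of_mul h0) (right_ne_zero_of_mul h0), ord_single_fst,
    ← toFunctionFieldOf_chart]
  have := ord_toFunctionFieldOf_nonneg (chart (ray j))
    ⟨RingHom.ker (orbitMap j), RingHom.ker_isPrime _⟩ r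
  change 0 ≤ Scheme.ord _ (divisorPoint j) at this
  omega

/-- After division by x^a the function is regular, and m₀ contributes a term of pairing zero with
v_j. So the quotient does not vanish on the orbit and has order zero. -/
lemma ord_toRational_eq {j : Fin (n + 1)} {a : ℤ} {q : TorusRing}
    (h : ∀ m, q.coeff m ≠ 0 → a ≤ pair m j) {m₀ : ℤ × ℤ} (hm₀ : q.coeff m₀ ≠ 0)
    (ha : pair m₀ j = a) :
    Scheme.ord (toRational n q) (divisorPoint j) = a := by
  have hq : q ≠ 0 := by rintro rfl; simp at hm₀
  obtain ⟨r, rfl⟩ := exists_eq_single_mul_inclTorus j a q h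
  have h0 := (map_ne_zero_iff _ (toRational_injective (n := n))).mpr hq
  rw [map_mul] at h0 ⊢
  rw [Scheme.ord_mul (left_ne_zero_of_mul h0) (right_ne_zero_of_mul h0), ord_single_fst,
    ← toFunctionFieldOf_chart]
  have := ord_toFunctionFieldOf_of_notMem (chart (ray j))
    (p := ⟨RingHom.ker (orbitMap j), RingHom.ker_isPrime _⟩) (r := r) (by
      intro hr
      refine hm₀ ?_
      rw [coeff_single_one_mul]
      refine mem_ker_orbitMap.mp hr _ ?_
      simp [pair] at ha ⊢
      omega)
  change Scheme.ord _ (divisorPoint j) = 0 at this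
  omega

lemma ord_toRational_le {j : Fin (n + 1)} {q : TorusRing} {m : ℤ × ℤ} (hm : q.coeff m ≠ 0) :
    Scheme.ord (toRational n q) (divisorPoint j) ≤ pair m j := by
  -- The order is the minimum of the pairings over the support, attained at m₀.
  obtain ⟨m₀, hm₀, hmin⟩ := q.coeff.support.exists_min_image (fun m => pair m j)
    ⟨m, Finsupp.mem_support_iff.mpr hm⟩
  rw [ord_toRational_eq (fun m hm => hmin m (Finsupp.mem_support_iff.mpr hm))
    (Finsupp.mem_support_iff.mp hm₀) rfl]
  exact hmin m (Finsupp.mem_support_iff.mpr hm)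

end ToricOrder

/-! ### Codimension one points and global sections of O(D(b)) -/

section GlobalSections

open CategoryTheory CategoryTheory.Limits AlgebraicGeometry

variable {n : ℕ}

lemma chart_map {σ τ : FanCone n} (f : σ ⟶ τ) (z : (fanDiagram n).obj σ) :
    chart τ ((fanDiagram n).map f z) = chart σ z := by
  change colimit.ι (fanDiagram n) τ ((fanDiagram n).map f z) = colimit.ι (fanDiagram n) σ z
  rw [← Scheme.Hom.comp_apply, colimit.w]

/-- A point of the chart of `τ` at which the function `χ^m`, positive on the generators of `τ` that
are not in the face `σ` and zero on `σ`, is invertible lies in the chart of `σ`. -/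
lemma exists_chart_eq {σ τ : FanCone n} (f : σ ⟶ τ) (m : dualMonoid τ.1)
    (h0 : ∀ j ∈ σ.1, pair m j = 0) (h1 : ∀ j ∈ τ.1, j ∉ σ.1 → 1 ≤ pair m j)
    (p : PrimeSpectrum (ChartRing τ.1)) (hp : AddMonoidAlgebra.single m (1 : ℂ) ∉ p.asIdeal) :
    ∃ p' : PrimeSpectrum (ChartRing σ.1), chart τ p = chart σ p' := by
  obtain ⟨z, hz⟩ := (fanDiagram_mem_range f m h0 h1 p).mpr hp
  refine ⟨z, ?_⟩
  have h := chart_map f z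
  rw [← hz]
  exact h

/-- The coefficient of `D(b)` at `D_j`. -/
def divisorCoeff (b : Fin (n - 1) → ℕ) (j : Fin (n + 1)) : ℤ :=
  ∑ p : Fin (n - 1), (b p : ℤ) * max 0 ((p : ℤ) + 1 - (n - j))

variable [NeZero n]

/-- The inclusion of the zero cone in a cone. -/
def zeroHom (σ : FanCone n) : zeroCone n ⟶ σ :=
  homOfLE (Finset.empty_subset σ.1 : (∅ : Finset (Fin (n + 1))) ⊆ σ.1)

/-- Two charts meet only in charts of common faces. If v_j does not span a face of σ, the common
face of σ and the ray is zero; but then x would be invertible at the generic point of D_j, where it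
vanishes. -/
lemma chart_ne_divisorPoint {σ : FanCone n} (j : Fin (n + 1)) (hj : j ∉ σ.1)
    (p : PrimeSpectrum (ChartRing σ.1)) : chart σ p ≠ divisorPoint j := by
  intro h
  obtain ⟨ρ, f, g, z, -, hz⟩ := (Scheme.IsLocallyDirected.ι_eq_ι_iff (fanDiagram n)).mp h
  have hρ : ρ.1 = ∅ := by
    refine Finset.eq_empty_of_forall_notMem fun i hi => ?_
    obtain rfl : i = j := Finset.mem_singleton.mp (leOfHom g hi)
    exact hj (leOfHom f hi)
  have := (fanDiagram_mem_range g ⟨(1, 0), fun j _ => by simp [pair]⟩ (by simp [hρ])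
    (by simp [pair]) _).mp ⟨z, hz⟩
  refine this ?_
  change chartX (ray j).1 ∈ RingHom.ker (orbitMap j)
  rw [ker_orbitMap]
  exact Ideal.mem_span_singleton_self _

lemma divisorPoint_injective : Function.Injective (divisorPoint (n := n)) := by
  intro i j h
  by_contra hij
  exact chart_ne_divisorPoint (σ := ray i) j (by simpa [ray] using Ne.symm hij) _ h

lemma divisor_apply (b : Fin (n - 1) → ℕ) (j : Fin (n + 1)) :
    divisor b (divisorPoint j) = divisorCoeff b j := by
  simp only [divisor, divisorCoeff, basicDivisor, Finsupp.finsetSum_apply, Finsupp.smul_apply,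
    primeDivisor, smul_eq_mul]
  refine Finset.sum_congr rfl fun p _ => ?_
  congr 1
  have hp := p.2
  have hj := j.2
  -- D_j is the term of index n - j in the sum defining D(p + 1), so it occurs exactly when n - j ≤
  -- p; otherwise the maximum in `divisorCoeff` is zero.
  by_cases h : n - (j : ℕ) ≤ p
  · rw [Finset.sum_eq_single (n - (j : ℕ))]
    · rw [show (⟨n - (n - (j : ℕ)), by omega⟩ : Fin (n + 1)) = j from Fin.ext (by simp; omega),
        Finsupp.single_eq_same]
      omega
    · intro i hi hij
      rw [Finsupp.single_eq_of_ne, mul_zero]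
      intro he
      have := congrArg Fin.val (divisorPoint_injective he)
      simp at this hi
      omega
    · intro hc
      simp at hc
      omega
  · rw [Finset.sum_eq_zero, max_eq_left (by omega)]
    intro i hi
    rw [Finsupp.single_eq_of_ne, mul_zero]
    intro he
    have := congrArg Fin.val (divisorPoint_injective he)
    simp at this hi
    omega

lemma divisor_apply_of_forall_ne (b : Fin (n - 1) → ℕ) {x : ToricSurface n}
    (h : ∀ j, x ≠ divisorPoint j) : divisor b x = 0 := by
  simp [divisor, basicDivisor, primeDivisor, Finsupp.finsetSum_apply, h]

lemma divisor_apply_zeroChart (b : Fin (n - 1) → ℕ) (p : PrimeSpectrum (ChartRing (zeroCone n).1)) :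
    divisor b (chart (zeroCone n) p) = 0 :=
  divisor_apply_of_forall_ne b fun j => chart_ne_divisorPoint j (Finset.notMem_empty _) p

/-- A point of codimension one in the chart of a ray is in the torus or is the generic point of
the orbit closure. -/
lemma ray_cases (j : Fin (n + 1)) (p : PrimeSpectrum (ChartRing (ray j).1))
    (h : Order.coheight (chart (ray j) p) = 1) :
    (∃ p', chart (ray j) p = chart (zeroCone n) p') ∨ chart (ray j) p = divisorPoint j := by
  -- If x vanishes at p, then p contains the height one prime (x) and, having height one, equals it.
  -- If not, p lies in the torus.
  by_cases hx : chartX (ray j).1 ∈ p.asIdeal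
  · right
    rw [divisorPoint]
    congr 1
    refine PrimeSpectrum.ext ?_
    rw [coheight_eq_height] at h
    by_contra hne
    have hle : RingHom.ker (orbitMap j) ≤ p.asIdeal := by
      rw [ker_orbitMap, Ideal.span_singleton_le_iff_mem]; exact hx
    have := RingHom.ker_isPrime (orbitMap j)
    have h1 := Ideal.height_add_one_le_of_lt_of_isPrime (lt_of_le_of_ne hle (Ne.symm hne))
    have h2 : (RingHom.ker (orbitMap j)).height = 1 := by
      have := coheight_divisorPoint j
      rwa [divisorPoint, coheight_eq_height] at this
    rw [h, h2] at h1
    exact absurd h1 (by decide)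
  · left
    exact exists_chart_eq (zeroHom (ray j)) ⟨(1, 0), fun j _ => by simp [pair]⟩
      (fun i hi => absurd hi (Finset.notMem_empty _)) (by simp [pair]) p hx

/-- A point of codimension one in the chart of a cone with generators `v_i, v_j` such that there are
functions which vanish to order one along one of the divisors and to order zero along the other
is in the chart of a ray. -/
lemma cone_cases {σ : FanCone n} {i j : Fin (n + 1)} (hσ : σ.1 = {i, j})
    {s t : dualMonoid σ.1} (hsi : pair s i = 1) (hsj : pair s j = 0) (hti : pair t i = 0)
    (htj : pair t j = 1) (p : PrimeSpectrum (ChartRing σ.1))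
    (h : Order.coheight (chart σ p) = 1) :
    (∃ p', chart σ p = chart (ray i) p') ∨ ∃ p', chart σ p = chart (ray j) p' := by
  have hi : i ∈ σ.1 := by simp [hσ]
  have hj : j ∈ σ.1 := by simp [hσ]
  by_cases ht : AddMonoidAlgebra.single t (1 : ℂ) ∈ p.asIdeal
  · by_cases hs : AddMonoidAlgebra.single s (1 : ℂ) ∈ p.asIdeal
    -- If χ^s and χ^t both vanish at p, then p contains the prime Q = (χ^s) of D_i, and properly,
    -- since χ^t is not in Q. The chain 0 < Q < p contradicts height one.
    · exfalso
      let f : ray i ⟶ σ := homOfLE (Finset.singleton_subset_iff.mpr hi : {i} ⊆ σ.1)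
      let Q : Ideal (ChartRing σ.1) := (RingHom.ker (orbitMap i)).comap (chartMap (leOfHom f))
      have hQ : Q.IsPrime := by
        have := RingHom.ker_isPrime (orbitMap i)
        exact Ideal.comap_isPrime _ _
      have hmem : ∀ r, r ∈ Q ↔ ∀ m, pair m i = 0 → (inclTorus _ r).coeff m = 0 := by
        intro r
        rw [Ideal.mem_comap, mem_ker_orbitMap]
        simp only [inclTorus_chartMap]
      have hsQ : AddMonoidAlgebra.single s (1 : ℂ) ∈ Q := by
        rw [hmem]
        intro m hm
        rw [inclTorus_single, AddMonoidAlgebra.coeff_single, Finsupp.single_eq_of_ne]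
        rintro rfl
        omega
      have htQ : AddMonoidAlgebra.single t (1 : ℂ) ∉ Q := by
        rw [hmem]
        intro hc
        have := hc t hti
        simp [inclTorus_single] at this
      have hQp : Q ≤ p.asIdeal := by
        intro r hr
        rw [hmem] at hr
        obtain ⟨r', hr'⟩ := exists_inclTorus_eq (S := σ.1)
          (AddMonoidAlgebra.single (-(s : ℤ × ℤ)) 1 * inclTorus _ r) (by
            intro m hm l hl
            rw [coeff_single_one_mul] at hm
            have h1 := mem_dualMonoid_of_coeff_inclTorus r hm l hl
            have h2 : pair (m - -s) i ≠ 0 := fun h0 => hm (hr _ h0)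
            have h3 := mem_dualMonoid_of_coeff_inclTorus r hm i hi
            rw [hσ, Finset.mem_insert, Finset.mem_singleton] at hl
            rw [sub_neg_eq_add, pair_add] at h1 h2 h3
            rcases hl with rfl | rfl <;> omega)
        have : r = AddMonoidAlgebra.single s 1 * r' := by
          refine inclTorus_injective _ ?_
          rw [map_mul, hr', inclTorus_single, ← mul_assoc, AddMonoidAlgebra.single_mul_single]
          simp only [add_neg_cancel, mul_one]
          exact (one_mul _).symm
        rw [this]
        exact Ideal.mul_mem_right _ _ hs
      have hbot : (⊥ : Ideal (ChartRing σ.1)) < Q := by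
        refine bot_lt_iff_ne_bot.mpr fun hc => ?_
        rw [hc, Ideal.mem_bot] at hsQ
        have := congrArg (fun r => AddMonoidAlgebra.coeff r s) hsQ
        simp at this
      have hlt : Q < p.asIdeal := lt_of_le_of_ne hQp fun hc => htQ (hc ▸ ht)
      rw [coheight_eq_height] at h
      have h1 := Ideal.height_add_one_le_of_lt_of_isPrime hbot
      have h2 := Ideal.height_add_one_le_of_lt_of_isPrime hlt
      rw [h] at h2
      rw [Ideal.height_bot] at h1
      have := (add_le_add_left h1 1).trans h2
      exact absurd this (by decide)
    · right
      let f : ray j ⟶ σ := homOfLE (Finset.singleton_subset_iff.mpr hj : {j} ⊆ σ.1)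
      refine exists_chart_eq f s ?_ ?_ p hs
      · intro l hl
        obtain rfl := Finset.mem_singleton.mp hl
        exact hsj
      · intro l hl hl'
        rw [hσ, Finset.mem_insert, Finset.mem_singleton] at hl
        rcases hl with rfl | rfl
        · exact hsi.ge
        · exact absurd (Finset.mem_singleton_self _) hl'
  · left
    let f : ray i ⟶ σ := homOfLE (Finset.singleton_subset_iff.mpr hi : {i} ⊆ σ.1)
    refine exists_chart_eq f t ?_ ?_ p ht
    · intro l hl
      obtain rfl := Finset.mem_singleton.mp hl
      exact hti
    · intro l hl hl'
      rw [hσ, Finset.mem_insert, Finset.mem_singleton] at hl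
      rcases hl with rfl | rfl
      · exact absurd (Finset.mem_singleton_self _) hl'
      · exact htj.ge

/-- The points of codimension one of `X` are points of the torus and the generic points of the
divisors `D_j`. -/
lemma codimension_one_cases (x : ToricSurface n) (hx : Order.coheight x = 1) :
    (∃ p, x = chart (zeroCone n) p) ∨ ∃ j, x = divisorPoint j := by
  have hray : ∀ j p, x = chart (ray j) p →
      (∃ p, x = chart (zeroCone n) p) ∨ ∃ j, x = divisorPoint j := by
    rintro j p rfl
    rcases ray_cases j p hx with h | h
    · exact Or.inl h
    · exact Or.inr ⟨j, h⟩
  obtain ⟨σ, p, rfl⟩ := Scheme.IsLocallyDirected.ι_jointly_surjective (fanDiagram n) x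
  change PrimeSpectrum (ChartRing σ.1) at p
  change Order.coheight (chart σ p) = 1 at hx
  change ∀ j p', chart σ p = chart (ray j) p' → _ at hray
  obtain ⟨S, i, hi⟩ := σ
  by_cases h1 : i.castSucc ∈ S <;> by_cases h2 : i.succ ∈ S
  · have hS : S = {i.castSucc, i.succ} := by
      refine Finset.Subset.antisymm hi ?_
      intro l hl
      rw [Finset.mem_insert, Finset.mem_singleton] at hl
      rcases hl with rfl | rfl <;> assumption
    -- (i + 1, -1) and (-i, 1) form the basis of M dual to v_i, v_{i+1}.
    rcases cone_cases (σ := ⟨S, i, hi⟩) (i := i.castSucc) (j := i.succ) hS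
      (s := ⟨((i : ℤ) + 1, -1), by
        intro l hl
        change l ∈ S at hl
        rw [hS, Finset.mem_insert, Finset.mem_singleton] at hl
        rcases hl with rfl | rfl <;> simp [pair]⟩)
      (t := ⟨(-(i : ℤ), 1), by
        intro l hl
        change l ∈ S at hl
        rw [hS, Finset.mem_insert, Finset.mem_singleton] at hl
        rcases hl with rfl | rfl <;> simp [pair]⟩) (by simp [pair]) (by simp [pair])
      (by simp [pair]) (by simp [pair]) p hx with ⟨p', h⟩ | ⟨p', h⟩
    · exact hray _ _ h
    · exact hray _ _ h
  · obtain rfl : S = {i.castSucc} := by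
      refine Finset.Subset.antisymm (fun l hl => ?_) (Finset.singleton_subset_iff.mpr h1)
      have := hi hl
      rw [Finset.mem_insert, Finset.mem_singleton] at this
      rcases this with rfl | rfl
      · exact Finset.mem_singleton_self _
      · exact absurd hl h2
    exact hray _ p rfl
  · obtain rfl : S = {i.succ} := by
      refine Finset.Subset.antisymm (fun l hl => ?_) (Finset.singleton_subset_iff.mpr h2)
      have := hi hl
      rw [Finset.mem_insert, Finset.mem_singleton] at this
      rcases this with rfl | rfl
      · exact absurd hl h1
      · exact Finset.mem_singleton_self _
    exact hray _ p rfl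
  · obtain rfl : S = ∅ := by
      refine Finset.eq_empty_of_forall_notMem fun l hl => ?_
      have := hi hl
      rw [Finset.mem_insert, Finset.mem_singleton] at this
      rcases this with rfl | rfl
      · exact h1 hl
      · exact h2 hl
    exact Or.inl ⟨p, rfl⟩

/-- Laurent polynomials over a factorial ring are a localization of the polynomial ring; this is
applied twice, reading ℂ[ℤ × ℤ] as an iterated Laurent ring. -/
instance torusRing_uniqueFactorizationMonoid : UniqueFactorizationMonoid TorusRing := by
  have h1 : UniqueFactorizationMonoid (LaurentPolynomial ℂ) :=
    UniqueFactorizationMonoid.of_isLocalization (Submonoid.powers (Polynomial.X : Polynomial ℂ)) _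
  have h2 : UniqueFactorizationMonoid (LaurentPolynomial (LaurentPolynomial ℂ)) :=
    UniqueFactorizationMonoid.of_isLocalization
      (Submonoid.powers (Polynomial.X : Polynomial (LaurentPolynomial ℂ))) _
  exact MulEquiv.uniqueFactorizationMonoid
    (AddMonoidAlgebra.curryRingEquiv (R := ℂ) (M := ℤ) (N := ℤ)).symm.toMulEquiv h2

/-- The chart of the zero cone is the torus. -/
noncomputable def zeroChartEquiv : TorusRing ≃+* ChartRing (zeroCone n).1 :=
  RingEquiv.ofBijective (toZeroChart n)
    ⟨fun a b h => by rw [← inclTorus_toZeroChart (n := n) a, h, inclTorus_toZeroChart],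
      fun r => ⟨_, toZeroChart_inclTorus r⟩⟩

/-- The torus chart is a nonempty affine open set, so the function field is its fraction field;
factoriality allows the fraction to be reduced. -/
lemma exists_toRational_div (f : (ToricSurface n).functionField) :
    ∃ a b : ChartRing (zeroCone n).1, b ≠ 0 ∧ IsRelPrime a b ∧
      f = toFunctionFieldOf (chart (zeroCone n)) a / toFunctionFieldOf (chart (zeroCone n)) b := by
  let := (toFunctionFieldOf (chart (zeroCone n))).toAlgebra
  have hfrac : IsFractionRing (ChartRing (zeroCone n).1) (ToricSurface n).functionField := by
    have : FaithfulSMul (ChartRing (zeroCone n).1) (ToricSurface n).functionField :=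
      (faithfulSMul_iff_algebraMap_injective _ _).mpr (toFunctionFieldOf_injective _)
    have hU : IsAffineOpen (chart (zeroCone n) ''ᵁ ⊤) :=
      (isAffineOpen_top _).image_of_isOpenImmersion _
    have := functionField_isFractionRing_of_isAffineOpen _ _ hU
    refine IsFractionRing.of_field _ _ fun z => ?_
    obtain ⟨x, y, -, rfl⟩ := IsFractionRing.div_surjective
      (A := Γ(ToricSurface n, chart (zeroCone n) ''ᵁ ⊤)) z
    have hs : Function.Surjective ((Scheme.ΓSpecIso (.of (ChartRing (zeroCone n).1))).inv ≫
        ((chart (zeroCone n)).appIso ⊤).inv) :=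
      (ConcreteCategory.bijective_of_isIso _).2
    obtain ⟨a, rfl⟩ := hs x
    obtain ⟨b, rfl⟩ := hs y
    exact ⟨a, b, rfl⟩
  have hufd : UniqueFactorizationMonoid (ChartRing (zeroCone n).1) :=
    MulEquiv.uniqueFactorizationMonoid (zeroChartEquiv (n := n)).toMulEquiv inferInstance
  obtain ⟨a, b, hab, h⟩ := IsFractionRing.exists_reduced_fraction (ChartRing (zeroCone n).1) f
  refine ⟨a, b, nonZeroDivisors.ne_zero b.2, hab, ?_⟩
  rw [← h, IsFractionRing.mk'_eq_div]
  rfl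

/-- Rational functions without poles on the torus are Laurent polynomials. -/
lemma exists_toRational_eq (f : (ToricSurface n).functionField)
    (h : ∀ p, Order.coheight (chart (zeroCone n) p) = 1 →
      0 ≤ Scheme.ord f (chart (zeroCone n) p)) : ∃ q, f = toRational n q := by
  by_cases hf : f = 0
  · exact ⟨0, by rw [hf, map_zero]⟩
  have hufd : UniqueFactorizationMonoid (ChartRing (zeroCone n).1) :=
    MulEquiv.uniqueFactorizationMonoid (zeroChartEquiv (n := n)).toMulEquiv inferInstance
  obtain ⟨a, b, hb, hab, rfl⟩ := exists_toRational_div f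
  have hinj := toFunctionFieldOf_injective (chart (zeroCone n))
  by_cases hu : IsUnit b
  · obtain ⟨c, hc⟩ := hu.exists_right_inv
    refine ⟨inclTorus _ (a * c), ?_⟩
    rw [← toFunctionFieldOf_chart, div_eq_iff ((map_ne_zero_iff _ hinj).mpr hb), ← map_mul,
      mul_assoc, mul_comm c, hc, mul_one]
  · exfalso
    -- A prime factor π of the denominator defines a codimension one point of the torus. There the
    -- denominator has order at least one and the coprime numerator order zero, so f would have a
    -- pole.
    obtain ⟨π, hπ, c, rfl⟩ := WfDvdMonoid.exists_irreducible_factor hu hb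
    have hprime : Prime π := hπ.prime
    let p : PrimeSpectrum (ChartRing (zeroCone n).1) :=
      ⟨Ideal.span {π}, (Ideal.span_singleton_prime hprime.ne_zero).mpr hprime⟩
    have hht : Order.coheight (chart (zeroCone n) p) = 1 := by
      rw [coheight_eq_height]
      exact Ideal.height_span_singleton_eq_one_of_mem_nonZeroDivisors
        (mem_nonZeroDivisors_of_ne_zero hprime.ne_zero) hprime.not_isUnit
    have ha : a ∉ p.asIdeal := by
      rw [Ideal.mem_span_singleton]
      intro hd
      exact hprime.not_isUnit (hab hd (dvd_mul_right _ _))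
    have h1 := ord_toFunctionFieldOf_of_notMem (chart (zeroCone n)) ha
    have h2 := ord_toFunctionFieldOf_of_span (chart (zeroCone n)) hht hprime.ne_zero rfl
    have h3 := ord_toFunctionFieldOf_nonneg (chart (zeroCone n)) p c
    have h4 := h p hht
    have hbne := (map_ne_zero_iff _ hinj).mpr hb
    have h5 := Scheme.ord_mul (x := chart (zeroCone n) p) hf hbne
    rw [div_mul_cancel₀ _ hbne, h1] at h5
    rw [map_mul] at hbne
    have h6 := Scheme.ord_mul (x := chart (zeroCone n) p) (left_ne_zero_of_mul hbne)
      (right_ne_zero_of_mul hbne)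
    rw [← map_mul, h2] at h6
    omega

/-- The space `H⁰(X, O(D(b)))` is spanned by the monomials `χ^m` with `⟨m, v_j⟩ ≥ -d_j`. -/
lemma globalSections_divisor (b : Fin (n - 1) → ℕ) :
    globalSections (divisor b) =
      toRational n '' {q | ∀ m, q.coeff m ≠ 0 → ∀ j, -divisorCoeff b j ≤ pair m j} := by
  ext f
  constructor
  · intro hf
    by_cases h0 : f = 0
    · exact ⟨0, by simp, by rw [h0, map_zero]⟩
    have hf := hf.resolve_left h0
    -- D(b) is not supported at points of the torus, so f has no poles there.
    obtain ⟨q, rfl⟩ := exists_toRational_eq f fun p hp => by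
      have := hf _ trivial hp
      have hz : divisor b (chart (zeroCone n) p) = 0 := divisor_apply_zeroChart b p
      rwa [hz, add_zero] at this
    refine ⟨q, fun m hm j => ?_, rfl⟩
    have h1 := hf _ trivial (coheight_divisorPoint j)
    rw [divisor_apply] at h1
    have h2 := ord_toRational_le (n := n) (j := j) hm
    omega
  · rintro ⟨q, hq, rfl⟩
    by_cases h0 : q = 0
    · left; rw [h0, map_zero]
    right
    intro x _ hx
    rcases codimension_one_cases x hx with ⟨p, rfl⟩ | ⟨j, rfl⟩
    · have hz : divisor b (chart (zeroCone n) p) = 0 := divisor_apply_zeroChart b p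
      rw [hz, add_zero, toRational_eq]
      exact ord_toFunctionFieldOf_nonneg _ _ _
    · rw [divisor_apply]
      have := le_ord_toRational (n := n) h0 fun m hm => hq m hm j
      omega

end GlobalSections

/-! ### Calculus of the elements y^m f(y∂/n) e -/

section Monomials

open Polynomial

variable (n : ℕ)

lemma yPow_add (a b : ℤ) : yPow n (a + b) = yPow n a * yPow n b := by
  simp [yPow, zpow_add]

lemma yPow_zero : yPow n 0 = 1 := by simp [yPow]

lemma del_mul_yPow_one : del n * yPow n 1 = yPow n 1 * del n + 1 := by
  have := toCrossedProduct_rel (Rel.weyl (n := n))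
  simpa [yPow, yUnit, del, gen] using this

lemma gam_pow : gam n ^ n = 1 := by
  have := toCrossedProduct_rel (Rel.gam_pow (n := n))
  simpa [gam, gen] using this

lemma yPow_one_mul_gam : yPow n 1 * gam n = rootOfUnity n • (gam n * yPow n 1) := by
  have := toCrossedProduct_rel (Rel.y_gam (n := n))
  simpa [yPow, yUnit, gam, gen] using this

lemma gam_mul_del : gam n * del n = rootOfUnity n • (del n * gam n) := by
  have := toCrossedProduct_rel (Rel.gam_del (n := n))
  simpa [del, gam, gen] using this

lemma rootOfUnity_ne_zero : rootOfUnity n ≠ 0 := Complex.exp_ne_zero _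

lemma isPrimitiveRoot_rootOfUnity [NeZero n] : IsPrimitiveRoot (rootOfUnity n) n :=
  Complex.isPrimitiveRoot_exp n (NeZero.ne n)

/-- The Euler operator `y ∂`. -/
noncomputable def euler : CrossedProduct n := yPow n 1 * del n

lemma del_eq : del n = yPow n (-1) * euler n := by
  rw [euler, ← mul_assoc, ← yPow_add, neg_add_cancel, yPow_zero, one_mul]

lemma euler_mul_yPow (a : ℤ) : euler n * yPow n a = yPow n a * (euler n + (a : ℂ) • 1) := by
  -- The defect of the identity at b + 1 is the defect at b times the unit y, so its vanishing
  -- propagates from 0 in both directions.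
  have hstep : ∀ b : ℤ, euler n * yPow n (b + 1) - yPow n (b + 1) * (euler n + ((b + 1 : ℤ) : ℂ) • 1)
      = (euler n * yPow n b - yPow n b * (euler n + (b : ℂ) • 1)) * yPow n 1 := by
    intro b
    have h : euler n * yPow n 1 = yPow n 1 * euler n + yPow n 1 := by
      rw [euler, mul_assoc, del_mul_yPow_one, mul_add, mul_one]
    simp only [yPow_add, sub_mul, mul_add, mul_assoc, h, Int.cast_add, Int.cast_one, add_smul,
      one_smul, mul_one, mul_smul_comm, add_mul, smul_mul_assoc]
    abel
  rw [← sub_eq_zero]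
  induction a using Int.induction_on with
  | zero => simp [yPow_zero]
  | succ i hi => rw [hstep, hi, zero_mul]
  | pred i hi =>
    have h := hstep (-(i : ℤ) - 1)
    rw [sub_add_cancel, hi] at h
    have := congrArg (· * yPow n (-1)) h
    simpa [mul_assoc, ← yPow_add, yPow_zero] using this.symm

lemma gam_mul_yPow (a : ℤ) : gam n * yPow n a = (rootOfUnity n) ^ (-a) • (yPow n a * gam n) := by
  have hω := rootOfUnity_ne_zero n
  have hstep : ∀ b : ℤ, rootOfUnity n • (gam n * yPow n (b + 1) -
      rootOfUnity n ^ (-(b + 1)) • (yPow n (b + 1) * gam n)) =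
      rootOfUnity n • (gam n * yPow n b - rootOfUnity n ^ (-b) • (yPow n b * gam n)) *
        yPow n 1 := by
    intro b
    rw [smul_mul_assoc]
    congr 1
    rw [sub_mul, smul_mul_assoc, yPow_add, mul_assoc, mul_assoc, mul_assoc, yPow_one_mul_gam,
      mul_smul_comm, smul_smul, ← zpow_add_one₀ hω]
    simp
  rw [← sub_eq_zero]
  induction a using Int.induction_on with
  | zero => simp [yPow_zero]
  | succ i hi =>
    have h := hstep i
    rw [hi, smul_zero, zero_mul] at h
    exact (smul_eq_zero.mp h).resolve_left hω
  | pred i hi =>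
    have h := hstep (-(i : ℤ) - 1)
    rw [sub_add_cancel, hi, smul_zero] at h
    have := congrArg (· * yPow n (-1)) h
    simp only [zero_mul, mul_assoc, ← yPow_add, add_neg_cancel, yPow_zero, mul_one] at this
    exact (smul_eq_zero.mp this.symm).resolve_left hω

lemma commute_gam_euler : Commute (gam n) (euler n) := by
  rw [commute_iff_eq, euler, ← mul_assoc, gam_mul_yPow, smul_mul_assoc, mul_assoc, gam_mul_del,
    mul_smul_comm, smul_smul, mul_assoc, zpow_neg_one, inv_mul_cancel₀ (rootOfUnity_ne_zero n),
    one_smul]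

/-- The operator `y ∂ / n`, which acts on `y ^ (n t)` as `t`. -/
noncomputable def scaledEuler : CrossedProduct n := (n : ℂ)⁻¹ • euler n

lemma commute_gam_aeval (f : ℂ[X]) : Commute (gam n) (aeval (scaledEuler n) f) := by
  refine Polynomial.induction_on' f ?_ ?_
  · intro p q hp hq; rw [map_add]; exact hp.add_right hq
  · intro k a
    rw [aeval_monomial]
    exact (Algebra.commute_algebraMap_right a (gam n)).mul_right
      (((commute_gam_euler n).smul_right _).pow_right k)

lemma commute_idem_aeval (i : ℕ) (f : ℂ[X]) : Commute (idem n i) (aeval (scaledEuler n) f) :=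
  (Commute.sum_left _ _ _ fun j _ =>
    ((commute_gam_aeval n f).smul_left _).pow_left j).smul_left _

/-- The elements `y ^ m f(y ∂ / n) e`. -/
noncomputable def mono (m : ℤ) : ℂ[X] →ₗ[ℂ] CrossedProduct n :=
  LinearMap.mulRight ℂ (idem n 0) ∘ₗ LinearMap.mulLeft ℂ (yPow n m) ∘ₗ
    (aeval (scaledEuler n)).toLinearMap

lemma mono_apply (m : ℤ) (f : ℂ[X]) :
    mono n m f = yPow n m * aeval (scaledEuler n) f * idem n 0 := rfl

lemma yPow_mul_mono (a m : ℤ) (f : ℂ[X]) : yPow n a * mono n m f = mono n (a + m) f := by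
  rw [mono_apply, mono_apply, yPow_add, ← mul_assoc, ← mul_assoc]

lemma mono_zero_one : mono n 0 1 = idem n 0 := by simp [mono_apply, yPow_zero]

variable [NeZero n]

lemma gam_mul_idem_zero : gam n * idem n 0 = idem n 0 := by
  have hn := NeZero.pos n
  rw [idem, mul_smul_comm]
  congr 1
  simp only [pow_zero, one_smul]
  rw [Finset.mul_sum]
  simp only [← pow_succ']
  have h1 := Finset.sum_range_succ' (fun j => gam n ^ j) n
  have h2 := Finset.sum_range_succ (fun j => gam n ^ j) n
  rw [h2, gam_pow, pow_zero] at h1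
  exact (add_right_cancel h1).symm

lemma gam_mul_mono (m : ℤ) (f : ℂ[X]) :
    gam n * mono n m f = rootOfUnity n ^ (-m) • mono n m f := by
  rw [mono_apply, ← mul_assoc, ← mul_assoc, gam_mul_yPow, smul_mul_assoc, mul_assoc (yPow n m),
    (commute_gam_aeval n f).eq, smul_mul_assoc]
  rw [mul_assoc, mul_assoc, gam_mul_idem_zero, mul_assoc]

lemma gam_pow_mul_mono (m : ℤ) (f : ℂ[X]) (c : ℂ) (j : ℕ) :
    (c • gam n) ^ j * mono n m f = (c * rootOfUnity n ^ (-m)) ^ j • mono n m f := by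
  induction j with
  | zero => simp
  | succ j ih =>
    rw [pow_succ, mul_assoc, smul_mul_assoc, gam_mul_mono, smul_smul, mul_smul_comm, ih,
      smul_smul, pow_succ, mul_comm]

/-- γ acts on the element of degree m by ω^(-m), so e_i acts by a geometric sum over n-th roots of
unity: the projection to degrees congruent to i modulo n. -/
lemma idem_mul_mono (i : ℕ) (m : ℤ) (f : ℂ[X]) :
    idem n i * mono n m f = if (n : ℤ) ∣ m - i then mono n m f else 0 := by
  have hω := rootOfUnity_ne_zero n
  have hprim := isPrimitiveRoot_rootOfUnity n
  have hn : (n : ℂ) ≠ 0 := NeZero.ne _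
  rw [idem, smul_mul_assoc, Finset.sum_mul]
  simp only [gam_pow_mul_mono]
  rw [← Finset.sum_smul, smul_smul]
  have hz : rootOfUnity n ^ i * rootOfUnity n ^ (-m) = rootOfUnity n ^ (-(m - i)) := by
    rw [← zpow_natCast, ← zpow_add₀ hω]; congr 1; ring
  rw [hz]
  split_ifs with h
  · have : rootOfUnity n ^ (-(m - i)) = 1 :=
      (hprim.zpow_eq_one_iff_dvd _).mpr ((dvd_neg).mpr h)
    simp only [this, one_pow, Finset.sum_const, Finset.card_range, nsmul_eq_mul, mul_one,
      inv_mul_cancel₀ hn, one_smul]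
  · have hne : rootOfUnity n ^ (-(m - i)) ≠ 1 := fun hc =>
      h ((dvd_neg).mp ((hprim.zpow_eq_one_iff_dvd _).mp hc))
    have hp : (rootOfUnity n ^ (-(m - i))) ^ n = 1 := by
      rw [← zpow_natCast, ← zpow_mul, mul_comm, zpow_mul, zpow_natCast, hprim.pow_eq_one, one_zpow]
    rw [geom_sum_eq hne, hp, sub_self, zero_div, mul_zero, zero_smul]

lemma idem_zero_mul_mono (a : ℤ) (f : ℂ[X]) : idem n 0 * mono n (n * a) f = mono n (n * a) f := by
  rw [idem_mul_mono, if_pos (by simp)]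

/-- Conjugation by y^p turns γ into ω^p γ, so e_p y^p = y^p e. This puts the right-hand generator of
a basic bimodule into monomial form. -/
lemma idem_mul_yPow (p : ℕ) : idem n p * yPow n p = mono n p 1 := by
  have h := idem_mul_mono n p p 1
  rw [sub_self, if_pos (dvd_zero _)] at h
  rw [mono_apply, map_one, mul_one, idem, idem, smul_mul_assoc, mul_smul_comm, Finset.sum_mul,
    Finset.mul_sum]
  congr 1
  refine Finset.sum_congr rfl fun j _ => ?_
  rw [pow_zero, one_smul]
  refine ((?_ : SemiconjBy (yPow n p) (gam n) (rootOfUnity n ^ p • gam n)).pow_right j).eq.symm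
  rw [SemiconjBy, smul_mul_assoc, gam_mul_yPow, smul_smul, ← zpow_natCast,
    ← zpow_add₀ (rootOfUnity_ne_zero n)]
  simp

lemma euler_mul_mono (m : ℤ) (f : ℂ[X]) :
    euler n * mono n m f = mono n m ((C (n : ℂ) * X + C (m : ℂ)) * f) := by
  have hn : (n : ℂ) ≠ 0 := NeZero.ne _
  have h : euler n + (m : ℂ) • 1 = aeval (scaledEuler n) (C (n : ℂ) * X + C (m : ℂ)) := by
    simp only [map_add, map_mul, aeval_C, aeval_X, scaledEuler, Algebra.algebraMap_eq_smul_one,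
      smul_mul_assoc, one_mul, smul_smul]
    rw [mul_inv_cancel₀ hn, one_smul]
  rw [mono_apply, mono_apply, ← mul_assoc, ← mul_assoc, euler_mul_yPow, h, map_mul, mul_assoc,
    mul_assoc, mul_assoc, mul_assoc]

lemma aeval_mul_mono (m : ℤ) (f g : ℂ[X]) :
    aeval (scaledEuler n) f * mono n m g = mono n m (f.comp (X + C ((m : ℂ) / n)) * g) := by
  have hn : (n : ℂ) ≠ 0 := NeZero.ne _
  have hT : ∀ g, scaledEuler n * mono n m g = mono n m ((X + C ((m : ℂ) / n)) * g) := by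
    intro g
    rw [scaledEuler, smul_mul_assoc, euler_mul_mono, ← map_smul, ← smul_mul_assoc]
    congr 2
    rw [smul_add, smul_eq_C_mul, smul_eq_C_mul, ← mul_assoc, ← C_mul, ← C_mul,
      inv_mul_cancel₀ hn, C_1, one_mul, inv_mul_eq_div]
  induction f using Polynomial.induction_on' generalizing g with
  | add p q hp hq => rw [map_add, add_mul, hp, hq, add_comp, add_mul, map_add]
  | monomial k a =>
    induction k generalizing g with
    | zero => simp [Algebra.algebraMap_eq_smul_one, ← smul_eq_C_mul]
    | succ k ih =>
      rw [← monomial_mul_X, map_mul, aeval_X, mul_assoc, hT, ih, mul_comp, X_comp, mul_assoc]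

/-- The inner e is absorbed because y^(na) has degree divisible by n, and moving f(y∂/n) past y^(na)
shifts its argument by the integer a. -/
lemma mono_mul_mono (m a : ℤ) (f g : ℂ[X]) :
    mono n m f * mono n (n * a) g = mono n (m + n * a) (f.comp (X + C (a : ℂ)) * g) := by
  have hn : (n : ℂ) ≠ 0 := NeZero.ne _
  rw [mono_apply n m f, mul_assoc, idem_zero_mul_mono, mul_assoc, aeval_mul_mono, yPow_mul_mono]
  congr 6
  push_cast
  field_simp

end Monomials

/-! ### Graded components of e H_k e_p y^p -/

section GradedSpans

open Polynomial

variable {n : ℕ}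

/-- The `n`-periodic extension of `k` to `ℤ` which vanishes at the multiples of `n`. -/
noncomputable def periodicExt (k : Fin (n - 1) → ℂ) (m : ℤ) : ℂ :=
  ∑ p : Fin (n - 1), if (n : ℤ) ∣ m - ((p : ℕ) + 1 : ℕ) then k p else 0

/-- The span of the elements `y ^ m f(y ∂ / n) e` for which `h m` divides `f`. -/
noncomputable def monoSpan (n : ℕ) (h : ℤ → ℂ[X]) : Submodule ℂ (CrossedProduct n) :=
  Submodule.span ℂ {x | ∃ m f, x = mono n m (h m * f)}

/-- The span of the elements `y ^ (-n a) f(y ∂ / n) e` for which `G a` divides `f`. -/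
noncomputable def gradedSpan (n : ℕ) (G : ℤ → ℂ[X]) : Submodule ℂ (CrossedProduct n) :=
  Submodule.span ℂ {x | ∃ a f, x = mono n (n * -a) (G a * f)}

lemma mono_mem_gradedSpan {G : ℤ → ℂ[X]} {a : ℤ} {f : ℂ[X]} (h : G a ∣ f) :
    mono n (n * -a) f ∈ gradedSpan n G := by
  obtain ⟨g, rfl⟩ := h
  exact Submodule.subset_span ⟨a, g, rfl⟩

lemma gradedSpan_le {G G' : ℤ → ℂ[X]} (h : ∀ a, G' a ∣ G a) :
    gradedSpan n G ≤ gradedSpan n G' := by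
  refine Submodule.span_le.mpr ?_
  rintro _ ⟨a, f, rfl⟩
  exact mono_mem_gradedSpan ((h a).mul_right f)

lemma gradedSpan_congr {G G' : ℤ → ℂ[X]} (h : ∀ a, Associated (G a) (G' a)) :
    gradedSpan n G = gradedSpan n G' :=
  le_antisymm (gradedSpan_le fun a => (h a).symm.dvd) (gradedSpan_le fun a => (h a).dvd)

variable [NeZero n]

/-- On degree m the sum ∑ k_i e_i acts by the scalar k_i with i ≡ m modulo n (zero if n divides m),
so d_k lowers the degree and multiplies by one linear factor. -/
lemma dunkl_mul_mono (k : Fin (n - 1) → ℂ) (m : ℤ) (f : ℂ[X]) :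
    dunkl k * mono n m f = mono n (m - 1) ((C (n : ℂ) * X + C (m - periodicExt k m)) * f) := by
  rw [dunkl, sub_mul, mul_assoc, Finset.sum_mul]
  simp only [smul_mul_assoc, idem_mul_mono]
  have : ∑ p : Fin (n - 1), k p • (if (n : ℤ) ∣ m - ((p : ℕ) + 1 : ℕ) then mono n m f else 0) =
      periodicExt k m • mono n m f := by
    rw [periodicExt, Finset.sum_smul]
    refine Finset.sum_congr rfl fun p _ => ?_
    split_ifs <;> simp
  rw [this, del_eq, mul_assoc, euler_mul_mono, mul_smul_comm, yPow_mul_mono, yPow_mul_mono,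
    ← map_smul, ← map_sub, smul_eq_C_mul, ← sub_mul, add_sub_assoc, ← C_sub, neg_add_eq_sub]

/-- A graded span is stable under H_k as soon as it is stable under the generators: `hup` is the
condition for y and `hdown` the one for d_k, while γ acts by scalars. -/
lemma algH_mul_mem_monoSpan (k : Fin (n - 1) → ℂ) {h : ℤ → ℂ[X]} (hup : ∀ m, h (m + 1) ∣ h m)
    (hdown : ∀ m, h (m - 1) ∣ (C (n : ℂ) * X + C (m - periodicExt k m)) * h m)
    {x : CrossedProduct n} (hx : x ∈ algH k) {s : CrossedProduct n} (hs : s ∈ monoSpan n h) :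
    x * s ∈ monoSpan n h := by
  have hmem : ∀ m f, h m ∣ f → mono n m f ∈ monoSpan n h := by
    rintro m _ ⟨g, rfl⟩
    exact Submodule.subset_span ⟨m, g, rfl⟩
  have hgen : ∀ x : CrossedProduct n, (∀ m f, x * mono n m (h m * f) ∈ monoSpan n h) →
      ∀ s ∈ monoSpan n h, x * s ∈ monoSpan n h := by
    intro x hx s hs
    induction hs using Submodule.span_induction with
    | mem s hs => obtain ⟨m, f, rfl⟩ := hs; exact hx m f
    | zero => rw [mul_zero]; exact zero_mem _
    | add s t _ _ hs ht => rw [mul_add]; exact add_mem hs ht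
    | smul c s _ hs => rw [mul_smul_comm]; exact Submodule.smul_mem _ c hs
  induction hx using Algebra.adjoin_induction generalizing s with
  | mem x hx =>
    refine hgen x ?_ s hs
    intro m f
    rcases hx with rfl | rfl | rfl
    · rw [dunkl_mul_mono, ← mul_assoc]
      exact hmem _ _ ((hdown m).mul_right f)
    · rw [yPow_mul_mono, add_comm]
      exact hmem _ _ ((hup m).mul_right f)
    · rw [gam_mul_mono]
      exact Submodule.smul_mem _ _ (hmem _ _ (dvd_mul_right _ _))
  | algebraMap c =>
    rw [Algebra.algebraMap_eq_smul_one, smul_mul_assoc, one_mul]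
    exact Submodule.smul_mem _ c hs
  | add x y _ _ hx hy => rw [add_mul]; exact add_mem (hx hs) (hy hs)
  | mul x y _ _ hx hy => rw [mul_assoc]; exact hx (hy hs)

/-- The polynomial by which `d_k ^ (p - m)` takes `y ^ p e` to a multiple of `y ^ m e`. -/
noncomputable def lowering (k : Fin (n - 1) → ℂ) (p m : ℤ) : ℂ[X] :=
  ∏ j ∈ Finset.Ioc m p, (C (n : ℂ) * X + C (j - periodicExt k j))

omit [NeZero n] in
lemma lowering_of_le (k : Fin (n - 1) → ℂ) {p m : ℤ} (h : p ≤ m) : lowering k p m = 1 := by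
  rw [lowering, Finset.Ioc_eq_empty (not_lt.mpr h), Finset.prod_empty]

omit [NeZero n] in
lemma lowering_sub_one (k : Fin (n - 1) → ℂ) {p m : ℤ} (h : m ≤ p) :
    lowering k p (m - 1) = (C (n : ℂ) * X + C (m - periodicExt k m)) * lowering k p m := by
  rw [lowering, lowering, ← Finset.prod_insert (f := fun j : ℤ =>
    C (n : ℂ) * X + C ((j : ℂ) - periodicExt k j)) Finset.left_notMem_Ioc]
  congr 1
  ext j
  simp only [Finset.mem_Ioc, Finset.mem_insert]
  omega

/-- The span with generators `lowering` is stable under H_k and contains y^p e, which bounds H_k y^p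
e from above. It is reached because y d_k produces all polynomials in degree p, from which y moves
up and d_k down. Multiplication by e keeps the degrees divisible by n. -/
lemma sandwich_algH (k : Fin (n - 1) → ℂ) (p : ℕ) :
    sandwich (idem n 0) (Subalgebra.toSubmodule (algH k)) (mono n p 1) =
      gradedSpan n fun a => lowering k p (n * -a) := by
  apply le_antisymm
  · rintro _ ⟨x, hx, rfl⟩
    change idem n 0 * x * mono n p 1 ∈ _
    have hx' : x * mono n p 1 ∈ monoSpan n (lowering k p) := by
      refine algH_mul_mem_monoSpan k ?_ ?_ hx
        (Submodule.subset_span ⟨p, 1, by rw [lowering_of_le k le_rfl, mul_one]⟩)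
      · intro m
        rcases lt_or_ge m p with h | h
        · have := lowering_sub_one k (p := p) (m := m + 1) h
          rw [add_sub_cancel_right] at this
          rw [this]
          exact dvd_mul_left _ _
        · rw [lowering_of_le k (by omega)]
          exact one_dvd _
      · intro m
        rcases le_or_gt m p with h | h
        · rw [lowering_sub_one k h]
        · rw [lowering_of_le k (by omega)]
          exact one_dvd _
    rw [mul_assoc]
    generalize x * mono n p 1 = s at hx'
    induction hx' using Submodule.span_induction with
    | mem s hs =>
      obtain ⟨m, f, rfl⟩ := hs
      rw [idem_mul_mono]
      split_ifs with h
      · obtain ⟨a, ha⟩ := h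
        rw [Nat.cast_zero, sub_zero] at ha
        obtain rfl : m = n * -(-a) := by rw [neg_neg, ha]
        exact mono_mem_gradedSpan (dvd_mul_right _ _)
      · exact zero_mem _
    | zero => rw [mul_zero]; exact zero_mem _
    | add s t _ _ hs ht => rw [mul_add]; exact add_mem hs ht
    | smul c s _ hs => rw [mul_smul_comm]; exact Submodule.smul_mem _ c hs
  · have hy : yPow n 1 ∈ algH k := Algebra.subset_adjoin (by simp)
    have hd : dunkl k ∈ algH k := Algebra.subset_adjoin (by simp)
    have hn : (n : ℂ) ≠ 0 := NeZero.ne _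
    let P : CrossedProduct n → Prop := fun s => ∃ x ∈ algH k, s = x * mono n p 1
    have hP : ∀ x ∈ algH k, ∀ s, P s → P (x * s) := by
      rintro x hx _ ⟨y, hy, rfl⟩
      exact ⟨x * y, mul_mem hx hy, (mul_assoc _ _ _).symm⟩
    have hPadd : ∀ s t, P s → P t → P (s + t) := by
      rintro _ _ ⟨y, hy, rfl⟩ ⟨z, hz, rfl⟩
      exact ⟨y + z, add_mem hy hz, (add_mul _ _ _).symm⟩
    have hPsmul : ∀ (c : ℂ) s, P s → P (c • s) := by
      rintro c _ ⟨y, hy, rfl⟩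
      exact ⟨c • y, Subalgebra.smul_mem _ hy c, (smul_mul_assoc _ _ _).symm⟩
    -- On degree p the element y d_k acts as nX plus a constant; subtracting the constant and
    -- dividing by n gives X.
    have hX : ∀ f, P (mono n p f) → P (mono n p (X * f)) := by
      intro f hf
      have h1 := hP _ hy _ (hP _ hd _ hf)
      rw [dunkl_mul_mono, yPow_mul_mono, add_sub_cancel] at h1
      have h2 := hPsmul (n : ℂ)⁻¹ _
        (hPadd _ _ h1 (hPsmul (-((p : ℤ) - periodicExt k p)) _ hf))
      rw [← map_smul, ← map_add, ← map_smul] at h2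
      convert h2 using 2
      rw [smul_eq_C_mul, smul_eq_C_mul, C_neg, add_mul, neg_mul, add_neg_cancel_right, mul_assoc,
        ← mul_assoc, ← C_mul, inv_mul_cancel₀ hn, C_1, one_mul]
    have hbase : ∀ f, P (mono n p f) := by
      intro f
      induction f using Polynomial.induction_on' with
      | add f g hf hg => rw [map_add]; exact hPadd _ _ hf hg
      | monomial i c =>
        rw [← C_mul_X_pow_eq_monomial, ← smul_eq_C_mul, map_smul]
        refine hPsmul _ _ ?_
        induction i with
        | zero => exact ⟨1, one_mem _, by simp⟩
        | succ i ih => rw [pow_succ']; exact hX _ ih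
    have hup : ∀ (i : ℕ) f, P (mono n (p + i) f) := by
      intro i f
      induction i with
      | zero => simpa using hbase f
      | succ i ih =>
        have := hP _ hy _ ih
        rw [yPow_mul_mono] at this
        convert this using 2
        push_cast; ring_nf
    have hlow : ∀ (i : ℕ) f, P (mono n (p - i) (lowering k p (p - i) * f)) := by
      intro i f
      induction i with
      | zero => simpa [lowering_of_le] using hbase f
      | succ i ih =>
        have := hP _ hd _ ih
        rw [dunkl_mul_mono, ← mul_assoc, ← lowering_sub_one k (by omega)] at this
        rw [show (p : ℤ) - (i + 1 : ℕ) = p - i - 1 by push_cast; ring]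
        exact this
    have hall : ∀ m f, P (mono n m (lowering k p m * f)) := by
      intro m f
      rcases le_total (p : ℤ) m with h | h
      · obtain ⟨i, rfl⟩ := Int.le.dest h
        exact hup i _
      · obtain ⟨i, hi⟩ := Int.le.dest h
        obtain rfl : m = p - i := by omega
        exact hlow i f
    refine Submodule.span_le.mpr ?_
    rintro _ ⟨a, f, rfl⟩
    obtain ⟨x, hx, h⟩ := hall (n * -a) f
    refine ⟨x, hx, ?_⟩
    change idem n 0 * x * mono n p 1 = _
    rw [mul_assoc, ← h, idem_zero_mul_mono]

lemma spherical_eq (k : Fin (n - 1) → ℂ) :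
    spherical k = gradedSpan n fun a => lowering k 0 (n * -a) := by
  have := sandwich_algH k 0
  rw [Nat.cast_zero, mono_zero_one] at this
  exact this

lemma basicBimodule_eq (k : Fin (n - 1) → ℂ) (p : Fin (n - 1)) :
    basicBimodule k p = gradedSpan n fun a => lowering (k + wVec p) ((p : ℤ) + 1) (n * -a) := by
  have := sandwich_algH (k + wVec p) (p + 1)
  rw [← idem_mul_yPow, Nat.cast_add, Nat.cast_one] at this
  exact this

end GradedSpans

/-! ### Products of graded spans and dominance -/

section Products

open Polynomial

/-- The polynomial with the simple roots `α + q`, `s ≤ q < t`. -/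
noncomputable def shiftProd (α : ℂ) (s t : ℤ) : ℂ[X] := ∏ q ∈ Finset.Ico s t, (X - C (α + q))

lemma shiftProd_of_le (α : ℂ) {s t : ℤ} (h : t ≤ s) : shiftProd α s t = 1 := by
  rw [shiftProd, Finset.Ico_eq_empty (not_lt.mpr h), Finset.prod_empty]

lemma shiftProd_mul (α : ℂ) {s t u : ℤ} (h : s ≤ t) (h' : t ≤ u) :
    shiftProd α s t * shiftProd α t u = shiftProd α s u := by
  rw [shiftProd, shiftProd, shiftProd, ← Finset.prod_union, Finset.Ico_union_Ico_eq_Ico h h']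
  exact Finset.Ico_disjoint_Ico_consecutive s t u

lemma shiftProd_add (α : ℂ) (s t b : ℤ) : shiftProd (α + b) s t = shiftProd α (s + b) (t + b) := by
  rw [shiftProd, shiftProd, ← Finset.image_add_right_Ico, Finset.prod_image (by simp)]
  refine Finset.prod_congr rfl fun q _ => ?_
  push_cast
  ring_nf

lemma shiftProd_comp (α : ℂ) (s t b : ℤ) :
    (shiftProd α s t).comp (X - C (b : ℂ)) = shiftProd α (s + b) (t + b) := by
  rw [← shiftProd_add, shiftProd, shiftProd, prod_comp]
  refine Finset.prod_congr rfl fun q _ => ?_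
  rw [sub_comp, X_comp, C_comp, sub_sub, ← C_add]
  congr 2
  ring

lemma eval_shiftProd_ne_zero {α c : ℂ} {s t : ℤ} (h : ∀ q : ℤ, c = α + q → s ≤ q → t ≤ q) :
    (shiftProd α s t).eval c ≠ 0 := by
  rw [shiftProd, eval_prod, Finset.prod_ne_zero_iff]
  intro q hq
  rw [eval_sub, eval_X, eval_C, sub_ne_zero]
  intro hc
  rw [Finset.mem_Ico] at hq
  have := h q hc hq.1
  omega

/-- Cutting [0, L) at x gives nothing extra if x lies between 0 and L. Otherwise the excess is the
interval by which x overshoots to the right or to the left; at most one of the last two factors is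
not 1. -/
lemma shiftProd_mul_shiftProd_zero (α : ℂ) (x L : ℤ) :
    shiftProd α x L * shiftProd α 0 x =
      shiftProd α 0 L * (shiftProd α (max 0 L) x * shiftProd α x (min 0 L)) := by
  rcases le_total L 0 with hL | hL
  · rw [max_eq_left hL, min_eq_right hL, shiftProd_of_le α hL, one_mul, mul_comm]
  · rw [max_eq_right hL, min_eq_left hL]
    rcases le_total x 0 with h0 | h0
    · rw [shiftProd_of_le α h0, shiftProd_of_le α (h0.trans hL), ← shiftProd_mul α h0 hL]
      ring
    · rw [shiftProd_of_le α h0]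
      rcases le_total x L with h | h
      · rw [shiftProd_of_le α h, ← shiftProd_mul α h0 h]
        ring
      · rw [shiftProd_of_le α h, ← shiftProd_mul α hL h]
        ring

variable {n : ℕ}

/-- The polynomial `G` such that `y ^ (-n a) G(y ∂ / n) e` generates the component of degree
`-n a` of a bimodule with parameters `α` and multiplicities `m`. -/
noncomputable def rootProd (α : Fin n → ℂ) (m : Fin n → ℕ) (a : ℤ) : ℂ[X] :=
  ∏ i, shiftProd (α i) 0 (a + m i)

/-- The dominance condition for the vector of parameters. -/
def DominantParam (α : Fin n → ℂ) : Prop :=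
  ∀ i j : Fin n, i < j → ∀ z : ℤ, α i - α j = z → 0 < z

/-- A decreasing vector can only increase the differences α_i - α_j for i < j, so dominance persists
along a chain. -/
lemma DominantParam.add {α : Fin n → ℂ} (h : DominantParam α) {m : Fin n → ℕ} (hm : Antitone m) :
    DominantParam fun i => α i + m i := by
  intro i j hij z hz
  have h1 := h i j hij (z - m i + m j) (by push_cast; rw [← hz]; ring)
  have h2 : m j ≤ m i := hm hij.le
  omega

/-- A shift for which the generators of a product of two components do not have the root `c` in
excess of the generator of the component of the product. -/
lemma exists_shift {α : Fin n → ℂ} (h : DominantParam α) {m : Fin n → ℕ} (hm : Antitone m)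
    (L : Fin n → ℤ) (c : ℂ) : ∃ b : ℤ, ∀ i, ∀ q : ℤ, c = α i + q →
      (max 0 (L i) ≤ q → b + m i ≤ q) ∧ (b + m i ≤ q → min 0 (L i) ≤ q) := by
  classical
  -- u i is the only possible position of c in the progression α i + ℤ, with 0 as a dummy if c is
  -- not in it.
  obtain ⟨u, hu⟩ : ∃ u : Fin n → ℤ, ∀ i, ∀ q : ℤ, c = α i + q → q = u i := by
    refine ⟨fun i => if h : ∃ q : ℤ, c = α i + q then h.choose else 0, fun i q hq => ?_⟩
    have hex : ∃ q : ℤ, c = α i + q := ⟨q, hq⟩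
    simp only [dif_pos hex]
    have := hex.choose_spec
    have h2 : ((q : ℤ) : ℂ) = hex.choose := add_left_cancel (hq.symm.trans this)
    exact_mod_cast h2
  -- These indices force b to be large: b + m i must pass u i, or c is an excess root on the left.
  let low := Finset.univ.filter fun i => c = α i + u i ∧ u i < min 0 (L i)
  by_cases hlow : low.Nonempty
  · obtain ⟨i₀, hi₀, hmax⟩ := low.exists_max_image (fun i => u i - m i) hlow
    have hi₀' := (Finset.mem_filter.mp hi₀).2
    -- The smallest b that passes u i for every low index.
    refine ⟨u i₀ - m i₀ + 1, fun i q hq => ?_⟩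
    obtain rfl := hu i q hq
    constructor
    · intro hi
      have hlt : u i₀ < u i := by omega
      have hd : ∀ z w : ℤ, z = w → (z : ℂ) = (w : ℂ) := fun z w h => by rw [h]
      -- Here u i₀ < 0 ≤ u i, so α i₀ - α i = u i - u i₀ is a positive integer. Dominance then
      -- excludes i < i₀, and m i ≤ m i₀ shows that b + m i does not overshoot u i.
      have hi0i : i₀ < i := by
        rcases lt_trichotomy i₀ i with h1 | h1 | h1
        · exact h1
        · subst h1; omega
        · have := h i i₀ h1 (u i₀ - u i) (by
            push_cast
            linear_combination -hq + hi₀'.1)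
          omega
      have := hm hi0i.le
      omega
    · intro hi
      by_contra hc
      have := hmax i (Finset.mem_filter.mpr ⟨Finset.mem_univ _, hq, not_le.mp hc⟩)
      omega
  · have hno : ∀ i, c = α i + u i → min 0 (L i) ≤ u i := by
      intro i hi
      by_contra hc
      exact hlow ⟨i, Finset.mem_filter.mpr ⟨Finset.mem_univ _, hi, not_le.mp hc⟩⟩
    -- Without low indices there is no lower constraint, and b is taken so negative that b + m i ≤ u
    -- i for all i.
    refine ⟨-∑ i, (|u i| + m i), fun i q hq => ?_⟩
    obtain rfl := hu i q hq
    refine ⟨fun _ => ?_, fun _ => hno i hq⟩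
    have := Finset.single_le_sum (f := fun i => |u i| + (m i : ℤ))
      (fun i _ => by positivity) (Finset.mem_univ i)
    have h2 := neg_abs_le (u i)
    omega

/-- In the progression of α i, the substitution moves the roots of the left factor to [b + m₁, a + b
+ m₁ + m₂), next to the interval [0, b + m₁) of the right factor. The last product collects the
excess from cutting at b + m₁. -/
lemma rootProd_comp_mul (α : Fin n → ℂ) (m₁ m₂ : Fin n → ℕ) (a b : ℤ) :
    (rootProd (fun i => α i + m₁ i) m₂ a).comp (X - C (b : ℂ)) * rootProd α m₁ b =
      rootProd α (m₁ + m₂) (a + b) *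
        ∏ i, (shiftProd (α i) (max 0 (a + b + (m₁ i + m₂ i))) (b + m₁ i) *
          shiftProd (α i) (b + m₁ i) (min 0 (a + b + (m₁ i + m₂ i)))) := by
  rw [rootProd, rootProd, rootProd, prod_comp, ← Finset.prod_mul_distrib,
    ← Finset.prod_mul_distrib]
  refine Finset.prod_congr rfl fun i _ => ?_
  rw [shiftProd_comp]
  have := shiftProd_add (α i) (0 + b) (a + m₂ i + b) (m₁ i)
  rw [Int.cast_natCast] at this
  rw [this, zero_add]
  have h := shiftProd_mul_shiftProd_zero (α i) (b + m₁ i) (a + b + (m₁ i + m₂ i))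
  simp only [Pi.add_apply, Nat.cast_add]
  rw [← h]
  congr 2
  ring

variable [NeZero n]

/-- Splitting the degree as (a - b) + b yields the multiples of G a by an excess factor Q. By `hcop`
these factors have no common complex root, so they generate the unit ideal and all multiples of G a
are obtained. -/
lemma gradedSpan_mul {G₁ G₂ G : ℤ → ℂ[X]}
    (hdvd : ∀ a b, G (a + b) ∣ (G₂ a).comp (X - C (b : ℂ)) * G₁ b)
    (hcop : ∀ a (c : ℂ), ∃ b Q, (G₂ (a - b)).comp (X - C (b : ℂ)) * G₁ b = G a * Q ∧
      Q.eval c ≠ 0) :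
    gradedSpan n G₂ * gradedSpan n G₁ = gradedSpan n G := by
  have hmul : ∀ (a b : ℤ) (f g : ℂ[X]), mono n (n * -a) f * mono n (n * -b) g =
      mono n (n * -(a + b)) (f.comp (X - C (b : ℂ)) * g) := by
    intro a b f g
    rw [mono_mul_mono]
    congr 2
    · ring_nf
    · congr 2; push_cast; rw [C_neg]
  apply le_antisymm
  · rw [gradedSpan, gradedSpan, Submodule.span_mul_span, Submodule.span_le]
    rintro _ ⟨_, ⟨a, f, rfl⟩, _, ⟨b, g, rfl⟩, rfl⟩
    simp only [hmul]
    refine mono_mem_gradedSpan ((hdvd a b).trans ?_)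
    rw [mul_comp]
    exact mul_dvd_mul (dvd_mul_right _ _) (dvd_mul_right _ _)
  · refine Submodule.span_le.mpr ?_
    rintro _ ⟨a, f, rfl⟩
    let S : Set ℂ[X] := {Q | ∃ b, (G₂ (a - b)).comp (X - C (b : ℂ)) * G₁ b = G a * Q}
    have hS : Ideal.span S = ⊤ := by
      by_contra hne
      have hpr : (Ideal.span S).IsPrincipal := IsPrincipalIdealRing.principal _
      obtain ⟨g, hg⟩ := hpr.principal
      rw [← Ideal.span] at hg
      have hgu : ¬ IsUnit g := by
        rw [hg, Ideal.span_singleton_eq_top] at hne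
        exact hne
      -- A generator of a proper ideal of ℂ[X] has a root, the zero polynomial included.
      have hroot : ∃ c, g.IsRoot c := by
        by_cases h0 : g = 0
        · exact ⟨0, by simp [h0]⟩
        · exact IsAlgClosed.exists_root g fun hd => hgu (isUnit_iff_degree_eq_zero.mpr hd)
      obtain ⟨c, hc⟩ := hroot
      obtain ⟨b, Q, hQ, hQc⟩ := hcop a c
      have hQS : Q ∈ Ideal.span S := Ideal.subset_span ⟨b, hQ⟩
      rw [hg, Ideal.mem_span_singleton] at hQS
      exact hQc (eval_eq_zero_of_dvd_of_eval_eq_zero hQS hc)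
    have hall : ∀ Q ∈ Ideal.span S, ∀ g,
        mono n (n * -a) (G a * (Q * g)) ∈ gradedSpan n G₂ * gradedSpan n G₁ := by
      intro Q hQ
      induction hQ using Submodule.span_induction with
      | mem Q hQ =>
        intro g
        obtain ⟨b, hb⟩ := hQ
        rw [← mul_assoc, ← hb, mul_assoc, show a = a - b + b by ring, ← hmul,
          sub_add_cancel]
        exact Submodule.mul_mem_mul (mono_mem_gradedSpan dvd_rfl)
          (mono_mem_gradedSpan (dvd_mul_right _ _))
      | zero => intro g; simp
      | add Q R _ _ hQ hR => intro g; rw [add_mul, mul_add, map_add]; exact add_mem (hQ g) (hR g)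
      | smul c Q _ hQ =>
        intro g
        rw [smul_eq_mul, mul_comm c, mul_assoc]
        exact hQ _
    have := hall 1 (by rw [hS]; trivial) f
    rwa [one_mul] at this

lemma gradedSpan_rootProd_mul {α : Fin n → ℂ} (h : DominantParam α) {m₁ : Fin n → ℕ}
    (hm : Antitone m₁) (m₂ : Fin n → ℕ) :
    gradedSpan n (rootProd (fun i => α i + m₁ i) m₂) * gradedSpan n (rootProd α m₁) =
      gradedSpan n (rootProd α (m₁ + m₂)) := by
  refine gradedSpan_mul (fun a b => ⟨_, rootProd_comp_mul α m₁ m₂ a b⟩) fun a c => ?_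
  obtain ⟨b, hb⟩ := exists_shift h hm (fun i => a + (m₁ i + m₂ i)) c
  refine ⟨b, _, by rw [rootProd_comp_mul, sub_add_cancel], ?_⟩
  rw [eval_prod, Finset.prod_ne_zero_iff]
  intro i _
  rw [eval_mul]
  exact mul_ne_zero (eval_shiftProd_ne_zero fun q hq => (hb i q hq).1)
    (eval_shiftProd_ne_zero fun q hq => (hb i q hq).2)

end Products

/-! ### The generators G_a for spherical algebras, basic bimodules and chains -/

section Bimodules

open Polynomial

variable {n : ℕ}

lemma prod_Ioc_eq_prod_fin (f : ℤ → ℂ[X]) (c : ℤ) {p : ℕ} (hp : p ≤ n) :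
    ∏ j ∈ Finset.Ioc c (c + p), f j = ∏ i : Fin n, if (i : ℕ) < p then f (i + 1 + c) else 1 := by
  rw [Fin.prod_univ_eq_prod_range (fun i : ℕ => if i < p then f (i + 1 + c) else 1) n,
    ← Finset.prod_filter]
  symm
  refine Finset.prod_bij (fun i _ => (i : ℤ) + 1 + c) ?_ ?_ ?_ ?_
  · intro i hi
    simp only [Finset.mem_filter, Finset.mem_range, Finset.mem_Ioc] at hi ⊢
    omega
  · intro i _ j _ h
    omega
  · intro j hj
    rw [Finset.mem_Ioc] at hj
    refine ⟨(j - c - 1).toNat, ?_, ?_⟩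
    · simp only [Finset.mem_filter, Finset.mem_range]
      omega
    · omega
  · intro i _
    rfl

/-- The parameters `a_1, …, a_n`. -/
noncomputable def rootParam (k : Fin (n - 1) → ℂ) (i : Fin n) : ℂ := aVec k (i + 1)

lemma dominantParam_rootParam {k : Fin (n - 1) → ℂ} (hk : IsDominant k) :
    DominantParam (rootParam k) := by
  intro i j hij z hz
  have h1 : (i : ℕ) < j := hij
  exact hk (i + 1) (j + 1) (by omega) (by omega) j.2 z hz

/-- The value a_n = 0 obeys the same formula as the others if k_n is read as 0. -/
lemma mul_rootParam [NeZero n] (k : Fin (n - 1) → ℂ) (i : Fin n) :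
    (n : ℂ) * rootParam k i = n - (i + 1) + if h : (i : ℕ) < n - 1 then k ⟨i, h⟩ else 0 := by
  have hn : (n : ℂ) ≠ 0 := NeZero.ne _
  have hi := i.2
  rw [rootParam, aVec]
  by_cases h : (i : ℕ) < n - 1
  · rw [dif_pos ⟨by omega, by omega⟩, dif_pos h, mul_div_cancel₀ _ hn]
    simp
  · rw [dif_neg (by omega), dif_neg h]
    have : n = (i : ℕ) + 1 := by omega
    have h2 : (n : ℂ) = i + 1 := by exact_mod_cast this
    rw [h2]
    ring

lemma periodicExt_eq (k : Fin (n - 1) → ℂ) (i : Fin n) (s : ℤ) :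
    periodicExt k (i + 1 + n * s) = if h : (i : ℕ) < n - 1 then k ⟨i, h⟩ else 0 := by
  have hi := i.2
  have key : ∀ p : Fin (n - 1), (n : ℤ) ∣ i + 1 + n * s - ((p : ℕ) + 1 : ℕ) ↔ (p : ℕ) = i := by
    intro p
    have hp := p.2
    rw [show (i : ℤ) + 1 + n * s - ((p : ℕ) + 1 : ℕ) = (i - p : ℤ) + n * s by push_cast; ring,
      (Int.dvd_add_left (dvd_mul_right _ _))]
    constructor
    · intro h
      by_contra hne
      have := Int.le_of_dvd (abs_pos.mpr (by omega)) ((dvd_abs _ _).mpr h)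
      have := abs_lt.mpr (⟨by omega, by omega⟩ : -(n : ℤ) < i - p ∧ (i : ℤ) - p < n)
      omega
    · intro h
      rw [h, sub_self]
      exact dvd_zero _
  simp only [periodicExt, key]
  split_ifs with h
  · rw [Finset.sum_eq_single ⟨i, h⟩]
    · simp
    · intro p _ hp
      rw [if_neg fun he => hp (Fin.ext he)]
    · simp
  · refine Finset.sum_eq_zero fun p _ => if_neg fun he => ?_
    omega

variable [NeZero n]

/-- Degrees in one residue class modulo n contribute roots in one progression, which moves up by one
whenever the degree drops by n. -/
lemma lowering_factor (k : Fin (n - 1) → ℂ) (i : Fin n) (s : ℤ) :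
    C (n : ℂ) * X + C (((i + 1 + n * s : ℤ) : ℂ) - periodicExt k (i + 1 + n * s)) =
      C (n : ℂ) * (X - C (rootParam k i - 1 - s)) := by
  have h : ((i + 1 + n * s : ℤ) : ℂ) - periodicExt k (i + 1 + n * s) =
      -(n * (rootParam k i - 1 - s)) := by
    rw [mul_sub, mul_sub, mul_rootParam, periodicExt_eq]
    push_cast
    ring
  rw [h, C_neg, C_mul, ← sub_eq_add_neg, ← mul_sub]

lemma associated_lowering_factor (k : Fin (n - 1) → ℂ) (i : Fin n) (s : ℤ) :
    Associated
      (C (n : ℂ) * X + C (((i + 1 + n * s : ℤ) : ℂ) - periodicExt k (i + 1 + n * s)))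
      (X - C (rootParam k i - 1 - s)) := by
  have hn : (n : ℂ) ≠ 0 := NeZero.ne _
  rw [lowering_factor]
  exact associated_unit_mul_left _ _ (isUnit_C.mpr hn.isUnit)

lemma shiftProd_succ (α : ℂ) {L : ℤ} (h : 0 ≤ L) :
    shiftProd α 0 (L + 1) = shiftProd α 0 L * (X - C (α + L)) := by
  rw [← shiftProd_mul α h (by omega : L ≤ L + 1)]
  congr 1
  rw [shiftProd, show Finset.Ico L (L + 1) = {L} by ext; simp; omega, Finset.prod_singleton]

/-- The window of degrees (0, p] contributes the first root α i for i < p, and each further block of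
n degrees contributes one new root to each of the n progressions. For a basic bimodule k is the
upper vector, and α consists of the parameters of the lower one. -/
lemma associated_lowering (k : Fin (n - 1) → ℂ) {p : ℕ} (hp : p < n) (α : Fin n → ℂ)
    (hα : ∀ i : Fin n, rootParam k i = α i + if (i : ℕ) < p then 1 else 0) (a : ℤ) :
    Associated (lowering k p (n * -a))
      (rootProd α (fun i : Fin n => if (i : ℕ) < p then 1 else 0) a) := by
  have hnat : ∀ a : ℕ, Associated (lowering k p (n * -(a : ℤ)))
      (rootProd α (fun i : Fin n => if (i : ℕ) < p then 1 else 0) a) := by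
    intro a
    induction a with
    | zero =>
      rw [lowering, rootProd]
      have := prod_Ioc_eq_prod_fin (n := n)
        (fun j => C (n : ℂ) * X + C ((j : ℂ) - periodicExt k j)) 0 hp.le
      rw [zero_add] at this
      simp only [Nat.cast_zero, neg_zero, mul_zero]
      rw [this]
      refine Associated.prod _ _ _ fun i _ => ?_
      split_ifs with h
      · have h1 := associated_lowering_factor k i 0
        rw [mul_zero] at h1
        have h2 := shiftProd_succ (α i) (le_refl 0)
        rw [Nat.cast_one, h2, shiftProd_of_le _ le_rfl, one_mul]
        have h3 : α i + ((0 : ℤ) : ℂ) = rootParam k i - 1 - ((0 : ℤ) : ℂ) := by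
          rw [hα i, if_pos h]
          push_cast
          ring
        rw [h3]
        exact h1
      · rw [shiftProd_of_le _ (by simp)]
        exact Associated.refl 1
    | succ a ih =>
      have hsplit : lowering k p (n * -((a + 1 : ℕ) : ℤ)) =
          (∏ j ∈ Finset.Ioc (n * -((a + 1 : ℕ) : ℤ)) (n * -((a + 1 : ℕ) : ℤ) + (n : ℕ)),
            (C (n : ℂ) * X + C ((j : ℂ) - periodicExt k j))) * lowering k p (n * -(a : ℤ)) := by
        have hle : (n : ℤ) * -(a : ℤ) ≤ p := by
          have : (0 : ℤ) ≤ n * a := by positivity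
          rw [mul_neg]; omega
        have he : (n : ℤ) * -((a + 1 : ℕ) : ℤ) + (n : ℕ) = n * -(a : ℤ) := by push_cast; ring
        rw [he, lowering, lowering, ← Finset.prod_union (Finset.Ioc_disjoint_Ioc_of_le le_rfl),
          Finset.Ioc_union_Ioc_eq_Ioc _ hle]
        omega
      rw [hsplit, prod_Ioc_eq_prod_fin _ _ le_rfl]
      have hprod : rootProd α (fun i : Fin n => if (i : ℕ) < p then 1 else 0) ((a + 1 : ℕ) : ℤ) =
          (∏ i : Fin n, (X - C (rootParam k i - 1 - ((-((a + 1 : ℕ) : ℤ) : ℤ) : ℂ)))) *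
            rootProd α (fun i : Fin n => if (i : ℕ) < p then 1 else 0) a := by
        rw [rootProd, rootProd, ← Finset.prod_mul_distrib]
        refine Finset.prod_congr rfl fun i _ => ?_
        rw [mul_comm, hα i]
        split_ifs with h
        · have := shiftProd_succ (α i) (L := a + 1) (by omega)
          push_cast at this ⊢
          rw [this]
          congr 3
          ring
        · have := shiftProd_succ (α i) (L := a) (by omega)
          push_cast at this ⊢
          rw [add_zero, add_zero, this]
          congr 3
          ring
      rw [hprod]
      refine Associated.mul_mul (Associated.prod _ _ _ fun i _ => ?_) ih
      rw [if_pos i.2]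
      exact associated_lowering_factor k i _
  -- For a < 0 the degree -na is at least n > p, and both polynomials are 1.
  rcases le_or_gt 0 a with h | h
  · obtain ⟨a, rfl⟩ := Int.eq_ofNat_of_zero_le h
    exact hnat a
  · rw [lowering_of_le, rootProd, Finset.prod_eq_one]
    · intro i _
      refine shiftProd_of_le _ ?_
      split_ifs <;> push_cast <;> omega
    · have : (n : ℤ) * 1 ≤ n * -a := by gcongr; omega
      omega

/-- The number of the vectors `w_p` in the list whose entry at `i` does not vanish. -/
def listMult (l : List (Fin (n - 1))) (i : Fin n) : ℕ := l.countP fun p : Fin (n - 1) => (i : ℕ) ≤ p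

omit [NeZero n] in
lemma listMult_antitone (l : List (Fin (n - 1))) : Antitone (listMult l) := by
  intro i j hij
  refine List.countP_mono_left fun p _ h => ?_
  have h1 : (i : ℕ) ≤ j := hij
  simp only [decide_eq_true_eq] at h ⊢
  omega

lemma rootParam_add_wVec (k : Fin (n - 1) → ℂ) (p : Fin (n - 1)) (i : Fin n) :
    rootParam (k + wVec p) i = rootParam k i + if (i : ℕ) < (p : ℕ) + 1 then 1 else 0 := by
  have hn : (n : ℂ) ≠ 0 := NeZero.ne _
  apply mul_left_cancel₀ hn
  rw [mul_add, mul_rootParam, mul_rootParam]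
  have hp := p.2
  by_cases h : (i : ℕ) < n - 1
  · simp only [dif_pos h, Pi.add_apply, wVec, Fin.le_def, Nat.lt_succ_iff]
    split_ifs <;> ring
  · rw [dif_neg h, dif_neg h, if_neg (by omega)]
    ring

lemma spherical_eq_gradedSpan (k : Fin (n - 1) → ℂ) :
    spherical k = gradedSpan n (rootProd (rootParam k) 0) := by
  rw [spherical_eq]
  refine gradedSpan_congr fun a => ?_
  have := associated_lowering k (p := 0) (NeZero.pos n) (rootParam k) (by simp) a
  simp only [not_lt_zero, if_false, Nat.cast_zero] at this
  exact this

lemma basicBimodule_eq_gradedSpan (k : Fin (n - 1) → ℂ) (p : Fin (n - 1)) :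
    basicBimodule k p = gradedSpan n (rootProd (rootParam k) (listMult [p])) := by
  rw [basicBimodule_eq]
  refine gradedSpan_congr fun a => ?_
  have hp := p.2
  have := associated_lowering (k + wVec p) (p := p + 1) (by omega) (rootParam k)
    (rootParam_add_wVec k p) a
  have h : listMult [p] = fun i : Fin n => if (i : ℕ) < (p : ℕ) + 1 then 1 else 0 := by
    ext i
    simp [listMult, List.countP_cons]
  rw [h]
  exact this

/-- The description of the bimodules in terms of generators of the graded components. -/
theorem bimodule_eq_gradedSpan (l : List (Fin (n - 1))) (k : Fin (n - 1) → ℂ)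
    (hk : DominantParam (rootParam k)) :
    bimodule k l = gradedSpan n (rootProd (rootParam k) (listMult l)) := by
  induction l generalizing k with
  | nil => exact spherical_eq_gradedSpan k
  | cons p l ih =>
    have hα : rootParam (k + wVec p) = fun i => rootParam k i + listMult [p] i := by
      ext i
      rw [rootParam_add_wVec]
      simp [listMult, List.countP_cons]
    have hdom := hk.add (listMult_antitone [p])
    rw [← hα] at hdom
    rw [bimodule, ih _ hdom, basicBimodule_eq_gradedSpan, hα,
      gradedSpan_rootProd_mul hk (listMult_antitone [p])]
    congr 2
    ext i
    simp [listMult, List.countP_cons, add_comm]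

end Bimodules

/-! ### Representation of the crossed product on formal series in y -/

section Representation

open Polynomial

variable (n : ℕ)

/-- The action of the generators on formal series `∑ φ(m) y ^ m`. -/
noncomputable def repGen : Gen → Module.End ℂ (ℤ → ℂ)
  | Gen.y => LinearMap.funLeft ℂ ℂ fun m => m - 1
  | Gen.yinv => LinearMap.funLeft ℂ ℂ fun m => m + 1
  | Gen.del =>
    { toFun := fun φ m => ((m : ℂ) + 1) * φ (m + 1)
      map_add' := fun φ ψ => by ext m; simp [mul_add]
      map_smul' := fun c φ => by ext m; simp [mul_left_comm] }
  | Gen.gam =>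
    { toFun := fun φ m => rootOfUnity n ^ (-m) * φ m
      map_add' := fun φ ψ => by ext m; simp [mul_add]
      map_smul' := fun c φ => by ext m; simp [mul_left_comm] }

lemma repGen_gam_pow (j : ℕ) (φ : ℤ → ℂ) (m : ℤ) :
    (repGen n Gen.gam ^ j) φ m = (rootOfUnity n ^ (-m)) ^ j * φ m := by
  induction j with
  | zero => simp
  | succ j ih =>
    rw [pow_succ', pow_succ', mul_assoc, ← ih]
    rfl

variable [NeZero n]

lemma rootOfUnity_zpow_neg_mul (t : ℤ) : rootOfUnity n ^ (-(n * t)) = 1 :=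
  ((isPrimitiveRoot_rootOfUnity n).zpow_eq_one_iff_dvd _).mpr ((dvd_neg).mpr (dvd_mul_right _ _))

/-- The representation of the crossed product on formal series in `y`. -/
noncomputable def rep : CrossedProduct n →ₐ[ℂ] Module.End ℂ (ℤ → ℂ) :=
  RingQuot.liftAlgHom ℂ ⟨FreeAlgebra.lift ℂ (repGen n), by
    have hω := rootOfUnity_ne_zero n
    intro x y h
    cases h with
    | y_yinv =>
      simp only [map_mul, FreeAlgebra.lift_ι_apply, map_one]
      ext φ m
      simp [repGen, LinearMap.funLeft_apply]
    | yinv_y =>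
      simp only [map_mul, FreeAlgebra.lift_ι_apply, map_one]
      ext φ m
      simp [repGen, LinearMap.funLeft_apply]
    | weyl =>
      simp only [map_mul, map_add, FreeAlgebra.lift_ι_apply, map_one]
      ext φ m
      simp [repGen, LinearMap.funLeft_apply]
      ring
    | gam_pow =>
      simp only [map_pow, FreeAlgebra.lift_ι_apply, map_one]
      refine LinearMap.ext fun φ => funext fun m => ?_
      have h := rootOfUnity_zpow_neg_mul n m
      rw [mul_comm, neg_mul_eq_neg_mul, zpow_mul, zpow_natCast] at h
      rw [repGen_gam_pow, h, one_mul]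
      rfl
    | y_gam =>
      simp only [map_mul, map_smul, FreeAlgebra.lift_ι_apply]
      refine LinearMap.ext fun φ => funext fun m => ?_
      change rootOfUnity n ^ (-(m - 1)) * φ (m - 1) =
        rootOfUnity n * (rootOfUnity n ^ (-m) * φ (m - 1))
      rw [← mul_assoc, ← zpow_one_add₀ hω]
      congr 2
      ring
    | gam_del =>
      simp only [map_mul, map_smul, FreeAlgebra.lift_ι_apply]
      refine LinearMap.ext fun φ => funext fun m => ?_
      change rootOfUnity n ^ (-m) * (((m : ℂ) + 1) * φ (m + 1)) =
        rootOfUnity n * (((m : ℂ) + 1) * (rootOfUnity n ^ (-(m + 1)) * φ (m + 1)))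
      rw [show -m = 1 + (-(m + 1)) by ring, zpow_one_add₀ hω]
      ring⟩

lemma rep_gen (g : Gen) : rep n (gen n g) = repGen n g := by
  rw [gen, toCrossedProduct, rep]
  erw [RingQuot.liftAlgHom_mkAlgHom_apply]
  exact FreeAlgebra.lift_ι_apply _ _

lemma rep_del (φ : ℤ → ℂ) (m : ℤ) : rep n (del n) φ m = ((m : ℂ) + 1) * φ (m + 1) := by
  rw [del, rep_gen]; rfl

lemma rep_gam_pow (j : ℕ) (φ : ℤ → ℂ) (m : ℤ) :
    rep n (gam n ^ j) φ m = (rootOfUnity n ^ (-m)) ^ j * φ m := by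
  rw [map_pow, gam, rep_gen, repGen_gam_pow]

lemma rep_yPow_one (φ : ℤ → ℂ) (m : ℤ) : rep n (yPow n 1) φ m = φ (m - 1) := by
  have : yPow n 1 = gen n Gen.y := by simp [yPow, yUnit]
  rw [this, rep_gen]; rfl

lemma rep_yPow_neg_one (φ : ℤ → ℂ) (m : ℤ) : rep n (yPow n (-1)) φ m = φ (m + 1) := by
  have : yPow n (-1) = gen n Gen.yinv := by simp [yPow, yUnit]
  rw [this, rep_gen]; rfl

lemma rep_yPow (a : ℤ) (φ : ℤ → ℂ) (m : ℤ) : rep n (yPow n a) φ m = φ (m - a) := by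
  induction a using Int.induction_on generalizing m with
  | zero => simp [yPow_zero]
  | succ i hi =>
    rw [add_comm, yPow_add, map_mul, Module.End.mul_apply, rep_yPow_one, hi]
    congr 1; ring
  | pred i hi =>
    rw [sub_eq_neg_add, yPow_add, map_mul, Module.End.mul_apply, rep_yPow_neg_one, hi]
    congr 1; ring

lemma rep_euler (φ : ℤ → ℂ) (m : ℤ) : rep n (euler n) φ m = m * φ m := by
  rw [euler, map_mul, Module.End.mul_apply, rep_yPow_one, rep_del]
  simp

lemma rep_aeval (f : ℂ[X]) (φ : ℤ → ℂ) (m : ℤ) :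
    rep n (aeval (scaledEuler n) f) φ m = f.eval ((m : ℂ) / n) * φ m := by
  induction f using Polynomial.induction_on' with
  | add p q hp hq => simp [hp, hq, add_mul]
  | monomial k c =>
    induction k with
    | zero => simp [Algebra.algebraMap_eq_smul_one]
    | succ k ih =>
      rw [← X_mul_monomial, map_mul, aeval_X, map_mul, Module.End.mul_apply, scaledEuler, map_smul,
        LinearMap.smul_apply, Pi.smul_apply, rep_euler, ← scaledEuler, ih, eval_mul, eval_X]
      rw [smul_eq_mul]
      ring

lemma rep_del_pow (i : ℕ) (φ : ℤ → ℂ) (m : ℤ) :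
    rep n (del n ^ i) φ m = (∏ s ∈ Finset.range i, ((m : ℂ) + 1 + s)) * φ (m + i) := by
  induction i generalizing m with
  | zero => simp
  | succ i ih =>
    rw [pow_succ', map_mul, Module.End.mul_apply, rep_del, ih, Finset.prod_range_succ']
    have : ∀ s : ℕ, ((m + 1 : ℤ) : ℂ) + 1 + s = m + 1 + (s + 1 : ℕ) := by
      intro s; push_cast; ring
    simp only [this]
    rw [show m + 1 + (i : ℤ) = m + ((i + 1 : ℕ) : ℤ) by push_cast; ring]
    push_cast
    ring

/-- The coefficient of `y ^ (n t - n a)` in the image of `y ^ (n t)`. -/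
noncomputable def coefAt (a t : ℤ) : CrossedProduct n →ₗ[ℂ] ℂ :=
  LinearMap.proj (n * t + n * -a) ∘ₗ LinearMap.applyₗ (Pi.single (n * t) 1 : ℤ → ℂ) ∘ₗ
    (rep n).toLinearMap

lemma coefAt_apply (a t : ℤ) (x : CrossedProduct n) :
    coefAt n a t x = rep n x (Pi.single (n * t) 1) (n * t + n * -a) := rfl

lemma rep_idem_zero_single (t : ℤ) :
    rep n (idem n 0) (Pi.single (n * t) 1) = Pi.single (n * t) 1 := by
  have hn : (n : ℂ) ≠ 0 := NeZero.ne _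
  have hg : ∀ j : ℕ, rep n (gam n ^ j) (Pi.single (n * t) 1) = Pi.single (n * t) 1 := by
    intro j
    ext m
    rw [rep_gam_pow]
    by_cases hm : m = n * t
    · subst hm
      rw [rootOfUnity_zpow_neg_mul, one_pow, one_mul]
    · simp [hm]
  rw [idem, map_smul, map_sum, LinearMap.smul_apply, LinearMap.sum_apply]
  simp only [pow_zero, one_smul, hg, Finset.sum_const, Finset.card_range]
  rw [← Nat.cast_smul_eq_nsmul ℂ, smul_smul, inv_mul_cancel₀ hn, one_smul]

/-- The matrix coefficients return the values of f at all integers, hence f itself: this separates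
the components in the abstractly presented algebra. -/
lemma coefAt_mono (a b t : ℤ) (f : ℂ[X]) :
    coefAt n a t (mono n (n * -b) f) = if a = b then f.eval (t : ℂ) else 0 := by
  have hn : (n : ℂ) ≠ 0 := NeZero.ne _
  have hn' : (n : ℤ) ≠ 0 := NeZero.ne _
  rw [coefAt_apply, mono_apply, map_mul, map_mul, Module.End.mul_apply, Module.End.mul_apply,
    rep_yPow, rep_aeval, rep_idem_zero_single]
  split_ifs with h
  · subst h
    simp [hn]
  · rw [Pi.single_apply, if_neg, mul_zero]
    intro hc
    apply h
    have : (n : ℤ) * a = n * b := by linarith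
    exact mul_left_cancel₀ hn' this

end Representation

/-! ### The order of an operator is the degree of its polynomials -/

section OrderFiltration

open Polynomial

variable (n : ℕ)

/-- The operator `∑ y ^ (-n a) φ_a(y ∂ / n) e`. -/
noncomputable def opSum : (ℤ →₀ ℂ[X]) →ₗ[ℂ] CrossedProduct n :=
  Finsupp.lsum ℂ fun a => mono n (n * -a)

lemma opSum_single (a : ℤ) (f : ℂ[X]) : opSum n (Finsupp.single a f) = mono n (n * -a) f := by
  rw [opSum, Finsupp.lsum_single]

lemma exists_opSum_eq {G : ℤ → ℂ[X]} {β : CrossedProduct n} (h : β ∈ gradedSpan n G) :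
    ∃ φ, (∀ a, G a ∣ φ a) ∧ opSum n φ = β := by
  induction h using Submodule.span_induction with
  | mem β h =>
    obtain ⟨a, f, rfl⟩ := h
    refine ⟨Finsupp.single a (G a * f), fun b => ?_, opSum_single n a _⟩
    by_cases hab : b = a
    · subst hab; simp
    · simp [hab]
  | zero => exact ⟨0, by simp, map_zero _⟩
  | add x y _ _ hx hy =>
    obtain ⟨φ, hφ, rfl⟩ := hx
    obtain ⟨ψ, hψ, rfl⟩ := hy
    exact ⟨φ + ψ, fun a => dvd_add (hφ a) (hψ a), map_add _ _ _⟩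
  | smul c x _ hx =>
    obtain ⟨φ, hφ, rfl⟩ := hx
    exact ⟨c • φ, fun a => by
      rw [Finsupp.smul_apply, smul_eq_C_mul]; exact (hφ a).mul_left _, map_smul _ _ _⟩

lemma mem_orderLT_of_lt {N i : ℕ} (h : i < N) (a : ℤ) (j : ℕ) :
    yPow n a * gam n ^ j * del n ^ i ∈ orderLT n N :=
  Submodule.subset_span ⟨a, j, i, h, rfl⟩

lemma orderLT_mono {N N' : ℕ} (h : N ≤ N') : orderLT n N ≤ orderLT n N' := by
  refine Submodule.span_mono ?_
  rintro _ ⟨a, j, i, hi, rfl⟩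
  exact ⟨a, j, i, hi.trans_le h, rfl⟩

lemma mul_mem_orderLT {x : CrossedProduct n} {N N' : ℕ}
    (h : ∀ a j i, i < N → x * (yPow n a * gam n ^ j * del n ^ i) ∈ orderLT n N')
    {s : CrossedProduct n} (hs : s ∈ orderLT n N) : x * s ∈ orderLT n N' := by
  induction hs using Submodule.span_induction with
  | mem s hs => obtain ⟨a, j, i, hi, rfl⟩ := hs; exact h a j i hi
  | zero => rw [mul_zero]; exact zero_mem _
  | add s t _ _ hs ht => rw [mul_add]; exact add_mem hs ht
  | smul c s _ hs => rw [mul_smul_comm]; exact Submodule.smul_mem _ c hs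

lemma yPow_mul_mem_orderLT (b : ℤ) {N : ℕ} {s : CrossedProduct n} (hs : s ∈ orderLT n N) :
    yPow n b * s ∈ orderLT n N := by
  refine mul_mem_orderLT n (fun a j i hi => ?_) hs
  rw [← mul_assoc, ← mul_assoc, ← yPow_add]
  exact mem_orderLT_of_lt n hi _ _

lemma gam_mul_mem_orderLT {N : ℕ} {s : CrossedProduct n} (hs : s ∈ orderLT n N) :
    gam n * s ∈ orderLT n N := by
  refine mul_mem_orderLT n (fun a j i hi => ?_) hs
  rw [← mul_assoc, ← mul_assoc, gam_mul_yPow, smul_mul_assoc, smul_mul_assoc, mul_assoc (yPow n a),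
    ← pow_succ']
  exact Submodule.smul_mem _ _ (mem_orderLT_of_lt n hi _ _)

lemma idem_mul_mem_orderLT (i : ℕ) {N : ℕ} {s : CrossedProduct n} (hs : s ∈ orderLT n N) :
    idem n i * s ∈ orderLT n N := by
  have h : ∀ j : ℕ, (rootOfUnity n ^ i • gam n) ^ j * s ∈ orderLT n N := by
    intro j
    induction j with
    | zero => simpa using hs
    | succ j ih =>
      rw [pow_succ', mul_assoc, smul_mul_assoc]
      exact Submodule.smul_mem _ _ (gam_mul_mem_orderLT n ih)
  rw [idem, smul_mul_assoc, Finset.sum_mul]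
  exact Submodule.smul_mem _ _ (sum_mem fun j _ => h j)

lemma del_mul_gam : del n * gam n = (rootOfUnity n)⁻¹ • (gam n * del n) := by
  rw [gam_mul_del, smul_smul, inv_mul_cancel₀ (rootOfUnity_ne_zero n), one_smul]

lemma del_mul_gam_pow (j : ℕ) :
    del n * gam n ^ j = (rootOfUnity n)⁻¹ ^ j • (gam n ^ j * del n) := by
  induction j with
  | zero => simp
  | succ j ih =>
    rw [pow_succ, ← mul_assoc, ih, smul_mul_assoc, mul_assoc, del_mul_gam, mul_smul_comm, smul_smul,
      ← pow_succ, mul_assoc]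

lemma euler_mul_mem_orderLT {N : ℕ} {s : CrossedProduct n} (hs : s ∈ orderLT n N) :
    euler n * s ∈ orderLT n (N + 1) := by
  refine mul_mem_orderLT n (fun a j i hi => ?_) hs
  have h : euler n * (yPow n a * gam n ^ j * del n ^ i) =
      (rootOfUnity n)⁻¹ ^ j • (yPow n (a + 1) * gam n ^ j * del n ^ (i + 1)) +
        (a : ℂ) • (yPow n a * gam n ^ j * del n ^ i) := by
    rw [← mul_assoc, ← mul_assoc, euler_mul_yPow, mul_add, add_mul, add_mul, mul_smul_comm, mul_one,
      smul_mul_assoc, smul_mul_assoc]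
    congr 1
    rw [euler, ← mul_assoc, ← yPow_add, mul_assoc (yPow n (a + 1)), del_mul_gam_pow, mul_smul_comm,
      smul_mul_assoc, ← mul_assoc, mul_assoc _ (del n), ← pow_succ']
  rw [h]
  exact add_mem (Submodule.smul_mem _ _ (mem_orderLT_of_lt n (by omega) _ _))
    (Submodule.smul_mem _ _ (mem_orderLT_of_lt n (by omega) _ _))

/-- Induction from y∂ · y^N ∂^N = y^(N+1) ∂^(N+1) + N y^N ∂^N. -/
lemma euler_pow_sub_mem_orderLT (N : ℕ) :
    euler n ^ N - yPow n N * del n ^ N ∈ orderLT n N := by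
  induction N with
  | zero => simp [yPow_zero]
  | succ N ih =>
    have h1 := euler_mul_mem_orderLT n ih
    have h2 := mem_orderLT_of_lt n (Nat.lt_succ_self N) N 0
    rw [pow_zero, mul_one] at h2
    have h : euler n ^ (N + 1) - yPow n (N + 1 : ℕ) * del n ^ (N + 1) =
        euler n * (euler n ^ N - yPow n N * del n ^ N) +
          (N : ℂ) • (yPow n N * del n ^ N) := by
      have he : euler n * (yPow n N * del n ^ N) =
          yPow n (N + 1 : ℕ) * del n ^ (N + 1) + (N : ℂ) • (yPow n N * del n ^ N) := by
        rw [← mul_assoc, euler_mul_yPow, mul_add, add_mul, mul_smul_comm, mul_one, smul_mul_assoc,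
          euler, ← mul_assoc, ← yPow_add, mul_assoc, ← pow_succ']
        simp
      rw [mul_sub, ← pow_succ', he]
      abel
    rw [h]
    exact add_mem h1 (Submodule.smul_mem _ _ h2)

lemma scaledEuler_pow_sub_mem_orderLT (N : ℕ) :
    scaledEuler n ^ N - ((n : ℂ)⁻¹ ^ N) • (yPow n N * del n ^ N) ∈ orderLT n N := by
  rw [scaledEuler, _root_.smul_pow, ← smul_sub]
  exact Submodule.smul_mem _ _ (euler_pow_sub_mem_orderLT n N)

lemma scaledEuler_pow_mem_orderLT {N i : ℕ} (h : i < N) : scaledEuler n ^ i ∈ orderLT n N := by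
  have h1 := orderLT_mono n h.le (scaledEuler_pow_sub_mem_orderLT n i)
  have h2 := mem_orderLT_of_lt n h i 0
  rw [pow_zero, mul_one] at h2
  have := add_mem h1 (Submodule.smul_mem _ ((n : ℂ)⁻¹ ^ i) h2)
  rwa [sub_add_cancel] at this

lemma aeval_sub_mem_orderLT {N : ℕ} {f : ℂ[X]} (hf : f.natDegree ≤ N) :
    aeval (scaledEuler n) f - (f.coeff N * (n : ℂ)⁻¹ ^ N) • (yPow n N * del n ^ N) ∈
      orderLT n N := by
  rw [aeval_eq_sum_range' (Nat.lt_succ_of_le hf), Finset.sum_range_succ, add_sub_assoc, mul_smul,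
    ← smul_sub]
  exact add_mem (sum_mem fun i hi => Submodule.smul_mem _ _
    (scaledEuler_pow_mem_orderLT n (Finset.mem_range.mp hi)))
    (Submodule.smul_mem _ _ (scaledEuler_pow_sub_mem_orderLT n N))

/-- The Laurent polynomial `f(y)` such that an operator of order at most `N` has the form
`e f(y) ∂ ^ N` up to operators of smaller order. -/
noncomputable def leadingCoeff (N : ℕ) : (ℤ →₀ ℂ[X]) →ₗ[ℂ] (ℤ →₀ ℂ) :=
  Finsupp.lsum ℂ fun a =>
    ((n : ℂ)⁻¹ ^ N) • (Finsupp.lsingle ((N : ℤ) + n * -a) ∘ₗ lcoeff ℂ N)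

lemma leadingCoeff_single (N : ℕ) (a : ℤ) (f : ℂ[X]) : leadingCoeff n N (Finsupp.single a f) =
    Finsupp.single ((N : ℤ) + n * -a) (f.coeff N * (n : ℂ)⁻¹ ^ N) := by
  rw [leadingCoeff, Finsupp.lsum_single]
  simp [mul_comm]

lemma evalY_add (f g : ℤ →₀ ℂ) : evalY n (f + g) = evalY n f + evalY n g :=
  Finsupp.sum_add_index' (fun _ => zero_smul _ _) fun _ _ _ => add_smul _ _ _

lemma evalY_single (a : ℤ) (c : ℂ) : evalY n (Finsupp.single a c) = c • yPow n a :=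
  Finsupp.sum_single_index (zero_smul _ _)

variable [NeZero n]

lemma commute_idem_zero_yPow (a : ℤ) : Commute (idem n 0) (yPow n (n * a)) := by
  have h : Commute (gam n) (yPow n (n * a)) := by
    rw [commute_iff_eq, gam_mul_yPow, rootOfUnity_zpow_neg_mul, one_smul]
  refine (Commute.sum_left _ _ _ fun j _ => Commute.pow_left ?_ j).smul_left _
  exact h.smul_left _

/-- Only the coefficient of degree N matters modulo lower order, and e can be moved to the left
because it commutes with y^(-na) and with polynomials in y∂. -/
lemma opSum_sub_mem_orderLT {N : ℕ} {φ : ℤ →₀ ℂ[X]} (h : ∀ a, (φ a).natDegree ≤ N) :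
    opSum n φ - idem n 0 * evalY n (leadingCoeff n N φ) * del n ^ N ∈ orderLT n N := by
  have hmono : ∀ a : ℤ, ∀ f : ℂ[X], f.natDegree ≤ N → mono n (n * -a) f -
      idem n 0 * evalY n (leadingCoeff n N (Finsupp.single a f)) * del n ^ N ∈ orderLT n N := by
    intro a f hf
    have h1 := idem_mul_mem_orderLT n 0
      (yPow_mul_mem_orderLT n (n * -a) (aeval_sub_mem_orderLT n hf))
    convert h1 using 1
    rw [mul_sub, mul_sub, leadingCoeff_single, evalY_single, mono_apply, mul_assoc,
      ← (commute_idem_aeval n 0 f).eq, ← mul_assoc, ← (commute_idem_zero_yPow n (-a)).eq, mul_assoc]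
    congr 1
    rw [mul_smul_comm, smul_mul_assoc, mul_smul_comm, mul_smul_comm, add_comm, yPow_add]
    simp only [mul_assoc]
  induction φ using Finsupp.induction with
  | zero => simp [evalY]
  | single_add a f φ ha _ ih =>
    have hφ : ∀ b, (φ b).natDegree ≤ N := by
      intro b
      by_cases hb : b = a
      · subst hb
        rw [Finsupp.notMem_support_iff.mp ha]
        simp
      · have := h b
        rwa [Finsupp.add_apply, Finsupp.single_eq_of_ne hb, zero_add] at this
    have hf : f.natDegree ≤ N := by
      have := h a
      rwa [Finsupp.add_apply, Finsupp.single_eq_same, Finsupp.notMem_support_iff.mp ha,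
        add_zero] at this
    have := add_mem (hmono a f hf) (ih hφ)
    rw [map_add, map_add, opSum_single, evalY_add, mul_add, add_mul]
    convert this using 1
    abel

lemma coefAt_opSum (φ : ℤ →₀ ℂ[X]) (a t : ℤ) : coefAt n a t (opSum n φ) = (φ a).eval (t : ℂ) := by
  induction φ using Finsupp.induction_linear with
  | zero => simp
  | add φ ψ hφ hψ => simp [hφ, hψ]
  | single b f =>
    rw [opSum_single, coefAt_mono]
    by_cases h : a = b
    · subst h; simp
    · simp [h]

/-- The element y^b γ^j ∂^i sends y^(nt) to a multiple of y^(nt + b - i) by a product of i factors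
linear in t. So order below N forces matrix coefficients that are polynomials in t of degree below
N. -/
lemma exists_coefAt_eq {N : ℕ} {x : CrossedProduct n} (hx : x ∈ orderLT n N) (a : ℤ) :
    ∃ P : ℂ[X], P.degree < N ∧ ∀ t : ℤ, coefAt n a t x = P.eval (t : ℂ) := by
  induction hx using Submodule.span_induction with
  | mem x hx =>
    obtain ⟨b, j, i, hi, rfl⟩ := hx
    by_cases hd : b - i = n * -a
    · let P : ℂ[X] := ∏ s ∈ Finset.range i, (C (n : ℂ) * X + C ((1 : ℂ) + s - i))
      refine ⟨C ((rootOfUnity n ^ (i : ℤ)) ^ j) * P, ?_, fun t => ?_⟩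
      · have h1 : ∀ s ∈ Finset.range i, (C (n : ℂ) * X + C ((1 : ℂ) + s - i)).natDegree ≤ 1 :=
          fun s _ => natDegree_linear_le
        have h2 : P.natDegree ≤ i := by
          refine ((natDegree_prod_le _ _).trans (Finset.sum_le_sum h1)).trans ?_
          rw [Finset.sum_const, Finset.card_range, smul_eq_mul, mul_one]
        refine (degree_le_natDegree).trans_lt ?_
        exact_mod_cast ((natDegree_C_mul_le _ _).trans h2).trans_lt hi
      · have e1 : (n : ℤ) * t + n * -a - b = n * t + -i := by linarith
        -- γ acts after ∂^i, on degree nt - i, so its eigenvalue does not depend on t.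
        have hω : rootOfUnity n ^ (-((n : ℤ) * t + -i)) = rootOfUnity n ^ (i : ℤ) := by
          rw [neg_add, neg_neg, zpow_add₀ (rootOfUnity_ne_zero n), rootOfUnity_zpow_neg_mul,
            one_mul]
        rw [coefAt_apply, map_mul, map_mul, Module.End.mul_apply, Module.End.mul_apply, rep_yPow,
          rep_gam_pow, rep_del_pow, e1, hω, neg_add_cancel_right, Pi.single_eq_same, mul_one,
          eval_mul, eval_C, eval_prod]
        congr 1
        refine Finset.prod_congr rfl fun s _ => ?_
        simp only [eval_add, eval_mul, eval_C, eval_X]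
        push_cast
        ring
    · refine ⟨0, by simp, fun t => ?_⟩
      rw [coefAt_apply, map_mul, map_mul, Module.End.mul_apply, Module.End.mul_apply, rep_yPow,
          rep_gam_pow, rep_del_pow, Pi.single_apply, if_neg (by omega)]
      simp
  | zero => exact ⟨0, by simp, by simp⟩
  | add x y _ _ hx hy =>
    obtain ⟨P, hP, hP'⟩ := hx
    obtain ⟨Q, hQ, hQ'⟩ := hy
    exact ⟨P + Q, (degree_add_le _ _).trans_lt (max_lt hP hQ), fun t => by simp [hP', hQ']⟩
  | smul c x _ hx =>
    obtain ⟨P, hP, hP'⟩ := hx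
    exact ⟨c • P, (degree_smul_le _ _).trans_lt hP, fun t => by simp [hP']⟩

lemma eq_of_eval_intCast_eq {P Q : ℂ[X]} (h : ∀ t : ℤ, P.eval (t : ℂ) = Q.eval (t : ℂ)) :
    P = Q := by
  refine eq_of_infinite_eval_eq P Q (Set.Infinite.mono ?_
    (Set.infinite_range_of_injective (Int.cast_injective (α := ℂ))))
  rintro _ ⟨t, rfl⟩
  exact h t

/-- Polynomials agreeing at all integers are equal, so φ a is the polynomial of small degree given
by `exists_coefAt_eq`: the leading terms of `opSum` cannot drop in order. -/
lemma degree_lt_of_opSum_mem {N : ℕ} {φ : ℤ →₀ ℂ[X]} (h : opSum n φ ∈ orderLT n N) (a : ℤ) :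
    (φ a).degree < N := by
  obtain ⟨P, hP, hP'⟩ := exists_coefAt_eq n h a
  rwa [eq_of_eval_intCast_eq fun t => (coefAt_opSum n φ a t).symm.trans (hP' t)]

lemma opSum_injective : Function.Injective (opSum n) := by
  intro φ ψ h
  ext1 a
  refine eq_of_eval_intCast_eq fun t => ?_
  rw [← coefAt_opSum n, h, coefAt_opSum]

end OrderFiltration

/-! ### The symbol map on the associated graded space and its image -/

section SymbolMap

open Polynomial

variable (n : ℕ)

/-- The symbol of order `N` of the operator `opSum n φ`, in the coordinates `x = u v` and
`z = v ^ n`. -/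
noncomputable def symb (N : ℕ) : (ℤ →₀ ℂ[X]) →ₗ[ℂ] TorusRing :=
  Finsupp.lsum ℂ fun a =>
    ((n : ℂ)⁻¹ ^ N) • (AddMonoidAlgebra.lsingle ((N : ℤ) + n * -a, a) ∘ₗ lcoeff ℂ N)

lemma symb_single (N : ℕ) (a : ℤ) (f : ℂ[X]) : symb n N (Finsupp.single a f) =
    AddMonoidAlgebra.single ((N : ℤ) + n * -a, a) (f.coeff N * (n : ℂ)⁻¹ ^ N) := by
  rw [symb, Finsupp.lsum_single]
  simp [mul_comm]

lemma coeff_symb (N : ℕ) (φ : ℤ →₀ ℂ[X]) (m : ℤ × ℤ) : (symb n N φ).coeff m =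
    if m.1 + n * m.2 = N then (φ m.2).coeff N * (n : ℂ)⁻¹ ^ N else 0 := by
  induction φ using Finsupp.induction_linear with
  | zero => simp
  | add φ ψ hφ hψ =>
    rw [map_add, AddMonoidAlgebra.coeff_add, Finsupp.add_apply, hφ, hψ]
    split_ifs <;> simp [add_mul]
  | single a f =>
    obtain ⟨m₁, m₂⟩ := m
    rw [symb_single, AddMonoidAlgebra.coeff_single, Finsupp.single_apply]
    by_cases h : a = m₂
    · subst h
      have : ((N : ℤ) + n * -a, a) = (m₁, a) ↔ m₁ + n * a = N := by
        rw [Prod.mk.injEq]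
        constructor
        · rintro ⟨rfl, -⟩; ring
        · intro h; exact ⟨by rw [← h]; ring, rfl⟩
      simp only [this, Finsupp.single_eq_same]
    · rw [if_neg (by simp [h]), Finsupp.single_eq_of_ne (Ne.symm h)]
      simp

lemma symbol_add (f g : ℤ →₀ ℂ) (N : ℕ) : symbol (f + g) N = symbol f N + symbol g N :=
  Finsupp.sum_add_index' (fun _ => AddMonoidAlgebra.single_zero _)
    fun _ _ _ => AddMonoidAlgebra.single_add _ _ _

lemma symbol_single (a : ℤ) (c : ℂ) (N : ℕ) :
    symbol (Finsupp.single a c) N = AddMonoidAlgebra.single (a, (N : ℤ)) c :=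
  Finsupp.sum_single_index (AddMonoidAlgebra.single_zero _)

lemma toSymbol_symb (N : ℕ) (φ : ℤ →₀ ℂ[X]) :
    toSymbol n (symb n N φ) = symbol (leadingCoeff n N φ) N := by
  induction φ using Finsupp.induction_linear with
  | zero => simp [symbol]
  | add φ ψ hφ hψ => rw [map_add, map_add, map_add, hφ, hψ, symbol_add]
  | single a f =>
    rw [symb_single, leadingCoeff_single, symbol_single]
    simp [toSymbol]

lemma gradedSpan_le_range_opSum {n : ℕ} (G : ℤ → ℂ[X]) :
    gradedSpan n G ≤ LinearMap.range (opSum n) := by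
  intro β hβ
  obtain ⟨φ, -, h⟩ := exists_opSum_eq n hβ
  exact ⟨φ, h⟩

variable [NeZero n]

lemma symb_eq_zero_iff {N : ℕ} {φ : ℤ →₀ ℂ[X]} :
    symb n N φ = 0 ↔ ∀ a, (φ a).coeff N = 0 := by
  have hn : (n : ℂ) ≠ 0 := NeZero.ne _
  constructor
  · intro h a
    have := coeff_symb n N φ ((N : ℤ) + n * -a, a)
    rw [h, if_pos (by ring)] at this
    simpa [hn] using this.symm
  · intro h
    ext m
    rw [coeff_symb]
    simp [h]

lemma opSum_mem_orderLT {N : ℕ} {φ : ℤ →₀ ℂ[X]} (h : ∀ a, (φ a).natDegree ≤ N)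
    (h' : ∀ a, (φ a).coeff N = 0) : opSum n φ ∈ orderLT n N := by
  have h1 := opSum_sub_mem_orderLT n h
  have h2 : leadingCoeff n N φ = 0 := by
    rw [leadingCoeff, Finsupp.lsum_apply, Finsupp.sum]
    exact Finset.sum_eq_zero fun a _ => by simp [h']
  rw [h2] at h1
  simpa [evalY] using h1

variable {n} {B : Submodule ℂ (CrossedProduct n)} (hB : B ≤ LinearMap.range (opSum n))

/-- The coefficients `φ` of an operator `opSum n φ` which lies in `B`. -/
noncomputable def opCoords (N : ℕ) : ↥(B ⊓ orderLE n N) →ₗ[ℂ] ℤ →₀ ℂ[X] :=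
  (LinearEquiv.ofInjective (opSum n) (opSum_injective n)).symm.toLinearMap ∘ₗ
    Submodule.inclusion (inf_le_left.trans hB)

lemma opSum_opCoords (N : ℕ) (β : ↥(B ⊓ orderLE n N)) : opSum n (opCoords hB N β) = β :=
  congrArg Subtype.val ((LinearEquiv.ofInjective (opSum n) (opSum_injective n)).apply_symm_apply
    (Submodule.inclusion (inf_le_left.trans hB) β))

lemma natDegree_opCoords_le (N : ℕ) (β : ↥(B ⊓ orderLE n N)) (a : ℤ) :
    (opCoords hB N β a).natDegree ≤ N := by
  have h : opSum n (opCoords hB N β) ∈ orderLT n (N + 1) := by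
    rw [opSum_opCoords]
    exact β.2.2
  have h1 := degree_lt_of_opSum_mem n h a
  refine natDegree_le_iff_coeff_eq_zero.mpr fun N' hN' => ?_
  exact coeff_eq_zero_of_degree_lt (h1.trans_le (by exact_mod_cast hN'))

lemma symb_opCoords_eq_zero_iff (N : ℕ) (β : ↥(B ⊓ orderLE n N)) :
    symb n N (opCoords hB N β) = 0 ↔ (β : CrossedProduct n) ∈ orderLT n N := by
  rw [symb_eq_zero_iff]
  constructor
  · intro h
    have h1 := opSum_mem_orderLT n (natDegree_opCoords_le hB N β) h
    rwa [opSum_opCoords] at h1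
  · intro h a
    rw [← opSum_opCoords hB] at h
    exact coeff_eq_zero_of_degree_lt (degree_lt_of_opSum_mem n h a)

/-- The symbol map on a graded piece of `gr B`. -/
noncomputable def grPieceSymb (N : ℕ) : GrPiece B N →ₗ[ℂ] TorusRing :=
  Submodule.liftQ _ (symb n N ∘ₗ opCoords hB N)
    fun β hβ => (symb_opCoords_eq_zero_iff hB N β).mpr hβ

lemma grPieceSymb_mk (N : ℕ) (β : ↥(B ⊓ orderLE n N)) :
    grPieceSymb hB N (Submodule.Quotient.mk β) = symb n N (opCoords hB N β) := rfl

lemma grPieceSymb_injective (N : ℕ) : Function.Injective (grPieceSymb hB N) := by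
  rw [← LinearMap.ker_eq_bot]
  exact Submodule.ker_liftQ_eq_bot _ _ _ fun β hβ => (symb_opCoords_eq_zero_iff hB N β).mp hβ

lemma coeff_grPieceSymb (N : ℕ) (x : GrPiece B N) {m : ℤ × ℤ} (hm : m.1 + n * m.2 ≠ N) :
    (grPieceSymb hB N x).coeff m = 0 := by
  induction x using Submodule.Quotient.induction_on with
  | H β => rw [grPieceSymb_mk, coeff_symb, if_neg hm]

/-- The symbol map on `gr B`. -/
noncomputable def grSymb : Gr B →ₗ[ℂ] TorusRing :=
  DirectSum.toModule ℂ ℕ TorusRing (grPieceSymb hB)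

lemma grSymb_grClass (N : ℕ) (β : ↥(B ⊓ orderLE n N)) :
    grSymb hB (grClass B N β) = symb n N (opCoords hB N β) :=
  DirectSum.toModule_lof ℂ N _

lemma coeff_grSymb (x : Gr B) {m : ℤ × ℤ} {N : ℕ} (hm : m.1 + n * m.2 = N) :
    (grSymb hB x).coeff m = (grPieceSymb hB N (x N)).coeff m := by
  induction x using DirectSum.induction_on with
  | zero => simp
  | of N' x =>
    have h : grSymb hB (DirectSum.of (GrPiece B) N' x) = grPieceSymb hB N' x :=
      DirectSum.toModule_lof ℂ N' x
    rw [h]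
    by_cases hN : N' = N
    · subst hN
      rw [DirectSum.of_eq_same]
    · rw [DirectSum.of_eq_of_ne _ _ _ (Ne.symm hN), map_zero,
        coeff_grPieceSymb hB N' x (by omega)]
      rfl
  | add x y hx hy =>
    rw [map_add, AddMonoidAlgebra.coeff_add, Finsupp.add_apply, hx, hy, DirectSum.add_apply,
      map_add, AddMonoidAlgebra.coeff_add, Finsupp.add_apply]

/-- Symbols of order N have their exponents on the line m₁ + n m₂ = N. Distinct pieces thus have
disjoint supports, and injectivity on each piece suffices. -/
lemma grSymb_injective : Function.Injective (grSymb hB) := by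
  intro x y h
  ext1 N
  apply grPieceSymb_injective hB N
  ext m
  by_cases hm : m.1 + n * m.2 = N
  · rw [← coeff_grSymb hB x hm, ← coeff_grSymb hB y hm, h]
  · rw [coeff_grPieceSymb hB N _ hm, coeff_grPieceSymb hB N _ hm]

lemma dvd_opCoords {G : ℤ → ℂ[X]} (N : ℕ) (β : ↥(gradedSpan n G ⊓ orderLE n N)) (a : ℤ) :
    G a ∣ opCoords (gradedSpan_le_range_opSum G) N β a := by
  obtain ⟨φ, hφ, h⟩ := exists_opSum_eq n β.2.1
  have : opCoords (gradedSpan_le_range_opSum G) N β = φ :=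
    opSum_injective n ((opSum_opCoords _ N β).trans h.symm)
  rw [this]
  exact hφ a

/-- A nonzero coefficient comes from a nonzero multiple of G m₂ of degree at most N = m₁ + n m₂. -/
lemma natDegree_le_of_coeff_grSymb {G : ℤ → ℂ[X]} (x : Gr (gradedSpan n G)) {m : ℤ × ℤ}
    (hm : (grSymb (gradedSpan_le_range_opSum G) x).coeff m ≠ 0) :
    ((G m.2).natDegree : ℤ) ≤ m.1 + n * m.2 := by
  induction x using DirectSum.induction_on with
  | zero => simp at hm
  | of N x =>
    induction x using Submodule.Quotient.induction_on with
    | H β =>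
      change (grSymb _ (grClass _ N β)).coeff m ≠ 0 at hm
      rw [grSymb_grClass, coeff_symb] at hm
      split_ifs at hm with h
      · have h1 := natDegree_le_of_dvd (dvd_opCoords N β m.2) (by
          intro h0
          rw [h0] at hm
          simp at hm)
        have h2 := natDegree_opCoords_le (gradedSpan_le_range_opSum G) N β m.2
        omega
      · exact absurd rfl hm
  | add x y hx hy =>
    rw [map_add, AddMonoidAlgebra.coeff_add, Finsupp.add_apply] at hm
    by_cases h : (grSymb (gradedSpan_le_range_opSum G) x).coeff m = 0
    · rw [h, zero_add] at hm
      exact hy hm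
    · exact hx h

lemma single_mem_range_grSymb {G : ℤ → ℂ[X]} (hG : ∀ a, (G a).Monic) {m : ℤ × ℤ}
    (hm : ((G m.2).natDegree : ℤ) ≤ m.1 + n * m.2) (c : ℂ) :
    AddMonoidAlgebra.single m c ∈
      LinearMap.range (grSymb (gradedSpan_le_range_opSum (n := n) G)) := by
  have hn : (n : ℂ) ≠ 0 := NeZero.ne _
  obtain ⟨m₁, a⟩ := m
  obtain ⟨N, hN⟩ := Int.eq_ofNat_of_zero_le ((Int.natCast_nonneg _).trans hm)
  obtain ⟨d, hd⟩ : ∃ d, N = (G a).natDegree + d := Nat.exists_eq_add_of_le (by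
    simp only at hm hN
    omega)
  -- X^d raises the monic generator to degree N, and n^N cancels the factor n^(-N) in `symb`.
  let f : ℂ[X] := G a * (C (c * (n : ℂ) ^ N) * X ^ d)
  have hf : f.natDegree ≤ N := by
    rw [hd]
    exact natDegree_mul_le.trans (Nat.add_le_add_left (natDegree_C_mul_X_pow_le _ _) _)
  have hfc : f.coeff N = c * (n : ℂ) ^ N := by
    rw [hd, coeff_mul_add_eq_of_natDegree_le le_rfl (natDegree_C_mul_X_pow_le _ _),
      (hG a).coeff_natDegree, coeff_C_mul_X_pow, if_pos rfl, one_mul, ← hd]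
  have hφ : ∀ b, (Finsupp.single a f b).natDegree ≤ N := by
    intro b
    by_cases hb : b = a
    · subst hb; simpa using hf
    · simp [Finsupp.single_eq_of_ne hb]
  have h1 : opSum n (Finsupp.single a f) ∈ gradedSpan n G := by
    rw [opSum_single]
    exact mono_mem_gradedSpan (dvd_mul_right _ _)
  have h2 : opSum n (Finsupp.single a f) ∈ orderLE n N := opSum_mem_orderLT n
    (fun b => (hφ b).trans (Nat.le_succ N)) fun b =>
    coeff_eq_zero_of_natDegree_lt (Nat.lt_succ_of_le (hφ b))
  refine ⟨grClass _ N ⟨_, h1, h2⟩, ?_⟩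
  have h3 : opCoords (gradedSpan_le_range_opSum G) N ⟨_, h1, h2⟩ = Finsupp.single a f :=
    opSum_injective n (opSum_opCoords _ N _)
  rw [grSymb_grClass, h3, symb_single, hfc, mul_assoc, ← mul_pow, mul_inv_cancel₀ hn, one_pow,
    mul_one]
  congr 2
  simp only at hN
  linarith

lemma range_grSymb {G : ℤ → ℂ[X]} (hG : ∀ a, (G a).Monic) :
    Set.range (grSymb (gradedSpan_le_range_opSum (n := n) G)) =
      {q | ∀ m, q.coeff m ≠ 0 → ((G m.2).natDegree : ℤ) ≤ m.1 + n * m.2} := by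
  ext q
  constructor
  · rintro ⟨x, rfl⟩ m hm
    exact natDegree_le_of_coeff_grSymb x hm
  · intro hq
    rw [← LinearMap.coe_range, SetLike.mem_coe, ← AddMonoidAlgebra.sum_coeff_single q]
    exact Submodule.sum_mem _ fun m hm =>
      single_mem_range_grSymb hG (hq m (Finsupp.mem_support_iff.mp hm)) _

end SymbolMap

/-! ### Degrees of the generators against the inequalities of the divisor -/

section Lattice

open Polynomial

variable {n : ℕ}

/-- The sum `b_{i+1} + ⋯ + b_{n-1}`, which is the entry of `n⁻¹ F(b)` at `i`. -/
def latticeMult (b : Fin (n - 1) → ℕ) (i : ℕ) : ℕ :=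
  ∑ p : Fin (n - 1), if i ≤ (p : ℕ) then b p else 0

lemma latticeMult_antitone (b : Fin (n - 1) → ℕ) : Antitone (latticeMult b) := by
  intro i j hij
  refine Finset.sum_le_sum fun p _ => ?_
  split_ifs <;> omega

lemma latticeF_apply (b : Fin (n - 1) → ℕ) (q : Fin (n - 1)) :
    latticeF b q = n * (latticeMult b q : ℂ) := by
  rw [latticeF, Finset.sum_apply, latticeMult, Nat.cast_sum, Finset.mul_sum]
  refine Finset.sum_congr rfl fun p _ => ?_
  simp only [Pi.smul_apply, wVec, Fin.le_def]
  split_ifs <;> simp [mul_comm]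

lemma latticeMult_of_le (b : Fin (n - 1) → ℕ) {i : ℕ} (h : n - 1 ≤ i) : latticeMult b i = 0 :=
  Finset.sum_eq_zero fun p _ => if_neg (by omega)

lemma sum_wVec_apply (l : List (Fin (n - 1))) (q : Fin (n - 1)) :
    (l.map wVec).sum q = n * (l.countP (fun p : Fin (n - 1) => (q : ℕ) ≤ p) : ℂ) := by
  induction l with
  | nil => simp
  | cons p l ih =>
    rw [List.map_cons, List.sum_cons, Pi.add_apply, ih, List.countP_cons]
    simp only [wVec, Fin.le_def, decide_eq_true_eq]
    split_ifs <;> push_cast <;> ring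

lemma sum_latticeMult (b : Fin (n - 1) → ℕ) (s : ℕ) :
    ∑ i ∈ Finset.range s, (latticeMult b i : ℤ) = ∑ p, (b p : ℤ) * min ((p : ℤ) + 1) s := by
  simp only [latticeMult, Nat.cast_sum]
  rw [Finset.sum_comm]
  refine Finset.sum_congr rfl fun p _ => ?_
  induction s with
  | zero => simp; right; omega
  | succ s ih =>
    rw [Finset.sum_range_succ, ih]
    split_ifs with h
    · rw [min_eq_right (by omega), min_eq_right (by omega)]
      push_cast; ring
    · rw [min_eq_left (by omega), min_eq_left (by omega)]
      simp

/-- Termwise, p + 1 - max(0, p + 1 - (n - j)) = min(p + 1, n - j), which counts the i < n - j with i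
≤ p. -/
lemma weight_sub_divisorCoeff (b : Fin (n - 1) → ℕ) (j : Fin (n + 1)) :
    (weight b : ℤ) - divisorCoeff b j = ∑ i ∈ Finset.range (n - j), (latticeMult b i : ℤ) := by
  rw [sum_latticeMult, weight, divisorCoeff, Nat.cast_sum, ← Finset.sum_sub_distrib]
  refine Finset.sum_congr rfl fun p _ => ?_
  have hj := j.2
  rw [Nat.cast_sub (by omega)]
  push_cast
  rw [mul_comm _ (b p : ℤ), ← mul_sub]
  congr 1
  omega

lemma exists_sum_max_eq {f : ℕ → ℤ} (hf : Antitone f) (n : ℕ) :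
    ∃ s ≤ n, ∑ i ∈ Finset.range n, max 0 (f i) = ∑ i ∈ Finset.range s, f i := by
  induction n with
  | zero => exact ⟨0, le_rfl, rfl⟩
  | succ n ih =>
    rcases le_total (f n) 0 with h | h
    · obtain ⟨s, hs, h'⟩ := ih
      exact ⟨s, by omega, by rw [Finset.sum_range_succ, h', max_eq_left h, add_zero]⟩
    · refine ⟨n + 1, le_rfl, Finset.sum_congr rfl fun i hi => max_eq_right (h.trans (hf ?_))⟩
      have := Finset.mem_range.mp hi
      omega

/-- For a decreasing sequence the positive terms form an initial segment, so the sum of positive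
parts is the largest partial sum. -/
lemma sum_max_le_iff {f : ℕ → ℤ} (hf : Antitone f) (n : ℕ) (N : ℤ) :
    ∑ i ∈ Finset.range n, max 0 (f i) ≤ N ↔ ∀ s ≤ n, ∑ i ∈ Finset.range s, f i ≤ N := by
  constructor
  · intro h s hs
    refine le_trans (Finset.sum_le_sum fun i _ => le_max_right 0 (f i)) (le_trans ?_ h)
    exact Finset.sum_le_sum_of_subset_of_nonneg (Finset.range_mono hs) fun _ _ _ => le_max_left _ _
  · intro h
    obtain ⟨s, hs, h'⟩ := exists_sum_max_eq hf n
    exact h' ▸ h s hs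

/-- The partial sum over i < s with s = n - j is the inequality for D_j, once the exponent is
shifted by the weight. -/
lemma forall_divisorCoeff_le_iff (b : Fin (n - 1) → ℕ) (m : ℤ × ℤ) :
    (∀ j : Fin (n + 1), -divisorCoeff b j ≤ pair (m + (-(weight b : ℤ), 0)) j) ↔
      ∑ i : Fin n, max 0 (m.2 + latticeMult b i) ≤ m.1 + n * m.2 := by
  have hf : Antitone fun i => m.2 + (latticeMult b i : ℤ) := fun i j hij => by
    have := latticeMult_antitone b hij
    simp only
    omega
  rw [Fin.sum_univ_eq_sum_range fun i => max 0 (m.2 + (latticeMult b i : ℤ)), sum_max_le_iff hf]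
  have key : ∀ j : Fin (n + 1), -divisorCoeff b j ≤ pair (m + (-(weight b : ℤ), 0)) j ↔
      ∑ i ∈ Finset.range (n - j), (m.2 + (latticeMult b i : ℤ)) ≤ m.1 + n * m.2 := by
    intro j
    have hj := j.2
    rw [Finset.sum_add_distrib, ← weight_sub_divisorCoeff, Finset.sum_const, Finset.card_range,
      nsmul_eq_mul, Nat.cast_sub (by omega), sub_mul]
    simp only [pair, Prod.fst_add, Prod.snd_add]
    constructor <;> intro h <;> linarith
  constructor
  · intro h s hs
    have := (key ⟨n - s, by omega⟩).mp (h _)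
    rwa [show n - (n - s) = s by omega] at this
  · exact fun h j => (key j).mpr (h _ (Nat.sub_le _ _))

lemma monic_shiftProd (α : ℂ) (s t : ℤ) : (shiftProd α s t).Monic :=
  monic_prod_of_monic _ _ fun _ _ => monic_X_sub_C _

lemma natDegree_shiftProd (α : ℂ) (t : ℤ) : ((shiftProd α 0 t).natDegree : ℤ) = max 0 t := by
  rw [shiftProd, natDegree_prod_of_monic _ _ fun _ _ => monic_X_sub_C _]
  simp only [natDegree_X_sub_C, Finset.sum_const, Int.card_Ico, smul_eq_mul]
  omega

lemma monic_rootProd (α : Fin n → ℂ) (m : Fin n → ℕ) (a : ℤ) : (rootProd α m a).Monic :=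
  monic_prod_of_monic _ _ fun _ _ => monic_shiftProd _ _ _

lemma natDegree_rootProd (α : Fin n → ℂ) (m : Fin n → ℕ) (a : ℤ) :
    ((rootProd α m a).natDegree : ℤ) = ∑ i, max 0 (a + m i) := by
  rw [rootProd, natDegree_prod_of_monic _ _ fun _ _ => monic_shiftProd _ _ _, Nat.cast_sum]
  exact Finset.sum_congr rfl fun i _ => natDegree_shiftProd _ _

variable [NeZero n]

/-- The multiplicities depend only on the sum of the steps, hence not on the chain. -/
lemma listMult_eq_latticeMult {l : List (Fin (n - 1))} {b : Fin (n - 1) → ℕ}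
    (h : (l.map wVec).sum = latticeF b) (i : Fin n) : listMult l i = latticeMult b i := by
  have hn : (n : ℂ) ≠ 0 := NeZero.ne _
  by_cases hi : (i : ℕ) < n - 1
  · have h1 := congrFun h ⟨i, hi⟩
    rw [sum_wVec_apply, latticeF_apply] at h1
    exact_mod_cast mul_left_cancel₀ hn h1
  · rw [latticeMult_of_le b (by omega), listMult, List.countP_eq_zero]
    intro p _
    simp only [decide_eq_true_eq]
    omega

lemma rootParam_add_latticeF (k : Fin (n - 1) → ℂ) (c : Fin (n - 1) → ℕ) (i : Fin n) :
    rootParam (k + latticeF c) i = rootParam k i + latticeMult c i := by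
  have hn : (n : ℂ) ≠ 0 := NeZero.ne _
  apply mul_left_cancel₀ hn
  rw [mul_add, mul_rootParam, mul_rootParam]
  by_cases h : (i : ℕ) < n - 1
  · rw [dif_pos h, dif_pos h, Pi.add_apply, latticeF_apply, add_assoc]
  · rw [dif_neg h, dif_neg h, latticeMult_of_le c (by omega), Nat.cast_zero, mul_zero, add_zero,
      add_zero]

lemma dominantParam_add_latticeF {k : Fin (n - 1) → ℂ} (hk : IsDominant k)
    (c : Fin (n - 1) → ℕ) : DominantParam (rootParam (k + latticeF c)) := by
  have h : rootParam (k + latticeF c) = fun i : Fin n => rootParam k i + latticeMult c i :=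
    funext (rootParam_add_latticeF k c)
  rw [h]
  exact (dominantParam_rootParam hk).add fun i j hij => latticeMult_antitone c hij

end Lattice

/-! ### Matching symbols with sections -/

section Comparison

variable {n : ℕ} [NeZero n]

lemma single_mul_single_neg (w : ℤ) (q : TorusRing) :
    AddMonoidAlgebra.single (w, 0) (1 : ℂ) * (AddMonoidAlgebra.single (-w, 0) 1 * q) = q := by
  rw [← mul_assoc, AddMonoidAlgebra.single_mul_single]
  simp [single_zero_one]

variable (n) in
/-- The embedding of the coordinate ring of the torus into the function field. -/
noncomputable def toRationalHom : TorusRing →ₐ[ℂ] (ToricSurface n).functionField :=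
  { toRational n with commutes' := fun _ => rfl }

/-- The symbol map of `gr B`, divided by `x ^ w`, as a map to the function field. -/
noncomputable def grToRational {B : Submodule ℂ (CrossedProduct n)}
    (hB : B ≤ LinearMap.range (opSum n)) (w : ℤ) : Gr B →ₗ[ℂ] (ToricSurface n).functionField :=
  (toRationalHom n).toLinearMap ∘ₗ
    LinearMap.mulLeft ℂ (AddMonoidAlgebra.single (-w, 0) 1) ∘ₗ grSymb hB

lemma grToRational_apply {B : Submodule ℂ (CrossedProduct n)}
    (hB : B ≤ LinearMap.range (opSum n)) (w : ℤ) (x : Gr B) : grToRational hB w x =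
      toRational n (AddMonoidAlgebra.single (-w, 0) 1 * grSymb hB x) := rfl

lemma single_mul_grToRational {B : Submodule ℂ (CrossedProduct n)}
    (hB : B ≤ LinearMap.range (opSum n)) (w : ℤ) (x : Gr B) :
    toRational n (AddMonoidAlgebra.single (w, 0) 1) * grToRational hB w x =
      toRational n (grSymb hB x) := by
  rw [grToRational_apply, ← map_mul, single_mul_single_neg]

lemma grToRational_injective {B : Submodule ℂ (CrossedProduct n)}
    (hB : B ≤ LinearMap.range (opSum n)) (w : ℤ) : Function.Injective (grToRational hB w) := by
  intro x y h
  apply grSymb_injective hB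
  apply toRational_injective (n := n)
  rw [← single_mul_grToRational hB w, h, single_mul_grToRational]

lemma range_grToRational {α : Fin n → ℂ} {m : Fin n → ℕ} {b : Fin (n - 1) → ℕ}
    (hm : ∀ i, m i = latticeMult b i) :
    Set.range (grToRational (gradedSpan_le_range_opSum (n := n) (rootProd α m)) (weight b)) =
      globalSections (divisor b) := by
  have h1 := range_grSymb (n := n) (monic_rootProd α m)
  simp only [natDegree_rootProd, hm, ← forall_divisorCoeff_le_iff b] at h1
  rw [globalSections_divisor]
  ext f
  constructor
  · rintro ⟨x, rfl⟩
    have hx := (Set.ext_iff.mp h1 _).mp ⟨x, rfl⟩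
    refine ⟨AddMonoidAlgebra.single (-(weight b : ℤ), 0) 1 * grSymb _ x, fun m hm => ?_,
      (grToRational_apply _ _ x).symm⟩
    rw [coeff_single_one_mul] at hm
    have := hx _ hm
    rwa [sub_add_cancel] at this
  · rintro ⟨q, hq, rfl⟩
    obtain ⟨x, hx⟩ := (Set.ext_iff.mp h1 (AddMonoidAlgebra.single ((weight b : ℤ), 0) 1 * q)).mpr
      fun m hm => by
        rw [coeff_single_one_mul] at hm
        have := hq _ hm
        rwa [sub_eq_add_neg, Prod.neg_mk, neg_zero] at this
    refine ⟨x, ?_⟩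
    rw [grToRational_apply, hx]
    have := single_mul_single_neg (-(weight b : ℤ)) q
    rw [neg_neg] at this
    rw [this]

end Comparison

end Kleinian

theorem mainTheorem2 (n : ℕ) [NeZero n] (k r r' : Fin (n - 1) → ℂ) (hk : IsDominant k)
    (c b : Fin (n - 1) → ℕ) (hr : r = k + latticeF c) (hr' : r' = r + latticeF b)
    (l : List (Fin (n - 1))) (hl : r + (l.map wVec).sum = r') :
    ∃ Ψ : Gr (bimodule r l) →ₗ[ℂ] (ToricSurface n).functionField,
      Function.Injective Ψ ∧
      Set.range Ψ = globalSections (divisor b) ∧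
      ∀ (N : ℕ) (β : ↥(bimodule r l ⊓ orderLE n N)),
        ∃ (f : ℤ →₀ ℂ) (q : TorusRing),
          (β : CrossedProduct n) - idem n 0 * evalY n f * del n ^ N ∈ orderLT n N ∧
          toSymbol n q = symbol f N ∧
          toRational n (AddMonoidAlgebra.single ((weight b : ℤ), 0) 1) *
            Ψ (grClass (bimodule r l) N β) = toRational n q := by
  have hlb : (l.map wVec).sum = latticeF b := add_left_cancel (hl.trans hr')
  subst hr
  rw [bimodule_eq_gradedSpan l _ (dominantParam_add_latticeF hk c)]
  have hB := gradedSpan_le_range_opSum (n := n) (rootProd (rootParam (k + latticeF c)) (listMult l))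
  -- Both witnesses come from the same coordinates of β: the leading coefficient in y, and the
  -- symbol written in x and z.
  refine ⟨grToRational hB (weight b), grToRational_injective hB _,
    range_grToRational (listMult_eq_latticeMult hlb), fun N β =>
      ⟨leadingCoeff n N (opCoords hB N β), symb n N (opCoords hB N β), ?_, toSymbol_symb n N _, ?_⟩⟩
  · have h := opSum_sub_mem_orderLT n (natDegree_opCoords_le hB N β)
    rwa [opSum_opCoords] at h
  · rw [single_mul_grToRational, grSymb_grClass]
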